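/- Let $\varphi$ be an orientation-preserving homeomorphism of the once-punctured torus $\Sigma_{1,1}=(\mathbb R^2\setminus\mathbb Z^2)/\mathbb Z^2$ whose isotopy class is pseudo-Anosov, i.e. whose action on $H_1(\Sigma_{1,1};\mathbb Z)=\mathbb Z^2$ is a matrix in $SL_2(\mathbb Z)$ with $|\mathrm{tr}|>2$. Let $L=\begin{pmatrix}1&0\\1&1\end{pmatrix}$ and $R=\begin{pmatrix}1&1\\0&1\end{pmatrix}$. Then up to isotopy and conjugation $\varphi=\pm\varphi_1\cdots\varphi_N$ with $\varphi_i\in\{L,R\}$ (indices in $\mathbb Z/N$), $\varphi_1=L$, $\varphi_N=R$, and for every such decomposition the following holds. **Triangulation.** The mapping torus $M_\varphi$ has the layered ideal triangulation with oriented tetrahedra $T_1,\dots,T_N$ (vertices $0,1,2,3$; shape $z_i$ at the edges $01,23$, $z_i'=1/(1-z_i)$ at $02,13$, $z_i''=1-1/z_i$ at $03,12$), in which the faces $023$, $120$ of $T_{i-1}$ are glued to the faces $013$, $123$ of $T_i$ if $\varphi_i=L$, and the faces $012$, $023$ of $T_{i-1}$ to the faces $013$, $123$ of $T_i$ if $\varphi_i=R$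 (vertices matched in the listed order; for the sign $-$, the gluing of $T_N$ to $T_1$ is composed with the exchange of the vertices $0\leftrightarrow2$, $1\leftrightarrow3$ of $T_1$). Its $N$ edges are $E_1,\dots,E_N$, with $E_i$ the class of the edge $02$ of $T_{i-1}$. Let $z=(z_1,\dots,z_N)$, $\mathrm{Im}\,z_i>0$, be the shapes of the complete hyperbolic structure: the logarithmic gluing equation $\sum_j(G_{ij}\log z_j+G'_{ij}\log z_j'+G''_{ij}\log z_j'')=2\pi\mathsf i$ holds at every edge $E_i$, where $G^\square_{ij}$ is the number of edges of $T_j$ labelled $z_j^\square$ that lie around $E_i$, and the halved equation of the longitude $\lambda$ (the boundary of the fibre), $\log z_N-\log z_{N-1}'-\log z_N''+\log z_1'=0$, holds. Replace the row of one edge $E_p$ in $G,G',G''$ by the coefficients of this halved longitude equation, let $\eta^{\rm gl}$ be the vector with entries $2$ at the remaining edge rows and $0$ at the row $p$, and put $A=G'-G''$, $B=G-G''$, $\nu=\eta^{\rm gl}-G''(1,\dots,1)^t$. A flattening is a pair $f,f'\in\mathbb Z^N$ with $Af'+Bf=\nu$. Flattenings exist; fix one. The matrix $\frac12B$ is unimodular;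 put $\eta=2B^{-1}\nu$. **1-loop invariant.** For a root of unity $\zeta=e^{2\pi\mathsf ia/n}$ of odd order $n$, $(a,n)=1$, let $\mathcal D_\zeta(x)=\exp\big(-\mathsf i\pi s(a,n)+\sum_{j=1}^{n-1}\frac jn\log(1-\zeta^jx)\big)$ with the Dedekind sum $s(a,n)$, and $(x;q)_k=\prod_{j=0}^{k-1}(1-q^jx)$. Choose $\theta_i$ with $\theta_i^n=z_i'$. The number $$\tau_{M_\varphi,\lambda}(1)=\Big(\det\big(A\,\mathrm{diag}(z)+B\,\mathrm{diag}(1/z')\big)\prod_i z_i'^{\,f_i}z_i^{-f_i'}\Big)^{-1/2}$$ is well-defined up to sign and nonzero, and for $m\in\mathbb Z$ $$\frac{\tau_{M_\varphi,\lambda,m}(\zeta)}{\tau_{M_\varphi,\lambda}(1)}=\frac{\prod_i\mathcal D_{\zeta^{-1}}(\theta_i^{-1})}{n^{N/2}\prod_iz_i'^{\,\frac{1-n}{2n}f_i}z_i^{\frac{n-1}{2n}f_i'}}\sum_{k\in(\mathbb Z/n)^N}(-1)^{k^t\eta}\,\zeta^{\frac12[4k^tB^{-1}Ak+2k^tB^{-1}(\nu-2me_p)]}\prod_i\frac{\theta_i^{-(2B^{-1}Ak)_i}}{(\zeta\theta_i^{-1};\zeta)_{2k_i}},$$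 with $\frac12$ in the exponent of $\zeta$ (and of $q$ below) meaning the inverse of $2$ modulo $n$ and $e_p$ the unit vector of the longitude row. **BWY invariant.** For $q=e^{2\pi\mathsf ia/n}$ of odd order $n$ let $\mathcal F_L=\frac1{\sqrt n}(q^{ij})$, $\mathcal F_R=\frac1{\sqrt n}(q^{\frac12(i-j)^2})$, $i,j\in\mathbb Z/n$; let $\beta_i=-1,1,0$ if $\varphi_i\varphi_{i+1}$ is $LR$, $RL$, or otherwise; let $a_i=-q^{-1}\exp(\frac1n\log z_i')$, $d_i=q^{m\beta_i-\frac12\eta_i}\exp\big(\frac{1-n^2}{2n}\pi\mathsf i\eta_i-\frac1n\log z_i\big)$, $D_i=\mathrm{diag}\big(d_i^k(-q^{-1}a_i^{-1};q^{-2})_k\big)_{k=0}^{n-1}$, $H=\mathcal F_{\varphi_1}D_1\cdots\mathcal F_{\varphi_N}D_N$. Then $\det H\ne0$ and $T_{\varphi,m}(q)=\mathrm{tr}(H)/\det(H)^{1/n}$. **Claim.** For every root of unity $\zeta$ of odd order $n$, every $m\in\mathbb Z$, every removed edge $E_p$, every flattening, and all choices of the $\theta_i$, of the square root and of the $n$-th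 root, $$\tau_{M_\varphi,\lambda,m}(\zeta^2)=\omega\;\tau_{M_\varphi,\lambda}(1)\;T_{\varphi,m}(\zeta)\qquad\text{for some }\omega\text{ with }\omega^{12n}=1.$$ -/

import Mathlib

open scoped BigOperators Matrix MatrixGroups

noncomputable section

/-! ### Homeomorphisms of the once-punctured torus -/

/-- The torus `ℝ² / ℤ²`. -/
abbrev Torus : Type := Fin 2 → UnitAddCircle

/-- The once-punctured torus `(ℝ² ∖ ℤ²) / ℤ²`. -/
abbrev PuncturedTorus : Type := {x : Torus // x ≠ 0}

/-- The projection `ℝ² → ℝ² / ℤ²`. -/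
def torusProj (x : Fin 2 → ℝ) : Torus := fun i => (x i : UnitAddCircle)

/-- `φ` acts on the first homology `ℤ²` of the once-punctured torus by `g`: it lifts to a
continuous map `F` of the covering space `ℝ² ∖ ℤ²` (the values of `F` on `ℤ²` play no role) that is
equivariant with respect to `g` on the deck group `ℤ²`. -/
def ActsBy (φ : PuncturedTorus ≃ₜ PuncturedTorus) (g : SL(2, ℤ)) : Prop :=
  ∃ F : (Fin 2 → ℝ) → (Fin 2 → ℝ),
    ContinuousOn F {x | torusProj x ≠ 0} ∧
    (∀ x, ∀ hx : torusProj x ≠ 0, torusProj (F x) = (φ ⟨torusProj x, hx⟩ : Torus)) ∧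
    ∀ x, torusProj x ≠ 0 → ∀ v : Fin 2 → ℤ,
      F (fun i => x i + (v i : ℝ)) =
        fun i => F x i + (((g : Matrix (Fin 2) (Fin 2) ℤ) *ᵥ v) i : ℝ)

/-- An orientation-preserving homeomorphism of the once-punctured torus is (isotopic to a)
pseudo-Anosov if its action on the first homology, an element of `SL(2, ℤ)`, is hyperbolic. -/
def IsPseudoAnosov (φ : PuncturedTorus ≃ₜ PuncturedTorus) : Prop :=
  ∃ g : SL(2, ℤ), ActsBy φ g ∧ 2 < |Matrix.trace (g : Matrix (Fin 2) (Fin 2) ℤ)|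

/-- The two letters. -/
inductive Letter where
  | L
  | R
  deriving DecidableEq

/-- The linear maps of the two letters. -/
def Letter.mat : Letter → Matrix (Fin 2) (Fin 2) ℤ
  | .L => !![1, 0; 1, 1]
  | .R => !![1, 1; 0, 1]

/-- A cyclic word `φ₁ ⋯ φ_N` in `L` and `R`, with indices in `ℤ/N`, in which both letters occur,
rotated so that `φ₁ = L` and `φ_N = R` (the index `N` is `0` in `ℤ/N`). -/
structure LRWord (N : ℕ) where
  letter : ZMod N → Letter
  first : letter 1 = .L
  last : letter 0 = .R

/-- The product `φ₁ φ₂ ⋯ φ_N` of the matrices of the letters. -/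
def LRWord.mat {N : ℕ} (w : LRWord N) : Matrix (Fin 2) (Fin 2) ℤ :=
  ((List.range N).map fun i => (w.letter ((i + 1 : ℕ) : ZMod N)).mat).prod

/-- `φ = ± φ₁ ⋯ φ_N` up to isotopy and conjugation (the mapping class group of the once-punctured
torus is `SL(2, ℤ)`); the sign is `ε`. -/
def IsMonodromy (φ : PuncturedTorus ≃ₜ PuncturedTorus) {N : ℕ} (w : LRWord N) (ε : ℤˣ) : Prop :=
  ∃ g h : SL(2, ℤ), ActsBy φ g ∧
    ((h * g * h⁻¹ : SL(2, ℤ)) : Matrix (Fin 2) (Fin 2) ℤ) = (ε : ℤ) • w.mat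

/-! ### Oriented ideal triangulations and their gluing equations -/

/-- A gluing of oriented ideal tetrahedra, each with vertices `0, 1, 2, 3`, along their faces. The
face of `j` opposite to the vertex `v` is glued to a face of `adj j v`; the permutation `perm j v`
sends the three vertices of the first face to those of the second, and the opposite vertex `v` to
the vertex opposite to the second face. -/
structure OrientedTriangulation (ι : Type) where
  adj : ι → Fin 4 → ι
  perm : ι → Fin 4 → Equiv.Perm (Fin 4)
  adj_adj : ∀ j v, adj (adj j v) (perm j v v) = j
  perm_perm : ∀ j v, perm (adj j v) (perm j v v) = (perm j v)⁻¹
  /-- The face gluings are orientation-reversing. -/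
  odd : ∀ j v, Equiv.Perm.sign (perm j v) = -1
  /-- No face is glued to itself. -/
  free : ∀ j v, adj j v = j → perm j v v ≠ v

/-- The three shapes `z`, `z'`, `z''`. -/
inductive ShapeLabel where
  | z
  | z'
  | z''
  deriving DecidableEq

instance : Fintype ShapeLabel := ⟨{.z, .z', .z''}, fun l => by cases l <;> decide⟩

/-- Edges of a tetrahedron. -/
abbrev TetEdge : Type := {s : Finset (Fin 4) // s.card = 2}

/-- The edges `01`, `23` carry `z`, the edges `02`, `13` carry `z'`, and `03`, `12` carry `z''`. -/
def shapeLabel (s : Finset (Fin 4)) : ShapeLabel :=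
  if s = {0, 1} ∨ s = {2, 3} then .z else if s = {0, 2} ∨ s = {1, 3} then .z' else .z''

/-- The values `z`, `z' = 1 / (1 - z)`, `z'' = 1 - 1 / z`. -/
def ShapeLabel.val : ShapeLabel → ℂ → ℂ
  | .z, x => x
  | .z', x => 1 / (1 - x)
  | .z'', x => 1 - 1 / x

namespace OrientedTriangulation

variable {ι : Type} (T : OrientedTriangulation ι)

/-- Two edges of tetrahedra that are matched by a face gluing. -/
def EdgeGlued (x y : ι × TetEdge) : Prop :=
  ∃ v : Fin 4, v ∉ x.2.1 ∧ y.1 = T.adj x.1 v ∧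
    y.2.1 = x.2.1.map (T.perm x.1 v).toEmbedding

/-- Two edges of tetrahedra that give the same edge of the triangulation. -/
def SameEdge (x y : ι × TetEdge) : Prop := Relation.EqvGen T.EdgeGlued x y

/-- The number of edges of the tetrahedron `j` with label `l` that lie around the edge of the
triangulation represented by `x`. -/
def incidence (x : ι × TetEdge) (l : ShapeLabel) (j : ι) : ℕ :=
  Set.ncard {s : TetEdge | shapeLabel s.1 = l ∧ T.SameEdge x (j, s)}

/-- A closed normal curve on the boundary, which is triangulated by the links of the ideal vertices.
Each step crosses the link of a vertex of a tetrahedron. A step `(j, σ)` lies in the tetrahedron `j`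
at the vertex `σ 0`, enters through the face opposite to `σ 1`, leaves through the face opposite to
`σ 2`, and so turns around the edge from `σ 0` to `σ 3`. -/
structure PeripheralCurve where
  len : ℕ
  step : Fin (len + 1) → ι × Equiv.Perm (Fin 4)
  next_tet : ∀ k, (step (k + 1)).1 = T.adj (step k).1 ((step k).2 2)
  next_vertex : ∀ k, (step (k + 1)).2 0 = T.perm (step k).1 ((step k).2 2) ((step k).2 0)
  next_entry : ∀ k, (step (k + 1)).2 1 = T.perm (step k).1 ((step k).2 2) ((step k).2 2)

variable {T}

/-- The signed number of times that a peripheral curve turns around an edge of the tetrahedron `j`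
with label `l`. The sign is that of the sense of rotation, read off from the orientation. -/
def PeripheralCurve.winding [DecidableEq ι] (γ : T.PeripheralCurve) (l : ShapeLabel) (j : ι) : ℤ :=
  ∑ k, if (γ.step k).1 = j ∧ shapeLabel {(γ.step k).2 0, (γ.step k).2 3} = l
    then -((Equiv.Perm.sign (γ.step k).2 : ℤˣ) : ℤ) else 0

variable (T)

/-- `z` solves the logarithmic gluing equations of all edges and of the peripheral curve `γ`, with
all tetrahedra positively oriented. (The equation `log z + log z' + log z'' = π i` holds for the
principal branches whenever `z` is in the upper half plane.) -/
structure IsGeometricSolution [Fintype ι] [DecidableEq ι] (γ : T.PeripheralCurve) (z : ι → ℂ) :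
    Prop where
  im_pos : ∀ j, 0 < (z j).im
  edge : ∀ x : ι × TetEdge,
    ∑ j, ∑ l, (T.incidence x l j : ℂ) * Complex.log (l.val (z j)) = 2 * Real.pi * Complex.I
  cusp : ∑ j, ∑ l, (γ.winding l j : ℂ) * Complex.log (l.val (z j)) = 0

end OrientedTriangulation

/-! ### Neumann–Zagier data and the 1-loop invariant -/

/-- A Neumann–Zagier datum `(A, B, ν, z, f, f')`; `cusp` is the index of the row that belongs to the
peripheral curve. -/
structure NZDatum (ι : Type) where
  A : Matrix ι ι ℤ
  B : Matrix ι ι ℤ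
  ν : ι → ℤ
  cusp : ι
  z : ι → ℂ
  f : ι → ℤ
  f' : ι → ℤ

/-- The reduced gluing matrices: the rows are those of the edges represented by `e i`, except that
the row of `e p` is removed and replaced by one half of the row of the peripheral curve `γ`
(which is meant for curves with even winding numbers, such as a longitude). -/
def OrientedTriangulation.reducedGluing {ι : Type} [DecidableEq ι] (T : OrientedTriangulation ι)
    (e : ι → ι × TetEdge) (γ : T.PeripheralCurve) (p : ι) (l : ShapeLabel) : Matrix ι ι ℤ :=
  Matrix.of fun i j => if i = p then γ.winding l j / 2 else (T.incidence (e i) l j : ℤ)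

/-- The Neumann–Zagier datum of a triangulation, after elimination of `z''`:
`A = G' - G''`, `B = G - G''`, `ν = η - G'' (1, …, 1)ᵗ`. -/
def OrientedTriangulation.nzDatum {ι : Type} [Fintype ι] [DecidableEq ι]
    (T : OrientedTriangulation ι) (e : ι → ι × TetEdge) (γ : T.PeripheralCurve) (p : ι)
    (z : ι → ℂ) (f f' : ι → ℤ) : NZDatum ι where
  A := T.reducedGluing e γ p .z' - T.reducedGluing e γ p .z''
  B := T.reducedGluing e γ p .z - T.reducedGluing e γ p .z''
  ν := fun i => (if i = p then 0 else 2) - ∑ j, T.reducedGluing e γ p .z'' i j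
  cusp := p
  z := z
  f := f
  f' := f'

/-- `e(x) = exp(2 π i x)`. -/
def expTwoPi (x : ℚ) : ℂ := Complex.exp (2 * Real.pi * Complex.I * (x : ℂ))

/-- The sawtooth function `((x))`. -/
def sawtooth (x : ℚ) : ℚ := if Int.fract x = 0 then 0 else Int.fract x - 1 / 2

/-- The Dedekind sum `s(a, n)`. -/
def dedekindSum (a : ℤ) (n : ℕ) : ℚ :=
  ∑ j ∈ Finset.Ico 1 n, sawtooth ((j : ℚ) / n) * sawtooth ((a : ℚ) * j / n)

/-- The function `𝒟_ζ(x)` for `ζ = e(a / n)`: an `n`-th root of the cyclic quantum dilogarithm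
`∏ (1 - ζ ^ j x) ^ j`, corrected by a Dedekind sum. -/
def cyclicDilog (n : ℕ) (a : ℤ) (x : ℂ) : ℂ :=
  Complex.exp (-(Complex.I * Real.pi * (dedekindSum a n : ℂ)) +
    ∑ j ∈ Finset.Ico 1 n, (j : ℂ) / n * Complex.log (1 - expTwoPi (a / n) ^ j * x))

/-- The quantum Pochhammer symbol `(x; q)_k = (1 - x) (1 - q x) ⋯ (1 - q ^ (k - 1) x)`. -/
def qPoch (x q : ℂ) (k : ℕ) : ℂ := ∏ j ∈ Finset.range k, (1 - q ^ j * x)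

/-- The integer `(n + 1) / 2` that represents `1/2` modulo the odd number `n`. -/
def halfMod (n : ℕ) : ℤ := ((n + 1) / 2 : ℕ)

namespace NZDatum

variable {ι : Type} [Fintype ι] [DecidableEq ι] (Γ : NZDatum ι)

/-- The shapes `z'`. -/
def z' (i : ι) : ℂ := ShapeLabel.z'.val (Γ.z i)

/-- `(f, f')` is a flattening. -/
def IsFlattening : Prop := Γ.A *ᵥ Γ.f' + Γ.B *ᵥ Γ.f = Γ.ν

/-- The values of `τ_Γ(1) = 1 / √(det(A diag(z) + B diag(1 / z')) z' ^ f z ^ (-f'))`, for both choices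
of the square root; empty if the determinant vanishes. -/
def tauOne : Set ℂ :=
  {t | t ^ 2 * ((Γ.A.map (Int.cast : ℤ → ℂ) * Matrix.diagonal Γ.z +
      Γ.B.map (Int.cast : ℤ → ℂ) * Matrix.diagonal (fun i => (Γ.z' i)⁻¹)).det *
      ((∏ i, Γ.z' i ^ Γ.f i) * ∏ i, Γ.z i ^ (-Γ.f' i))) = 1}

/-- The summand `a_{k, m}(θ)` at `ζ = e(a / n)`, where `B = d U`, so that `d B⁻¹ = U⁻¹`. The index
`k` in `(ℤ/n)^N` is represented by integers between `0` and `n - 1`. -/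
def summand (d : ℕ) (U : Matrix ι ι ℤ) (θ : ι → ℂ) (m : ℤ) (n : ℕ) (a : ℤ) (k : ι → ZMod n) : ℂ :=
  let ζ : ℂ := expTwoPi (a / n)
  let K : ι → ℤ := fun i => ((k i).val : ℤ)
  (-1) ^ (K ⬝ᵥ (U⁻¹ *ᵥ Γ.ν)) *
    ζ ^ (halfMod n * ((d : ℤ) * (K ⬝ᵥ ((U⁻¹ * Γ.A) *ᵥ K)) +
      K ⬝ᵥ (U⁻¹ *ᵥ (Γ.ν - (2 * m) • (Pi.single Γ.cusp 1 : ι → ℤ))))) *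
    ∏ i, θ i ^ (-(((U⁻¹ * Γ.A) *ᵥ K) i)) / qPoch (ζ * (θ i)⁻¹) ζ (d * (k i).val)

/-- The quotient `τ_{Γ, m}(ζ) / τ_Γ(1)` at `ζ = e(a / n)`, where `B = d U`. -/
def tauRatio (d : ℕ) (U : Matrix ι ι ℤ) (θ : ι → ℂ) (m : ℤ) (n : ℕ) [NeZero n] (a : ℤ) : ℂ :=
  1 / ((Real.sqrt n : ℂ) ^ Fintype.card ι *
      Complex.exp ((1 - n) / (2 * n) * ∑ i, (Γ.f i : ℂ) * Complex.log (Γ.z' i)) *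
      Complex.exp ((n - 1) / (2 * n) * ∑ i, (Γ.f' i : ℂ) * Complex.log (Γ.z i))) *
    (∏ i, cyclicDilog n (-a) (θ i)⁻¹) * ∑ k : ι → ZMod n, Γ.summand d U θ m n a k

/-- The values of the `m`-th descendant 1-loop invariant `τ_{Γ, m}(ζ)` at `ζ = e(a / n)`, for all
choices of the roots `θ` and of the square root in `τ_Γ(1)`. It is only defined (nonempty) if
`B / d` is unimodular for some `d = 1, 2`. -/
def tau (m : ℤ) (n : ℕ) [NeZero n] (a : ℤ) : Set ℂ :=
  {τ | ∃ d : ℕ, (d = 1 ∨ d = 2) ∧ ∃ U : Matrix ι ι ℤ, Γ.B = (d : ℤ) • U ∧ IsUnit U.det ∧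
    ∃ θ : ι → ℂ, (∀ i, θ i ^ n = Γ.z' i) ∧
    ∃ t ∈ Γ.tauOne, τ = t * Γ.tauRatio d U θ m n a}

end NZDatum

/-! ### The layered triangulation of a once-punctured torus bundle -/

/-- The rotation of the square by `π`: it exchanges the vertices `0, 2` and `1, 3`. -/
def squareRot : Equiv.Perm (Fin 4) := Equiv.swap 0 2 * Equiv.swap 1 3

/-- The rotation (if any) in the gluing of the top of `T_{i-1}` to the bottom of `T_i`: the sign `ε` of
the monodromy is put at `i = 1`. -/
def layerTwist {N : ℕ} (ε : ℤˣ) (i : ZMod N) : Equiv.Perm (Fin 4) :=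
  if ε = -1 ∧ i = 1 then squareRot else 1

/-- The gluing between the top faces `012` and `023` of `T_{i-1}` (opposite to `3` and `1`) and the
bottom faces `013` and `123` of `T_i` (opposite to `2` and `0`), for a letter and a face. Every
tetrahedron projects to the unit square with vertices `0 = (0,0)`, `1 = (1,0)`, `2 = (1,1)`,
`3 = (0,1)`, with diagonal `02` on top and `13` at the bottom, and `T_i` is put on top of `T_{i-1}` by
the linear map of the letter: `L` glues `023` to `013` and `120` to `123`, and `R` glues `012` to
`013` and `023` to `123`. -/
def layerPerm : Letter → Fin 4 → Equiv.Perm (Fin 4)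
  | .L, v => if v = 1 ∨ v = 2 then Equiv.swap 1 2 else Equiv.swap 0 3
  | .R, v => if v = 2 ∨ v = 3 then Equiv.swap 2 3 else Equiv.swap 0 1

theorem LRWord.one_ne_zero {N : ℕ} (w : LRWord N) : (1 : ZMod N) ≠ 0 := by
  intro h
  have h1 := w.first
  rw [h, w.last] at h1
  exact absurd h1 (by decide)

theorem layerTwist_cases {N : ℕ} (ε : ℤˣ) (i : ZMod N) :
    layerTwist ε i = 1 ∨ layerTwist ε i = squareRot := by
  unfold layerTwist
  split_ifs <;> simp

/-- The layered triangulation of the mapping torus of `ε φ₁ ⋯ φ_N`, with tetrahedra indexed by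
`ℤ/N`. The faces opposite to `1` and `3` are the top faces, the other ones are the bottom faces. -/
def LRWord.layered {N : ℕ} (w : LRWord N) (ε : ℤˣ) : OrientedTriangulation (ZMod N) where
  adj j v := if v = 1 ∨ v = 3 then j + 1 else j - 1
  perm j v := if v = 1 ∨ v = 3
    then layerTwist ε (j + 1) * layerPerm (w.letter (j + 1)) v
    else layerPerm (w.letter j) (layerTwist ε j v) * layerTwist ε j
  adj_adj := by
    intro j v
    rcases layerTwist_cases ε (j + 1) with h | h <;>
    rcases layerTwist_cases ε j with h' | h' <;>
    rcases hl : w.letter (j + 1) <;>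
    rcases hl' : w.letter j <;>
    fin_cases v <;> simp [h, h', squareRot, layerPerm, Equiv.swap_apply_def]
  perm_perm := by
    intro j v
    rcases layerTwist_cases ε (j + 1) with h | h <;>
    rcases layerTwist_cases ε j with h' | h' <;>
    rcases hl : w.letter (j + 1) <;>
    rcases hl' : w.letter j <;>
    fin_cases v <;> simp [h, h', hl, hl', squareRot, layerPerm, Equiv.swap_apply_def] <;> decide
  odd := by
    intro j v
    rcases layerTwist_cases ε (j + 1) with h | h <;>
    rcases layerTwist_cases ε j with h' | h' <;>
    rcases hl : w.letter (j + 1) <;>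
    rcases hl' : w.letter j <;>
    fin_cases v <;> simp [*, squareRot, layerPerm] <;> decide
  free := by
    intro j v h
    exfalso
    have h1 := w.one_ne_zero
    split_ifs at h
    · exact h1 (by simpa using h)
    · exact h1 (by simpa using h)

/-- The edge `E_i` of the layered triangulation, represented by the edge `02` of `T_{i-1}`. -/
def layeredEdge {N : ℕ} (i : ZMod N) : ZMod N × TetEdge := (i - 1, ⟨{0, 2}, by decide⟩)

/-- The tetrahedra on the longitude: twice `T_N, T_{N-1}, T_N, T_1`. -/
def longitudeTet {N : ℕ} : Fin 8 → ZMod N := ![0, -1, 0, 1, 0, -1, 0, 1]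

/-- The eight steps of the longitude in these tetrahedra; `ρ` is the rotation in the gluing of the
bottom of `T_1`. -/
def longitudePerm (ρ : Equiv.Perm (Fin 4)) : Fin 8 → Equiv.Perm (Fin 4) :=
  ![⟨![2, 1, 0, 3], ![2, 1, 0, 3], by decide, by decide⟩,
    ⟨![2, 1, 3, 0], ![3, 1, 0, 2], by decide, by decide⟩,
    ⟨![3, 2, 1, 0], ![3, 2, 1, 0], by decide, by decide⟩,
    ρ * ⟨![3, 2, 0, 1], ![2, 3, 1, 0], by decide, by decide⟩,
    ⟨![0, 3, 2, 1], ![0, 3, 2, 1], by decide, by decide⟩,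
    ⟨![0, 3, 1, 2], ![0, 2, 3, 1], by decide, by decide⟩,
    ⟨![1, 0, 3, 2], ![1, 0, 3, 2], by decide, by decide⟩,
    ρ * ⟨![1, 0, 2, 3], ![1, 0, 2, 3], by decide, by decide⟩]

/-- The longitude of a once-punctured torus bundle, that is, the boundary of the fibre, as a closed
normal curve. -/
def LRWord.longitude {N : ℕ} (w : LRWord N) (ε : ℤˣ) : (w.layered ε).PeripheralCurve where
  len := 7
  step k := (longitudeTet k, longitudePerm (layerTwist ε (1 : ZMod N)) k)
  next_tet := by
    rcases layerTwist_cases ε (1 : ZMod N) with h | h <;> intro k <;> fin_cases k <;>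
      simp [longitudeTet, longitudePerm, LRWord.layered, h, squareRot, Equiv.swap_apply_def]
  next_vertex := by
    have h0 : layerTwist ε (0 : ZMod N) = 1 := by
      simp [layerTwist, w.one_ne_zero.symm]
    rcases layerTwist_cases ε (1 : ZMod N) with h | h <;> intro k <;> fin_cases k <;>
      simp [longitudeTet, longitudePerm, LRWord.layered, h, h0, w.first, w.last, layerPerm,
        squareRot, Equiv.swap_apply_def]
  next_entry := by
    have h0 : layerTwist ε (0 : ZMod N) = 1 := by
      simp [layerTwist, w.one_ne_zero.symm]
    rcases layerTwist_cases ε (1 : ZMod N) with h | h <;> intro k <;> fin_cases k <;>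
      simp [longitudeTet, longitudePerm, LRWord.layered, h, h0, w.first, w.last, layerPerm,
        squareRot, Equiv.swap_apply_def]

/-- The winding numbers of the longitude are even. -/
theorem LRWord.longitude_even {N : ℕ} (w : LRWord N) (ε : ℤˣ) (l : ShapeLabel) (j : ZMod N) :
    2 ∣ (w.longitude ε).winding l j := by
  set ρ := layerTwist ε (1 : ZMod N) with hρ
  have key : ∀ k : Fin 4,
      shapeLabel {longitudePerm ρ (k.natAdd 4) 0, longitudePerm ρ (k.natAdd 4) 3} =
        shapeLabel {longitudePerm ρ (k.castAdd 4) 0, longitudePerm ρ (k.castAdd 4) 3} ∧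
      Equiv.Perm.sign (longitudePerm ρ (k.natAdd 4)) =
        Equiv.Perm.sign (longitudePerm ρ (k.castAdd 4)) := by
    rcases layerTwist_cases ε (1 : ZMod N) with h | h <;> rw [hρ, h] <;> decide
  have key1 : ∀ k : Fin 4,
      longitudeTet (N := N) (k.natAdd 4) = longitudeTet (N := N) (k.castAdd 4) := by
    intro k
    fin_cases k <;> rfl
  have h : (w.longitude ε).winding l j = ∑ k : Fin (4 + 4),
      if longitudeTet (N := N) k = j ∧
          shapeLabel {longitudePerm ρ k 0, longitudePerm ρ k 3} = l
        then -((Equiv.Perm.sign (longitudePerm ρ k) : ℤˣ) : ℤ) else 0 := rfl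
  rw [h, Fin.sum_univ_add, ← Finset.sum_add_distrib]
  refine Finset.dvd_sum fun k _ => ?_
  rw [(key k).1, (key k).2, key1 k]
  exact Dvd.intro _ (two_mul _)

/-- The Neumann–Zagier datum of the layered triangulation with respect to the longitude, with the
equation of the edge `E_p` removed. -/
def LRWord.nzDatum {N : ℕ} [NeZero N] (w : LRWord N) (ε : ℤˣ) (p : ZMod N)
    (z : ZMod N → ℂ) (f f' : ZMod N → ℤ) : NZDatum (ZMod N) :=
  (w.layered ε).nzDatum layeredEdge (w.longitude ε) p z f f'

/-! ### The BWY invariant -/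

/-- The Fourier matrices `F_L = (q ^ (i j)) / √n` and `F_R = (q ^ ((i - j)² / 2)) / √n`. -/
def fourierMatrix (n : ℕ) (q : ℂ) : Letter → Matrix (ZMod n) (ZMod n) ℂ
  | .L => Matrix.of fun i j => q ^ (i * j).val / (Real.sqrt n : ℂ)
  | .R => Matrix.of fun i j =>
      q ^ (halfMod n * (((i - j) ^ 2).val : ℤ)) / (Real.sqrt n : ℂ)

/-- `β_i` is `-1`, `1` or `0`, as `φ_i φ_{i+1}` is `LR`, `RL` or something else. -/
def LRWord.beta {N : ℕ} (w : LRWord N) (i : ZMod N) : ℤ :=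
  match w.letter i, w.letter (i + 1) with
  | .L, .R => -1
  | .R, .L => 1
  | _, _ => 0

/-- `θ_i = exp(log(z'_i) / n)`. -/
def bwyTheta {N : ℕ} (z : ZMod N → ℂ) (n : ℕ) (i : ZMod N) : ℂ :=
  Complex.exp (1 / n * Complex.log (ShapeLabel.z'.val (z i)))

/-- `a_i = - q⁻¹ θ_i` -/
def bwyA {N : ℕ} (z : ZMod N → ℂ) (n : ℕ) (q : ℂ) (i : ZMod N) : ℂ := -q⁻¹ * bwyTheta z n i

/-- `d_i = q ^ (m β_i - η_i / 2) exp((1 - n²) / (2 n) π i η_i - log(z_i) / n)` -/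
def LRWord.bwyD {N : ℕ} (w : LRWord N) (z : ZMod N → ℂ) (η : ZMod N → ℤ) (m : ℤ) (n : ℕ) (q : ℂ)
    (i : ZMod N) : ℂ :=
  q ^ (m * w.beta i - halfMod n * η i) *
    Complex.exp ((1 - (n : ℂ) ^ 2) / (2 * n) * Real.pi * Complex.I * (η i : ℂ) -
      1 / n * Complex.log (z i))

/-- `H_i = F_{φ_i} D_i` with `D_i = diag(d_i ^ k (- q⁻¹ a_i⁻¹; q⁻²)_k)`. -/
def LRWord.bwyFactor {N : ℕ} (w : LRWord N) (z : ZMod N → ℂ) (η : ZMod N → ℤ) (m : ℤ) (n : ℕ)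
    [NeZero n] (q : ℂ) (i : ZMod N) : Matrix (ZMod n) (ZMod n) ℂ :=
  fourierMatrix n q (w.letter i) * Matrix.diagonal fun k : ZMod n =>
    w.bwyD z η m n q i ^ k.val * qPoch (-q⁻¹ * (bwyA z n q i)⁻¹) ((q ^ 2)⁻¹) k.val

/-- `H = H_1 H_2 ⋯ H_N`. -/
def LRWord.bwyMatrix {N : ℕ} (w : LRWord N) (z : ZMod N → ℂ) (η : ZMod N → ℤ) (m : ℤ) (n : ℕ)
    [NeZero n] (q : ℂ) : Matrix (ZMod n) (ZMod n) ℂ :=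
  ((List.range N).map fun i => w.bwyFactor z η m n q ((i + 1 : ℕ) : ZMod N)).prod

/-- The values of the BWY invariant `T_{φ, m}(q) = tr(H) / det(H) ^ (1/n)` at `q = e(a / n)`, for all
choices of the `n`-th root of `det(H)`, where `z` and `η = 2 B⁻¹ ν` are taken from the
Neumann–Zagier datum `Γ` of the layered triangulation. It is empty if `det(H) = 0`. -/
def LRWord.bwy {N : ℕ} (w : LRWord N) [NeZero N] (Γ : NZDatum (ZMod N)) (m : ℤ) (n : ℕ) [NeZero n]
    (a : ℤ) : Set ℂ :=
  {t | ∃ η : ZMod N → ℤ, Γ.B *ᵥ η = (2 : ℤ) • Γ.ν ∧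
    ∃ r : ℂ, r ≠ 0 ∧ r ^ n = (w.bwyMatrix Γ.z η m n (expTwoPi (a / n))).det ∧
      t = (w.bwyMatrix Γ.z η m n (expTwoPi (a / n))).trace / r}

end

/-! The claim compares two state sums over `(ℤ/n)^N`, and every sign and root of unity of order
`12 n` may be ignored.

**The Neumann–Zagier datum.** Write `λ_X(j)` for the last index at or before `j` with the letter `X`
(`LRWord.lastIndex`). The edges of `T_j` with label `z` belong to `E_i` for `i = λ_L(j)`, those with
label `z''` for `i = λ_R(j)`, the top diagonal `02` for `i = j + 1`, and the bottom diagonal `13` for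
`i = λ_X(j - 1)`, where `X = φ_j` (`LRWord.sameEdge_layeredEdge_iff`). So `B = 2 U` for an explicit
matrix `U` (`LRWord.halfB`). Its row lattice contains all unit vectors, because the rows of the
edges are, up to sign, sums of unit vectors that are consecutive in the cyclic order
(`LRWord.isUnit_det_halfB`). The matrix `S = 2 B⁻¹ A` is the Hessian of the quadratic form of the
word, the sum of `x_{i-1} x_i` over the letters `L` and of `(x_i - x_{i-1})² / 2` over the letters
`R` (`LRWord.hess`, `LRWord.halfB_mulVec_hess`), which is the exponent of the Fourier matrices.
Furthermore `U β = e_p`, and `η = S (1, …, 1)ᵗ` since each edge has two corners with label `z'`.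
In particular `f = 0`,
`f' = 1` is a flattening.

**Nonvanishing.** The matrix in `τ(1)` is `U (S + 2 diag((1 - z) / z)) diag(z)`. As `S` is real
symmetric and `Im ((1 - z) / z) < 0`, it is invertible (`LRWord.det_ne_zero`).

**The state sums.** The gluing equations say `S log z' + 2 log z = π i η` (`LRWord.hess_log_add`).
The entries of `D_i` are roots of unity times the values of `z_i ^ (-k/n) (θ_i⁻¹; q⁻²)_k`, which are
periodic in `k` (`normPoch`), and `(θ⁻¹; q⁻²)_{-2k} = 1 / (q² θ⁻¹; q²)_{2k}`. So the substitution of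
`c - 2 k` for `k` turns the trace of `H` into the 1-loop state sum, where `c` accounts for the choice
of the roots `θ_i` (`LRWord.summand_mul_prod_weight`).

**The prefactors.** The Fourier matrices have determinants of order dividing `12`, and `det D_i` is a
triangular product, which is the inverse of the `n`-th power of the cyclic quantum dilogarithm times
`z_i ^ ((n - 1) / 2)` (`prod_pow_mul_prod_normPoch`). The Dedekind sums have denominator dividing
`6 n`. It remains that the twelfth power of `∏ z'_i ^ f_i z_i ^ (1 - f'_i)` is `1`; this follows by
contraction of the gluing equations with `f'` and with `(1, …, 1)` (`LRWord.exp_flattening_pow`).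

**The monodromy.** A hyperbolic element of `SL(2, ℤ)` is made nonnegative up to sign by conjugations
that reduce the difference of its diagonal entries, and then it is factored by the Euclidean
algorithm (`exists_lrWord_conj`). -/

noncomputable section

/-! ### Edges of the layered triangulation -/

namespace LRWord

variable {N : ℕ} [NeZero N] (w : LRWord N)

theorem exists_letter_sub_eq (X : Letter) (j : ZMod N) : ∃ k : ℕ, w.letter (j - k) = X := by
  cases X
  · exact ⟨(j - 1).val, by simp [w.first]⟩
  · exact ⟨j.val, by simp [w.last]⟩

/-- The last index at or before `j`, in the cyclic order of `ℤ/N`, that carries the letter `X`. -/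
def lastIndex (X : Letter) (j : ZMod N) : ZMod N :=
  j - (Nat.find (w.exists_letter_sub_eq X j) : ℕ)

theorem letter_lastIndex (X : Letter) (j : ZMod N) : w.letter (w.lastIndex X j) = X :=
  Nat.find_spec (w.exists_letter_sub_eq X j)

theorem lastIndex_of_eq {X : Letter} {j : ZMod N} (h : w.letter j = X) : w.lastIndex X j = j := by
  have : Nat.find (w.exists_letter_sub_eq X j) = 0 := by simp [Nat.find_eq_zero, h]
  simp [lastIndex, this]

theorem lastIndex_of_ne {X : Letter} {j : ZMod N} (h : w.letter j ≠ X) :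
    w.lastIndex X j = w.lastIndex X (j - 1) := by
  have h2 : ∃ k : ℕ, w.letter (j - ((k + 1 : ℕ) : ZMod N)) = X := by
    obtain ⟨k, hk⟩ := w.exists_letter_sub_eq X (j - 1)
    exact ⟨k, by rw [← hk]; congr 1; push_cast; ring⟩
  have h3 := Nat.find_comp_succ (w.exists_letter_sub_eq X j) h2 (by simpa using h)
  have h4 : Nat.find h2 = Nat.find (w.exists_letter_sub_eq X (j - 1)) := by
    refine Nat.find_congr' fun {k} => ?_
    have : j - ((k + 1 : ℕ) : ZMod N) = j - 1 - k := by push_cast; ring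
    rw [this]
  unfold lastIndex
  rw [h3, h4]
  push_cast
  ring

/-- Induction on the distance to the last letter `X`. -/
theorem lastIndex_induction {X : Letter} {P : ZMod N → Prop}
    (h0 : ∀ j, w.letter j = X → P j) (h1 : ∀ j, w.letter j ≠ X → P (j - 1) → P j) (j : ZMod N) :
    P j := by
  obtain ⟨k, hk⟩ := w.exists_letter_sub_eq X j
  induction k generalizing j with
  | zero => exact h0 j (by simpa using hk)
  | succ k ih =>
    by_cases h : w.letter j = X
    · exact h0 j h
    · exact h1 j h (ih (j - 1) (by rw [← hk]; congr 1; push_cast; ring))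

/-- The index `i` of the edge `E_i` that contains the edge `s` of the tetrahedron `T_j`. -/
def edgeClass (x : ZMod N × TetEdge) : ZMod N :=
  match shapeLabel x.2.1 with
  | .z => w.lastIndex .L x.1
  | .z'' => w.lastIndex .R x.1
  | .z' => if x.2.1 = {0, 2} then x.1 + 1 else w.lastIndex (w.letter x.1) (x.1 - 1)

theorem edgeClass_of_z {x : ZMod N × TetEdge} (h : shapeLabel x.2.1 = .z) :
    w.edgeClass x = w.lastIndex .L x.1 := by
  simp [edgeClass, h]

theorem edgeClass_of_z'' {x : ZMod N × TetEdge} (h : shapeLabel x.2.1 = .z'') :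
    w.edgeClass x = w.lastIndex .R x.1 := by
  simp [edgeClass, h]

theorem edgeClass_of_top {x : ZMod N × TetEdge} (h : x.2.1 = {0, 2}) :
    w.edgeClass x = x.1 + 1 := by
  have : shapeLabel {0, 2} = .z' := by decide
  simp [edgeClass, h, this]

theorem edgeClass_of_bot {x : ZMod N × TetEdge} (h : x.2.1 = {1, 3}) :
    w.edgeClass x = w.lastIndex (w.letter x.1) (x.1 - 1) := by
  have : shapeLabel {1, 3} = .z' := by decide
  have h' : ({1, 3} : Finset (Fin 4)) ≠ {0, 2} := by decide
  simp [edgeClass, h, this, h']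

/-- The effect of the gluing of a top face on edges. -/
theorem layerPerm_top (ρ : Equiv.Perm (Fin 4)) (hρ : ρ = 1 ∨ ρ = squareRot) (X : Letter)
    (v : Fin 4) (hv : v = 1 ∨ v = 3) (s : TetEdge) (hs : v ∉ s.1) :
    let t := s.1.map (ρ * layerPerm X v).toEmbedding
    match X with
    | .L => (s.1 = {0, 2} ∧ shapeLabel t = .z) ∨ (shapeLabel s.1 = .z ∧ t = {1, 3}) ∨
        (shapeLabel s.1 = .z'' ∧ shapeLabel t = .z'')
    | .R => (s.1 = {0, 2} ∧ shapeLabel t = .z'') ∨ (shapeLabel s.1 = .z'' ∧ t = {1, 3}) ∨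
        (shapeLabel s.1 = .z ∧ shapeLabel t = .z) := by
  revert v s
  rcases hρ with rfl | rfl <;> cases X <;> decide

/-- The effect of the gluing of a bottom face on edges. -/
theorem layerPerm_bot (ρ : Equiv.Perm (Fin 4)) (hρ : ρ = 1 ∨ ρ = squareRot) (X : Letter)
    (v : Fin 4) (hv : ¬ (v = 1 ∨ v = 3)) (s : TetEdge) (hs : v ∉ s.1) :
    let t := s.1.map (layerPerm X (ρ v) * ρ).toEmbedding
    match X with
    | .L => (t = {0, 2} ∧ shapeLabel s.1 = .z) ∨ (shapeLabel t = .z ∧ s.1 = {1, 3}) ∨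
        (shapeLabel t = .z'' ∧ shapeLabel s.1 = .z'')
    | .R => (t = {0, 2} ∧ shapeLabel s.1 = .z'') ∨ (shapeLabel t = .z'' ∧ s.1 = {1, 3}) ∨
        (shapeLabel t = .z ∧ shapeLabel s.1 = .z) := by
  revert v s
  rcases hρ with rfl | rfl <;> cases X <;> decide

/-- If the edges `s` of `T_{i-1}` and `t` of `T_i` are related as in a gluing with the letter
`φ_i`, then they are in the same class. -/
theorem edgeClass_eq_of_layer {i : ZMod N} {s t : TetEdge}
    (h : match w.letter i with
      | .L => (s.1 = {0, 2} ∧ shapeLabel t.1 = .z) ∨ (shapeLabel s.1 = .z ∧ t.1 = {1, 3}) ∨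
          (shapeLabel s.1 = .z'' ∧ shapeLabel t.1 = .z'')
      | .R => (s.1 = {0, 2} ∧ shapeLabel t.1 = .z'') ∨ (shapeLabel s.1 = .z'' ∧ t.1 = {1, 3}) ∨
          (shapeLabel s.1 = .z ∧ shapeLabel t.1 = .z)) :
    w.edgeClass (i - 1, s) = w.edgeClass (i, t) := by
  cases hl : w.letter i <;> rw [hl] at h <;> rcases h with ⟨h1, h2⟩ | ⟨h1, h2⟩ | ⟨h1, h2⟩
  · rw [w.edgeClass_of_top h1, w.edgeClass_of_z h2, w.lastIndex_of_eq hl]; ring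
  · rw [w.edgeClass_of_z h1, w.edgeClass_of_bot h2, hl]
  · rw [w.edgeClass_of_z'' h1, w.edgeClass_of_z'' h2,
      w.lastIndex_of_ne (j := (i, t).1) (by simp [hl])]
  · rw [w.edgeClass_of_top h1, w.edgeClass_of_z'' h2, w.lastIndex_of_eq hl]; ring
  · rw [w.edgeClass_of_z'' h1, w.edgeClass_of_bot h2, hl]
  · rw [w.edgeClass_of_z h1, w.edgeClass_of_z h2,
      w.lastIndex_of_ne (j := (i, t).1) (by simp [hl])]

theorem edgeClass_eq_of_edgeGlued (ε : ℤˣ) {x y : ZMod N × TetEdge}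
    (h : (w.layered ε).EdgeGlued x y) : w.edgeClass x = w.edgeClass y := by
  obtain ⟨j, s⟩ := x
  obtain ⟨i, t⟩ := y
  obtain ⟨v, hv, h1, h2⟩ := h
  by_cases hT : v = 1 ∨ v = 3
  · have e1 : i = j + 1 := by rw [show i = _ from h1]; simp [layered, hT]
    have e2 : t.1 = s.1.map (layerTwist ε (j + 1) *
        layerPerm (w.letter (j + 1)) v).toEmbedding := by
      rw [h2]; simp [layered, hT]
    have := layerPerm_top _ (layerTwist_cases ε (j + 1)) (w.letter (j + 1)) v hT s hv
    rw [← e2] at this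
    subst e1
    have h3 := w.edgeClass_eq_of_layer (i := j + 1) this
    rwa [add_sub_cancel_right] at h3
  · have e1 : i = j - 1 := by rw [show i = _ from h1]; simp [layered, hT]
    have e2 : t.1 = s.1.map (layerPerm (w.letter j) (layerTwist ε j v) *
        layerTwist ε j).toEmbedding := by
      rw [h2]; simp [layered, hT]
    have := layerPerm_bot _ (layerTwist_cases ε j) (w.letter j) v hT s hv
    rw [← e2] at this
    subst e1
    exact (w.edgeClass_eq_of_layer this).symm

theorem edgeClass_eq_of_sameEdge (ε : ℤˣ) {x y : ZMod N × TetEdge}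
    (h : (w.layered ε).SameEdge x y) : w.edgeClass x = w.edgeClass y := by
  induction h with
  | rel x y h => exact w.edgeClass_eq_of_edgeGlued ε h
  | refl x => rfl
  | symm x y _ ih => exact ih.symm
  | trans x y z _ _ ih1 ih2 => exact ih1.trans ih2

omit [NeZero N] in
/-- Every edge of `T_j` except the top diagonal is glued to an edge of `T_{j-1}`. -/
theorem exists_sameEdge_sub_one (ε : ℤˣ) (j : ZMod N) (s : TetEdge) (hs : s.1 ≠ {0, 2}) :
    ∃ t : TetEdge, (w.layered ε).SameEdge (j - 1, t) (j, s) ∧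
      match w.letter j with
      | .L => (t.1 = {0, 2} ∧ shapeLabel s.1 = .z) ∨ (shapeLabel t.1 = .z ∧ s.1 = {1, 3}) ∨
          (shapeLabel t.1 = .z'' ∧ shapeLabel s.1 = .z'')
      | .R => (t.1 = {0, 2} ∧ shapeLabel s.1 = .z'') ∨ (shapeLabel t.1 = .z'' ∧ s.1 = {1, 3}) ∨
          (shapeLabel t.1 = .z ∧ shapeLabel s.1 = .z) := by
  have h0 : ∀ s : TetEdge, s.1 ≠ {0, 2} → ∃ v : Fin 4, ¬ (v = 1 ∨ v = 3) ∧ v ∉ s.1 := by decide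
  obtain ⟨v, hv, hvs⟩ := h0 s hs
  have h := layerPerm_bot _ (layerTwist_cases ε j) (w.letter j) v hv s hvs
  refine ⟨⟨s.1.map (layerPerm (w.letter j) (layerTwist ε j v) * layerTwist ε j).toEmbedding,
    by rw [Finset.card_map, s.2]⟩, ?_, h⟩
  refine Relation.EqvGen.symm _ _ (Relation.EqvGen.rel _ _ ⟨v, hvs, ?_, ?_⟩)
  · simp [layered, hv]
  · simp [layered, hv]

theorem sameEdge_layeredEdge_of_z (ε : ℤˣ) (j : ZMod N) :
    ∀ s : TetEdge, shapeLabel s.1 = .z →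
      (w.layered ε).SameEdge (layeredEdge (w.lastIndex .L j)) (j, s) := by
  refine w.lastIndex_induction (X := .L) (P := fun j => ∀ s : TetEdge, shapeLabel s.1 = .z →
    (w.layered ε).SameEdge (layeredEdge (w.lastIndex .L j)) (j, s))
    (fun j hj s hs => ?_) (fun j hj ih s hs => ?_) j
  · have hs' : s.1 ≠ {0, 2} := fun h => by rw [h] at hs; exact absurd hs (by decide)
    obtain ⟨t, h1, h2⟩ := w.exists_sameEdge_sub_one ε j s hs'
    simp only [hj, hs] at h2
    rw [w.lastIndex_of_eq hj]
    rcases h2 with ⟨h2, -⟩ | ⟨-, h2⟩ | ⟨-, h2⟩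
    · have : t = ⟨{0, 2}, by decide⟩ := Subtype.ext h2
      rwa [this] at h1
    · rw [h2] at hs; exact absurd hs (by decide)
    · cases h2
  · have hs' : s.1 ≠ {0, 2} := fun h => by rw [h] at hs; exact absurd hs (by decide)
    obtain ⟨t, h1, h2⟩ := w.exists_sameEdge_sub_one ε j s hs'
    have hR : w.letter j = .R := by cases h : w.letter j <;> simp_all
    simp only [hR, hs] at h2
    rw [w.lastIndex_of_ne hj]
    rcases h2 with ⟨-, h2⟩ | ⟨-, h2⟩ | ⟨h2, -⟩
    · cases h2
    · rw [h2] at hs; exact absurd hs (by decide)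
    · exact Relation.EqvGen.trans _ _ _ (ih t h2) h1

theorem sameEdge_layeredEdge_of_z'' (ε : ℤˣ) (j : ZMod N) :
    ∀ s : TetEdge, shapeLabel s.1 = .z'' →
      (w.layered ε).SameEdge (layeredEdge (w.lastIndex .R j)) (j, s) := by
  refine w.lastIndex_induction (X := .R) (P := fun j => ∀ s : TetEdge, shapeLabel s.1 = .z'' →
    (w.layered ε).SameEdge (layeredEdge (w.lastIndex .R j)) (j, s))
    (fun j hj s hs => ?_) (fun j hj ih s hs => ?_) j
  · have hs' : s.1 ≠ {0, 2} := fun h => by rw [h] at hs; exact absurd hs (by decide)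
    obtain ⟨t, h1, h2⟩ := w.exists_sameEdge_sub_one ε j s hs'
    simp only [hj, hs] at h2
    rw [w.lastIndex_of_eq hj]
    rcases h2 with ⟨h2, -⟩ | ⟨-, h2⟩ | ⟨-, h2⟩
    · have : t = ⟨{0, 2}, by decide⟩ := Subtype.ext h2
      rwa [this] at h1
    · rw [h2] at hs; exact absurd hs (by decide)
    · cases h2
  · have hs' : s.1 ≠ {0, 2} := fun h => by rw [h] at hs; exact absurd hs (by decide)
    obtain ⟨t, h1, h2⟩ := w.exists_sameEdge_sub_one ε j s hs'
    have hL : w.letter j = .L := by cases h : w.letter j <;> simp_all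
    simp only [hL, hs] at h2
    rw [w.lastIndex_of_ne hj]
    rcases h2 with ⟨-, h2⟩ | ⟨-, h2⟩ | ⟨h2, -⟩
    · cases h2
    · rw [h2] at hs; exact absurd hs (by decide)
    · exact Relation.EqvGen.trans _ _ _ (ih t h2) h1

theorem sameEdge_layeredEdge (ε : ℤˣ) (x : ZMod N × TetEdge) :
    (w.layered ε).SameEdge (layeredEdge (w.edgeClass x)) x := by
  obtain ⟨j, s⟩ := x
  have h0 : ∀ s : TetEdge, s.1 = {0, 2} ∨ s.1 = {1, 3} ∨ shapeLabel s.1 = .z ∨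
    shapeLabel s.1 = .z'' := by decide
  rcases h0 s with h | h | h | h
  · rw [w.edgeClass_of_top h]
    have : s = ⟨{0, 2}, by decide⟩ := Subtype.ext h
    rw [this, layeredEdge, add_sub_cancel_right]
    exact Relation.EqvGen.refl _
  · rw [w.edgeClass_of_bot h]
    have hs' : s.1 ≠ {0, 2} := by rw [h]; decide
    obtain ⟨t, h1, h2⟩ := w.exists_sameEdge_sub_one ε j s hs'
    have hz : shapeLabel s.1 = .z' := by rw [h]; decide
    cases hl : w.letter j <;> simp only [hl, hz] at h2 <;>
      rcases h2 with ⟨-, h2⟩ | ⟨h2, -⟩ | ⟨-, h2⟩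
    · cases h2
    · exact Relation.EqvGen.trans _ _ _ (w.sameEdge_layeredEdge_of_z ε (j - 1) t h2) h1
    · cases h2
    · cases h2
    · exact Relation.EqvGen.trans _ _ _ (w.sameEdge_layeredEdge_of_z'' ε (j - 1) t h2) h1
    · cases h2
  · rw [w.edgeClass_of_z h]; exact w.sameEdge_layeredEdge_of_z ε j s h
  · rw [w.edgeClass_of_z'' h]; exact w.sameEdge_layeredEdge_of_z'' ε j s h

theorem sameEdge_layeredEdge_iff (ε : ℤˣ) (e : ZMod N) (x : ZMod N × TetEdge) :
    (w.layered ε).SameEdge (layeredEdge e) x ↔ w.edgeClass x = e := by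
  constructor
  · intro h
    rw [← w.edgeClass_eq_of_sameEdge ε h, w.edgeClass_of_top rfl]
    simp [layeredEdge]
  · rintro rfl
    exact w.sameEdge_layeredEdge ε x

theorem ncard_tetEdge (p : TetEdge → Prop) [DecidablePred p] :
    Set.ncard {s | p s} = ∑ s : TetEdge, if p s then 1 else 0 := by
  rw [Set.ncard_eq_toFinset_card', Set.toFinset_ofPred, Finset.card_filter]

theorem univ_tetEdge : (Finset.univ : Finset TetEdge) =
    {⟨{0, 1}, by decide⟩, ⟨{0, 2}, by decide⟩, ⟨{0, 3}, by decide⟩, ⟨{1, 2}, by decide⟩,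
      ⟨{1, 3}, by decide⟩, ⟨{2, 3}, by decide⟩} := by decide

theorem incidence_eq_sum (ε : ℤˣ) (e : ZMod N) (l : ShapeLabel) (j : ZMod N) :
    (w.layered ε).incidence (layeredEdge e) l j =
      ∑ s : TetEdge, if shapeLabel s.1 = l ∧ w.edgeClass (j, s) = e then 1 else 0 := by
  rw [← ncard_tetEdge]
  unfold OrientedTriangulation.incidence
  simp only [w.sameEdge_layeredEdge_iff ε]

theorem sum_tetEdge (F : TetEdge → ℕ) : ∑ s, F s =
    F ⟨{0, 1}, by decide⟩ + F ⟨{0, 2}, by decide⟩ + F ⟨{0, 3}, by decide⟩ + F ⟨{1, 2}, by decide⟩ +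
      F ⟨{1, 3}, by decide⟩ + F ⟨{2, 3}, by decide⟩ := by
  rw [univ_tetEdge]
  repeat rw [Finset.sum_insert (by decide)]
  rw [Finset.sum_singleton]
  ring

theorem shapeLabel_values : shapeLabel {0, 1} = .z ∧ shapeLabel {0, 2} = .z' ∧
    shapeLabel {0, 3} = .z'' ∧ shapeLabel {1, 2} = .z'' ∧ shapeLabel {1, 3} = .z' ∧
    shapeLabel {2, 3} = .z := by decide

theorem incidence_z (ε : ℤˣ) (e j : ZMod N) :
    (w.layered ε).incidence (layeredEdge e) .z j = if w.lastIndex .L j = e then 2 else 0 := by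
  obtain ⟨h1, h2, h3, h4, h5, h6⟩ := shapeLabel_values
  rw [w.incidence_eq_sum, sum_tetEdge]
  simp only [edgeClass, h1, h2, h3, h4, h5, h6]
  by_cases h : w.lastIndex .L j = e <;> simp [h]

theorem incidence_z'' (ε : ℤˣ) (e j : ZMod N) :
    (w.layered ε).incidence (layeredEdge e) .z'' j = if w.lastIndex .R j = e then 2 else 0 := by
  obtain ⟨h1, h2, h3, h4, h5, h6⟩ := shapeLabel_values
  rw [w.incidence_eq_sum, sum_tetEdge]
  simp only [edgeClass, h1, h2, h3, h4, h5, h6]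
  by_cases h : w.lastIndex .R j = e <;> simp [h]

theorem incidence_z' (ε : ℤˣ) (e j : ZMod N) :
    (w.layered ε).incidence (layeredEdge e) .z' j =
      (if j + 1 = e then 1 else 0) + if w.lastIndex (w.letter j) (j - 1) = e then 1 else 0 := by
  obtain ⟨h1, h2, h3, h4, h5, h6⟩ := shapeLabel_values
  have h7 : ({1, 3} : Finset (Fin 4)) ≠ {0, 2} := by decide
  rw [w.incidence_eq_sum, sum_tetEdge]
  simp [edgeClass, h1, h2, h3, h4, h5, h6, h7]

/-! ### The Neumann–Zagier matrices -/

omit [NeZero N] in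
theorem winding_eq (ε : ℤˣ) (l : ShapeLabel) (j : ZMod N) :
    (w.longitude ε).winding l j = 2 * match l with
      | .z => if j = 0 then 1 else 0
      | .z' => (if j = 1 then 1 else 0) - if j = -1 then 1 else 0
      | .z'' => if j = 0 then -1 else 0 := by
  have hlab : ∀ ρ : Equiv.Perm (Fin 4), (ρ = 1 ∨ ρ = squareRot) → ∀ k : Fin 8,
      shapeLabel {longitudePerm ρ k 0, longitudePerm ρ k 3} =
        (![.z, .z', .z'', .z', .z, .z', .z'', .z'] : Fin 8 → ShapeLabel) k ∧
      -((Equiv.Perm.sign (longitudePerm ρ k) : ℤˣ) : ℤ) =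
        (![1, -1, -1, 1, 1, -1, -1, 1] : Fin 8 → ℤ) k := by
    rintro ρ (rfl | rfl) <;> decide
  have h : (w.longitude ε).winding l j = ∑ k : Fin 8,
      if longitudeTet (N := N) k = j ∧
          shapeLabel {longitudePerm (layerTwist ε (1 : ZMod N)) k 0,
            longitudePerm (layerTwist ε (1 : ZMod N)) k 3} = l
        then -((Equiv.Perm.sign (longitudePerm (layerTwist ε (1 : ZMod N)) k) : ℤˣ) : ℤ)
        else 0 := rfl
  rw [h]
  simp only [hlab _ (layerTwist_cases ε (1 : ZMod N))]
  simp only [Fin.sum_univ_eight, longitudeTet, Matrix.cons_val]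
  cases l <;> simp only [reduceCtorEq, and_true, and_false, if_false, eq_comm (b := j)] <;>
    split_ifs <;> norm_num

end LRWord

namespace LRWord

variable {N : ℕ} [NeZero N] (w : LRWord N)

theorem sum_add_one {M : Type*} [AddCommMonoid M] (g : ZMod N → M) :
    ∑ i, g (i + 1) = ∑ i, g i := Equiv.sum_comp (Equiv.addRight (1 : ZMod N)) g

theorem sum_sub_one {M : Type*} [AddCommMonoid M] (g : ZMod N → M) :
    ∑ i, g (i - 1) = ∑ i, g i := Equiv.sum_comp (Equiv.subRight (1 : ZMod N)) g

theorem lastIndex_ne_of_letter {X : Letter} {j e : ZMod N} (h : w.letter e ≠ X) :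
    w.lastIndex X j ≠ e := fun h' => h (by rw [← h', w.letter_lastIndex])

/-- The matrix `B / 2`. -/
def halfB (p : ZMod N) : Matrix (ZMod N) (ZMod N) ℤ := Matrix.of fun i j =>
  if i = p then if j = 0 then 1 else 0
  else (if w.lastIndex .L j = i then 1 else 0) - if w.lastIndex .R j = i then 1 else 0

variable (ε : ℤˣ) (p : ZMod N) (z : ZMod N → ℂ) (f f' : ZMod N → ℤ)

theorem nzDatum_B : (w.nzDatum ε p z f f').B = (2 : ℤ) • w.halfB p := by
  ext i j
  simp only [nzDatum, OrientedTriangulation.nzDatum, OrientedTriangulation.reducedGluing,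
    Matrix.sub_apply, Matrix.of_apply, winding_eq, halfB, Matrix.smul_apply, incidence_z,
    incidence_z'', smul_eq_mul]
  split_ifs <;> norm_num

theorem nzDatum_A (i j : ZMod N) : (w.nzDatum ε p z f f').A i j =
    if i = p then ((if j = 1 then 1 else 0) - if j = -1 then 1 else 0) + if j = 0 then 1 else 0
    else (if j + 1 = i then 1 else 0) + (if w.lastIndex (w.letter j) (j - 1) = i then 1 else 0)
      - 2 * if w.lastIndex .R j = i then 1 else 0 := by
  simp only [nzDatum, OrientedTriangulation.nzDatum, OrientedTriangulation.reducedGluing,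
    Matrix.sub_apply, Matrix.of_apply, winding_eq, incidence_z', incidence_z'']
  split_ifs <;> norm_num

/-- For each edge there is exactly one tetrahedron whose bottom diagonal it is. -/
theorem sum_ite_bottom (e : ZMod N) :
    ∑ j, (if w.lastIndex (w.letter j) (j - 1) = e then (1 : ℤ) else 0) = 1 := by
  have h : ∀ j, (if w.lastIndex (w.letter j) (j - 1) = e then (1 : ℤ) else 0) =
      (if w.lastIndex (w.letter e) (j - 1) = e then (1 : ℤ) else 0)
        - (if w.lastIndex (w.letter e) j = e then 1 else 0) + if j = e then 1 else 0 := by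
    intro j
    by_cases hj : w.letter j = w.letter e
    · rw [hj, w.lastIndex_of_eq hj]; ring
    · have hje : j ≠ e := fun h => hj (by rw [h])
      rw [w.lastIndex_of_ne hj, if_neg (w.lastIndex_ne_of_letter (Ne.symm hj)), if_neg hje]
      ring
  simp only [h, Finset.sum_add_distrib, Finset.sum_sub_distrib]
  rw [sum_sub_one (fun j => if w.lastIndex (w.letter e) j = e then (1 : ℤ) else 0)]
  simp

/-- `ν = A (1, …, 1)ᵗ`: every edge has exactly two corners with label `z'`, and the signed
number of those on the longitude is zero. -/
theorem nzDatum_nu (i : ZMod N) : (w.nzDatum ε p z f f').ν i =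
    ∑ j, (w.nzDatum ε p z f f').A i j := by
  simp only [nzDatum, OrientedTriangulation.nzDatum, Matrix.sub_apply, Finset.sum_sub_distrib]
  congr 1
  simp only [OrientedTriangulation.reducedGluing, Matrix.of_apply, winding_eq, incidence_z']
  by_cases h : i = p
  · simp [h]
  · simp only [h, if_false]
    push_cast
    rw [Finset.sum_add_distrib, w.sum_ite_bottom,
      sum_add_one (fun j => if j = i then (1 : ℤ) else 0)]
    simp

/-- The symmetric operator `2 B⁻¹ A`: the Hessian of the quadratic form that is the sum of
`x_{i-1} x_i` over the letters `L` and of `(x_i - x_{i-1})² / 2` over the letters `R`. -/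
def hess {R : Type*} [CommRing R] (x : ZMod N → R) (i : ZMod N) : R :=
  (if w.letter i = .L then x (i - 1) else x i - x (i - 1)) +
    if w.letter (i + 1) = .L then x (i + 1) else x i - x (i + 1)

/-- The symmetric bilinear form of `LRWord.hess`. -/
def hessForm {R : Type*} [CommRing R] (y x : ZMod N → R) : R :=
  ∑ i, if w.letter i = .L then y i * x (i - 1) + y (i - 1) * x i
    else (y i - y (i - 1)) * (x i - x (i - 1))

theorem sum_mul_hess {R : Type*} [CommRing R] (y x : ZMod N → R) :
    ∑ i, y i * w.hess x i = w.hessForm y x := by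
  have h := sum_add_one (fun i => y (i - 1) * if w.letter i = .L then x i else x (i - 1) - x i)
  simp only [add_sub_cancel_right] at h
  simp only [hess, mul_add, Finset.sum_add_distrib, h]
  rw [hessForm, ← Finset.sum_add_distrib]
  refine Finset.sum_congr rfl fun i _ => ?_
  split_ifs <;> ring

theorem hessForm_comm {R : Type*} [CommRing R] (y x : ZMod N → R) :
    w.hessForm y x = w.hessForm x y := by
  refine Finset.sum_congr rfl fun i _ => ?_
  split_ifs <;> ring

omit [NeZero N] in
theorem hess_intCast {R : Type*} [CommRing R] (x : ZMod N → ℤ) (i : ZMod N) :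
    ((w.hess x i : ℤ) : R) = w.hess (fun j => (x j : R)) i := by
  simp only [hess]; split_ifs <;> push_cast <;> rfl

/-- The relation `(B / 2) (2 B⁻¹ A) = A`, over any commutative ring. -/
theorem halfB_mulVec_hess {R : Type*} [CommRing R] (x : ZMod N → R) :
    (w.halfB p).map (Int.cast : ℤ → R) *ᵥ w.hess x =
      (w.nzDatum ε p z f f').A.map (Int.cast : ℤ → R) *ᵥ x := by
  ext i
  simp only [Matrix.mulVec, dotProduct, Matrix.map_apply, nzDatum_A, halfB, Matrix.of_apply]
  by_cases hi : i = p
  · simp [hi, hess, w.first, w.last, sub_mul, add_mul, Finset.sum_add_distrib]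
    ring
  simp only [hi, if_false]
  set e := i
  set u : ZMod N → R := fun j => (if w.lastIndex .L j = e then 1 else 0) -
    if w.lastIndex .R j = e then 1 else 0 with hu
  set r : ZMod N → R := fun j => if w.lastIndex .R j = e then 1 else 0 with hr
  have h1 := sum_add_one (fun j => u (j - 1) *
    if w.letter j = .L then x j else x (j - 1) - x j)
  have h2 := sum_add_one (fun j => (if j = e then (1 : R) else 0) * x (j - 1))
  have h3 := sum_sub_one (fun j => r j * x j)
  simp only [add_sub_cancel_right] at h1 h2
  have hL : ∑ j, (((if w.lastIndex .L j = e then 1 else 0) -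
      if w.lastIndex .R j = e then 1 else 0 : ℤ) : R) * w.hess x j =
      ∑ j, (u j * (if w.letter j = .L then x (j - 1) else x j - x (j - 1)) + u (j - 1) *
        if w.letter j = .L then x j else x (j - 1) - x j) := by
    rw [Finset.sum_add_distrib, ← h1, ← Finset.sum_add_distrib]
    refine Finset.sum_congr rfl fun j _ => ?_
    simp only [hess, hu]; push_cast; ring
  have hR : ∑ j, (((if j + 1 = e then 1 else 0) +
      (if w.lastIndex (w.letter j) (j - 1) = e then 1 else 0)
      - 2 * if w.lastIndex .R j = e then 1 else 0 : ℤ) : R) * x j =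
      ∑ j, ((if j = e then (1 : R) else 0) * x (j - 1) +
        ((if w.lastIndex (w.letter j) (j - 1) = e then 1 else 0) - 2 * r j) * x j) := by
    rw [Finset.sum_add_distrib, ← h2, ← Finset.sum_add_distrib]
    refine Finset.sum_congr rfl fun j _ => ?_
    simp only [hr]; push_cast; ring
  rw [hL, hR, ← sub_eq_zero, ← Finset.sum_sub_distrib]
  -- the difference of the two summands telescopes
  have hT : ∑ j, (r j * x j - r (j - 1) * x (j - 1)) = 0 := by
    rw [Finset.sum_sub_distrib, h3, sub_self]
  refine Eq.trans (Finset.sum_congr rfl fun j _ => ?_) hT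
  cases hl : w.letter j
  · have e1 : w.lastIndex .R j = w.lastIndex .R (j - 1) := w.lastIndex_of_ne (by simp [hl])
    simp only [hu, hr, if_true, w.lastIndex_of_eq hl, e1]
    ring
  · have e1 : w.lastIndex .L j = w.lastIndex .L (j - 1) := w.lastIndex_of_ne (by simp [hl])
    simp only [hu, hr, reduceCtorEq, if_false, w.lastIndex_of_eq hl, e1]
    ring

theorem halfB_mulVec_beta : w.halfB p *ᵥ w.beta = Pi.single p 1 := by
  ext i
  simp only [Matrix.mulVec, dotProduct, halfB, Matrix.of_apply]
  by_cases hi : i = p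
  · subst hi
    simp [beta, w.first, w.last]
  simp only [hi, if_false, Pi.single_apply]
  -- `β` is the difference of the indicator function of `L`
  have hβ : ∀ (c : ℤ) j, w.beta j = ((if w.letter (j + 1) = .L then 1 else 0) - c) -
      ((if w.letter j = .L then 1 else 0) - c) := by
    intro c j
    unfold beta
    cases w.letter j <;> cases w.letter (j + 1) <;> (simp; try ring)
  have key : ∀ (X : Letter) (c : ℤ), (c = if X = .L then 1 else 0) →
      ∑ j, (if w.lastIndex X j = i then 1 else 0) * w.beta j = 0 := by
    intro X c hc
    have h1 := sum_add_one (fun j => (if w.lastIndex X (j - 1) = i then 1 else 0) *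
      ((if w.letter j = .L then 1 else 0) - c))
    simp only [add_sub_cancel_right] at h1
    simp only [hβ c, mul_sub _ (_ - c) (_ - c), Finset.sum_sub_distrib, h1]
    rw [← Finset.sum_sub_distrib]
    refine Finset.sum_eq_zero fun j _ => ?_
    by_cases hj : w.letter j = X
    · rw [hj, hc]; simp
    · rw [w.lastIndex_of_ne hj]; simp
  simp only [sub_mul, Finset.sum_sub_distrib, key .L _ rfl, key .R _ rfl, sub_self]

/-! ### Unimodularity of `B / 2` -/

/-- The rows of all edges have sum zero, so the row of the removed edge is in the row lattice of
`B / 2`, too. -/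
theorem exists_vecMul_halfB (e : ZMod N) :
    ∃ v : ZMod N → ℤ, ∀ j, (v ᵥ* w.halfB p) j =
      (if w.lastIndex .L j = e then 1 else 0) - if w.lastIndex .R j = e then 1 else 0 := by
  by_cases h : e = p
  · subst h
    refine ⟨fun i => if i = e then 0 else -1, fun j => ?_⟩
    have h1 : ∑ i, (((if w.lastIndex .L j = i then 1 else 0) -
        if w.lastIndex .R j = i then 1 else 0 : ℤ)) = 0 := by simp
    rw [← Finset.add_sum_erase _ _ (Finset.mem_univ e)] at h1
    simp only [Matrix.vecMul, dotProduct]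
    rw [← Finset.add_sum_erase _ _ (Finset.mem_univ e)]
    rw [eq_neg_of_add_eq_zero_left h1, ← Finset.sum_neg_distrib]
    simp only [if_true, zero_mul, zero_add]
    refine Finset.sum_congr rfl fun i hi => ?_
    simp [Finset.ne_of_mem_erase hi, halfB]
  · refine ⟨Pi.single e 1, fun j => ?_⟩
    simp [halfB, h]

theorem exists_lastIndex_natCast {X : Letter} {i k : ℕ} (hik : i ≤ k)
    (hi : w.letter (i : ZMod N) = X) :
    ∃ l, i ≤ l ∧ l ≤ k ∧ w.lastIndex X (k : ZMod N) = (l : ZMod N) := by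
  induction k, hik using Nat.le_induction with
  | base => exact ⟨i, le_rfl, le_rfl, w.lastIndex_of_eq hi⟩
  | succ k hik ih =>
    by_cases h : w.letter ((k + 1 : ℕ) : ZMod N) = X
    · exact ⟨k + 1, by omega, le_rfl, w.lastIndex_of_eq h⟩
    · obtain ⟨l, h1, h2, h3⟩ := ih
      refine ⟨l, h1, by omega, ?_⟩
      rw [w.lastIndex_of_ne h, ← h3]
      congr 1
      push_cast
      ring

omit [NeZero N] in
theorem natCast_inj_of_lt {i j : ℕ} (hi : i < N) (hj : j < N) (h : (i : ZMod N) = j) : i = j := by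
  rw [← ZMod.val_cast_of_lt hi, ← ZMod.val_cast_of_lt hj, h]

theorem single_mem_range_vecMul_halfB (k : ℕ) (hk : k < N) :
    (Pi.single (k : ZMod N) 1 : ZMod N → ℤ) ∈ LinearMap.range (w.halfB p).vecMulLinear := by
  induction k using Nat.strong_induction_on with
  | _ k ih =>
  rcases Nat.eq_zero_or_pos k with rfl | hk0
  · refine ⟨Pi.single p 1, ?_⟩
    ext j
    simp [halfB, Pi.single_apply]
  -- the row of the last letter before `k + 1` that agrees with it ends in the column `k`
  set X := w.letter ((k + 1 : ℕ) : ZMod N) with hX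
  obtain ⟨l, hlk, hl⟩ : ∃ l, l ≤ k ∧ w.lastIndex X (k : ZMod N) = (l : ZMod N) := by
    cases X
    · obtain ⟨l, -, h⟩ := w.exists_lastIndex_natCast (X := .L) (i := 1) (k := k) hk0
        (by simp [w.first])
      exact ⟨l, h⟩
    · obtain ⟨l, -, h⟩ := w.exists_lastIndex_natCast (X := .R) (i := 0) (k := k) hk0.le
        (by simp [w.last])
      exact ⟨l, h⟩
  have hlX : w.letter (l : ZMod N) = X := by rw [← hl, w.letter_lastIndex]
  obtain ⟨v, hv⟩ := w.exists_vecMul_halfB p (l : ZMod N)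
  have hgt : ∀ j, k < j → j < N → w.lastIndex X (j : ZMod N) ≠ (l : ZMod N) := by
    intro j hkj hj h
    obtain ⟨i, h1, h2, h3⟩ := w.exists_lastIndex_natCast (X := X) (i := k + 1) (k := j) hkj hX.symm
    have := natCast_inj_of_lt (by omega) (by omega) (h3.symm.trans h)
    omega
  set r : ZMod N → ℤ := fun j => if w.lastIndex X j = (l : ZMod N) then 1 else 0 with hr
  have hrmem : r ∈ LinearMap.range (w.halfB p).vecMulLinear := by
    have hmem : v ᵥ* w.halfB p ∈ LinearMap.range (w.halfB p).vecMulLinear := ⟨v, rfl⟩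
    cases hX' : X
    · convert hmem using 1
      ext j
      rw [hv j, if_neg (w.lastIndex_ne_of_letter (X := .R) (by rw [hlX, hX']; decide))]
      simp [hr, hX']
    · convert Submodule.neg_mem _ hmem using 1
      ext j
      rw [Pi.neg_apply, hv j,
        if_neg (w.lastIndex_ne_of_letter (X := .L) (by rw [hlX, hX']; decide))]
      simp [hr, hX']
  have hsum : (Pi.single (k : ZMod N) 1 : ZMod N → ℤ) =
      r - ∑ j ∈ Finset.range k, r (j : ZMod N) • (Pi.single (j : ZMod N) 1 : ZMod N → ℤ) := by
    ext i
    obtain ⟨i, hi, rfl⟩ : ∃ i' : ℕ, i' < N ∧ (i' : ZMod N) = i :=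
      ⟨i.val, ZMod.val_lt i, ZMod.natCast_zmod_val i⟩
    have hinj : ∀ j < N, ((i : ZMod N) = (j : ZMod N)) = (i = j) := fun j hj =>
      propext ⟨natCast_inj_of_lt hi hj, fun h => by rw [h]⟩
    have : ∑ j ∈ Finset.range k, r (j : ZMod N) * (Pi.single (j : ZMod N) 1 : ZMod N → ℤ) i =
        if i < k then r (i : ZMod N) else 0 := by
      rw [Finset.sum_congr rfl (g := fun j => if i = j then r (i : ZMod N) else 0)]
      · simp
      · intro j hj
        simp only [Pi.single_apply, hinj j (by have := Finset.mem_range.1 hj; omega)]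
        by_cases h : i = j <;> simp [h]
    simp only [Pi.sub_apply, Finset.sum_apply, Pi.smul_apply, smul_eq_mul, this]
    simp only [Pi.single_apply, hinj k hk]
    rcases lt_trichotomy i k with h | rfl | h
    · simp [h, h.ne]
    · simp [hr, hl]
    · simp [h.ne', hr, hgt i h hi]
  rw [hsum]
  refine Submodule.sub_mem _ hrmem (Submodule.sum_mem _ fun j hj => Submodule.smul_mem _ _ ?_)
  have := Finset.mem_range.1 hj
  exact ih j this (by omega)

theorem isUnit_det_halfB : IsUnit (w.halfB p).det := by
  have h : ∀ j : ZMod N, ∃ v, v ᵥ* w.halfB p = Pi.single j 1 := by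
    intro j
    have := w.single_mem_range_vecMul_halfB p j.val (ZMod.val_lt j)
    rw [ZMod.natCast_zmod_val] at this
    exact this
  choose V hV using h
  have h1 : Matrix.of V * w.halfB p = 1 := by
    ext i j
    rw [Matrix.mul_apply_eq_vecMul, Matrix.one_eq_pi_single]
    exact congrFun (hV i) j
  have h2 := congrArg Matrix.det h1
  rw [Matrix.det_mul, Matrix.det_one] at h2
  exact IsUnit.of_mul_eq_one _ (by rw [mul_comm]; exact h2)

/-! ### The Neumann–Zagier datum in terms of the quadratic form -/

/-- The vector `η = 2 B⁻¹ ν`; its entries are the numbers of letters `L` in `φ_i φ_{i+1}`. -/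
def eta : ZMod N → ℤ := w.hess 1

theorem halfB_mulVec_hess_int (x : ZMod N → ℤ) :
    w.halfB p *ᵥ w.hess x = (w.nzDatum ε p z f f').A *ᵥ x := by
  have := w.halfB_mulVec_hess ε p z f f' x
  have h : ∀ M : Matrix (ZMod N) (ZMod N) ℤ, M.map (Int.cast : ℤ → ℤ) = M := fun M => by
    ext; simp
  rwa [h, h] at this

theorem halfB_mulVec_eta : w.halfB p *ᵥ w.eta = (w.nzDatum ε p z f f').ν := by
  rw [eta, w.halfB_mulVec_hess_int ε p z f f']
  ext i
  rw [nzDatum_nu]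
  simp [Matrix.mulVec, dotProduct]

theorem halfB_mulVec_inj {x y : ZMod N → ℤ} (h : w.halfB p *ᵥ x = w.halfB p *ᵥ y) : x = y :=
  Matrix.mulVec_injective_of_isUnit ((Matrix.isUnit_iff_isUnit_det _).2 (w.isUnit_det_halfB p)) h

theorem halfB_inv_mulVec {x y : ZMod N → ℤ} (h : w.halfB p *ᵥ x = y) :
    (w.halfB p)⁻¹ *ᵥ y = x := by
  rw [← h, Matrix.mulVec_mulVec, Matrix.nonsing_inv_mul _ (w.isUnit_det_halfB p),
    Matrix.one_mulVec]

theorem isFlattening_iff :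
    (w.nzDatum ε p z f f').IsFlattening ↔ ∀ i, w.hess f' i + 2 * f i = w.eta i := by
  unfold NZDatum.IsFlattening
  rw [show (w.nzDatum ε p z f f').f' = f' from rfl, show (w.nzDatum ε p z f f').f = f from rfl,
    ← w.halfB_mulVec_hess_int, nzDatum_B, Matrix.smul_mulVec, ← Matrix.mulVec_smul,
    ← Matrix.mulVec_add, ← w.halfB_mulVec_eta ε p z f f']
  constructor
  · intro h i
    have := congrFun (w.halfB_mulVec_inj p h) i
    simpa using this
  · intro h
    congr 1
    ext i
    simpa using h i

theorem exists_isFlattening : ∃ f f' : ZMod N → ℤ, (w.nzDatum ε p z f f').IsFlattening :=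
  ⟨0, 1, (w.isFlattening_iff ε p z 0 1).2 fun i => by simp [eta]⟩

end LRWord

/-! ### Shapes in the upper half plane -/

namespace ShapeLabel

theorem val_z'_ne_zero {x : ℂ} (hx : 0 < x.im) : ShapeLabel.z'.val x ≠ 0 := by
  have h : (1 : ℂ) - x ≠ 0 := fun h => by
    have := congrArg Complex.im h
    simp at this
    exact hx.ne' this
  simpa [ShapeLabel.val] using h

theorem inv_val_z' (x : ℂ) : (ShapeLabel.z'.val x)⁻¹ = 1 - x := by
  simp [ShapeLabel.val]

theorem val_im_pos (l : ShapeLabel) {x : ℂ} (hx : 0 < x.im) : 0 < (l.val x).im := by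
  have h0 : x ≠ 0 := fun h => by rw [h] at hx; simp at hx
  have h1 : (1 : ℂ) - x ≠ 0 := fun h => by
    have := congrArg Complex.im h
    simp at this
    exact hx.ne' this
  cases l
  · exact hx
  · simp only [ShapeLabel.val, one_div, Complex.inv_im]
    have := Complex.normSq_pos.2 h1
    simp only [Complex.sub_im, Complex.one_im, zero_sub, neg_neg]
    positivity
  · simp only [ShapeLabel.val, one_div, Complex.sub_im, Complex.one_im, Complex.inv_im, zero_sub]
    have := Complex.normSq_pos.2 h0
    rw [neg_div, neg_neg]
    positivity

/-- `log z + log z' + log z'' = π i` in the upper half plane: the left hand side is a logarithm of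
`z z' z'' = -1` with imaginary part in `(0, 3 π)`. -/
theorem log_add_log_add_log {x : ℂ} (hx : 0 < x.im) :
    Complex.log x + Complex.log (ShapeLabel.z'.val x) + Complex.log (ShapeLabel.z''.val x) =
      Real.pi * Complex.I := by
  have h0 : x ≠ 0 := fun h => by rw [h] at hx; simp at hx
  have h1 : (1 : ℂ) - x ≠ 0 := fun h => by
    have := congrArg Complex.im h
    simp at this
    exact hx.ne' this
  have hne : ∀ y : ℂ, 0 < y.im → y ≠ 0 := fun y hy h => by rw [h] at hy; simp at hy
  have harg : ∀ y : ℂ, 0 < y.im → 0 < (Complex.log y).im ∧ (Complex.log y).im < Real.pi := by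
    intro y hy
    rw [Complex.log_im]
    have h1 := Complex.arg_nonneg_iff.2 hy.le
    refine ⟨lt_of_le_of_ne h1 fun h => ?_, Complex.arg_lt_pi_iff.2 (Or.inr hy.ne')⟩
    have := Complex.arg_eq_zero_iff.1 h.symm
    exact hy.ne' this.2
  set s := Complex.log x + Complex.log (ShapeLabel.z'.val x) + Complex.log (ShapeLabel.z''.val x)
    with hs
  have hp := ShapeLabel.val_im_pos .z' hx
  have hpp := ShapeLabel.val_im_pos .z'' hx
  have hexp : Complex.exp s = Complex.exp (Real.pi * Complex.I) := by
    rw [hs, Complex.exp_add, Complex.exp_add, Complex.exp_log h0, Complex.exp_log (hne _ hp),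
      Complex.exp_log (hne _ hpp), Complex.exp_pi_mul_I]
    simp only [ShapeLabel.val]
    field_simp
    ring
  obtain ⟨n, hn⟩ := Complex.exp_eq_exp_iff_exists_int.1 hexp
  have him := congrArg Complex.im hn
  obtain ⟨a1, a2⟩ := harg x hx
  obtain ⟨b1, b2⟩ := harg _ hp
  obtain ⟨c1, c2⟩ := harg _ hpp
  have hsim : s.im = (Complex.log x).im + (Complex.log (ShapeLabel.z'.val x)).im +
    (Complex.log (ShapeLabel.z''.val x)).im := by simp [hs]
  have him' : s.im = Real.pi + n * (2 * Real.pi) := by simpa using him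
  have hpi := Real.pi_pos
  have hn0 : n = 0 := by
    have h1 : (-1 : ℝ) < n := by
      by_contra h
      push Not at h
      nlinarith
    have h2 : (n : ℝ) < 1 := by
      by_contra h
      push Not at h
      nlinarith
    have h1' : (-1 : ℤ) < n := by exact_mod_cast h1
    have h2' : n < (1 : ℤ) := by exact_mod_cast h2
    omega
  rw [hn, hn0]
  simp

theorem sum_eq {M : Type*} [AddCommMonoid M] (F : ShapeLabel → M) :
    ∑ l, F l = F .z + F .z' + F .z'' := by
  have : (Finset.univ : Finset ShapeLabel) = {.z, .z', .z''} := rfl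
  rw [this, Finset.sum_insert (by decide), Finset.sum_insert (by decide), Finset.sum_singleton,
    add_assoc]

end ShapeLabel

namespace LRWord

variable {N : ℕ} [NeZero N] (w : LRWord N) (ε : ℤˣ) (p : ZMod N) (z : ZMod N → ℂ)
  (f f' : ZMod N → ℤ)

theorem isUnit_det_halfB_map : IsUnit ((w.halfB p).map (Int.cast : ℤ → ℂ)).det := by
  have h : ((w.halfB p).map (Int.cast : ℤ → ℂ)).det = (((w.halfB p).det : ℤ) : ℂ) :=
    (RingHom.map_det (Int.castRingHom ℂ) (w.halfB p)).symm
  rw [h]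
  exact (w.isUnit_det_halfB p).map (Int.castRingHom ℂ)

theorem halfB_map_mulVec_inj {x y : ZMod N → ℂ} (h : (w.halfB p).map (Int.cast : ℤ → ℂ) *ᵥ x =
    (w.halfB p).map (Int.cast : ℤ → ℂ) *ᵥ y) : x = y :=
  Matrix.mulVec_injective_of_isUnit
    ((Matrix.isUnit_iff_isUnit_det _).2 (w.isUnit_det_halfB_map p)) h

theorem sum_reducedGluing_mul_log (hz : (w.layered ε).IsGeometricSolution (w.longitude ε) z)
    (i : ZMod N) :
    ∑ j, ∑ l : ShapeLabel, ((w.layered ε).reducedGluing layeredEdge (w.longitude ε) p l i j : ℂ) *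
      Complex.log (l.val (z j)) = (if i = p then 0 else 2) * (Real.pi * Complex.I) := by
  by_cases h : i = p
  · have h2 : (2 : ℂ) * ∑ j, ∑ l : ShapeLabel,
        ((w.layered ε).reducedGluing layeredEdge (w.longitude ε) p l i j : ℂ) *
          Complex.log (l.val (z j)) = 0 := by
      rw [← hz.cusp, Finset.mul_sum]
      refine Finset.sum_congr rfl fun j _ => ?_
      rw [Finset.mul_sum]
      refine Finset.sum_congr rfl fun l _ => ?_
      obtain ⟨c, hc⟩ := w.longitude_even ε l j
      simp only [OrientedTriangulation.reducedGluing, Matrix.of_apply, h, if_true, hc]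
      rw [Int.mul_ediv_cancel_left _ two_ne_zero]
      push_cast
      ring
    simpa [h] using h2
  · have := hz.edge (layeredEdge i)
    simp only [OrientedTriangulation.reducedGluing, Matrix.of_apply, h, if_false, Int.cast_natCast]
    rw [this]
    ring

/-- The logarithmic gluing equations, solved for `2 log z`. -/
theorem hess_log_add (hz : (w.layered ε).IsGeometricSolution (w.longitude ε) z) (i : ZMod N) :
    w.hess (fun j => Complex.log (ShapeLabel.z'.val (z j))) i + 2 * Complex.log (z i) =
      Real.pi * Complex.I * (w.eta i : ℂ) := by
  have key : w.hess (fun j => Complex.log (ShapeLabel.z'.val (z j))) +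
      (2 : ℂ) • (fun j => Complex.log (z j)) =
      (Real.pi * Complex.I) • fun i => (w.eta i : ℂ) := by
    apply w.halfB_map_mulVec_inj 0
    have hη : (w.halfB 0).map (Int.cast : ℤ → ℂ) *ᵥ (fun i => (w.eta i : ℂ)) =
        fun i => (((w.nzDatum ε 0 z 0 0).ν i : ℤ) : ℂ) := by
      rw [← w.halfB_mulVec_eta ε 0 z 0 0]
      ext i
      simp [Matrix.mulVec, dotProduct]
    have hB : (2 : ℂ) • ((w.halfB 0).map (Int.cast : ℤ → ℂ) *ᵥ fun j => Complex.log (z j)) =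
        (w.nzDatum ε 0 z 0 0).B.map (Int.cast : ℤ → ℂ) *ᵥ fun j => Complex.log (z j) := by
      rw [nzDatum_B, ← Matrix.smul_mulVec]
      congr 1
      ext i j
      simp only [Matrix.map_apply, Matrix.smul_apply, smul_eq_mul]
      push_cast
      rfl
    rw [Matrix.mulVec_add, Matrix.mulVec_smul, Matrix.mulVec_smul, hη, hB,
      w.halfB_mulVec_hess ε 0 z 0 0]
    ext i
    have h := w.sum_reducedGluing_mul_log ε 0 z hz i
    simp only [ShapeLabel.sum_eq] at h
    simp only [Pi.add_apply, Matrix.mulVec, dotProduct, Matrix.map_apply, Pi.smul_apply,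
      smul_eq_mul, nzDatum, OrientedTriangulation.nzDatum, Matrix.sub_apply, Int.cast_sub,
      Int.cast_sum, mul_sub]
    have h3 : ((((if i = 0 then 0 else 2 : ℤ)) : ℂ)) = if i = 0 then 0 else 2 := by
      split_ifs <;> simp
    rw [h3, mul_comm _ (if i = 0 then (0 : ℂ) else 2), ← h, Finset.mul_sum,
      ← Finset.sum_add_distrib, ← Finset.sum_sub_distrib]
    refine Finset.sum_congr rfl fun j _ => ?_
    rw [← ShapeLabel.log_add_log_add_log (hz.im_pos j)]
    simp only [show ShapeLabel.z.val (z j) = z j from rfl]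
    ring
  exact congrFun key i

/-! ### Nonvanishing of the 1-loop determinant -/

/-- A complex symmetric matrix with definite imaginary part has trivial kernel. -/
theorem hess_add_injective {W : ZMod N → ℂ} (hW : ∀ i, (W i).im < 0) {v : ZMod N → ℂ}
    (h : ∀ i, w.hess v i + 2 * (W i * v i) = 0) : v = 0 := by
  have h1 : ∑ i, (starRingEnd ℂ (v i) * w.hess v i +
      2 * (W i * (Complex.normSq (v i) : ℂ))) = 0 := by
    refine Finset.sum_eq_zero fun i _ => ?_
    have := congrArg (fun x => starRingEnd ℂ (v i) * x) (h i)
    simp only [mul_zero] at this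
    rw [Complex.normSq_eq_conj_mul_self, ← this]
    ring
  have h2 := congrArg Complex.im h1
  rw [Finset.sum_add_distrib, w.sum_mul_hess, Complex.add_im] at h2
  have h3 : (w.hessForm (fun i => starRingEnd ℂ (v i)) v).im = 0 := by
    refine Complex.conj_eq_iff_im.1 ?_
    simp only [hessForm, map_sum]
    refine Finset.sum_congr rfl fun i _ => ?_
    split_ifs <;> simp <;> ring
  rw [h3, zero_add, Complex.im_sum, Complex.zero_im] at h2
  have h4 : ∀ i, (2 * (W i * (Complex.normSq (v i) : ℂ))).im =
      2 * ((W i).im * Complex.normSq (v i)) := by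
    intro i
    simp
  simp only [h4] at h2
  have h5 := (Finset.sum_eq_zero_iff_of_nonpos (fun i _ => by
    have := mul_nonpos_of_nonpos_of_nonneg (hW i).le (Complex.normSq_nonneg (v i))
    linarith)).1 h2
  ext i
  have h6 := h5 i (Finset.mem_univ i)
  have h7 : Complex.normSq (v i) = 0 := by
    rcases mul_eq_zero.1 h6 with h | h
    · norm_num at h
    · exact (mul_eq_zero.1 h).resolve_left (hW i).ne
  exact Complex.normSq_eq_zero.1 h7

theorem det_ne_zero (hz : ∀ j, 0 < (z j).im) :
    ((w.nzDatum ε p z f f').A.map (Int.cast : ℤ → ℂ) * Matrix.diagonal z +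
      (w.nzDatum ε p z f f').B.map (Int.cast : ℤ → ℂ) *
        Matrix.diagonal (fun i => ((w.nzDatum ε p z f f').z' i)⁻¹)).det ≠ 0 := by
  have hz0 : ∀ j, z j ≠ 0 := fun j h => by have := hz j; rw [h] at this; simp at this
  intro hdet
  obtain ⟨v, hv0, hv⟩ := Matrix.exists_mulVec_eq_zero_iff.2 hdet
  apply hv0
  have hBm : (w.nzDatum ε p z f f').B.map (Int.cast : ℤ → ℂ) =
      (2 : ℂ) • (w.halfB p).map (Int.cast : ℤ → ℂ) := by
    rw [nzDatum_B]
    ext i j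
    simp only [Matrix.map_apply, Matrix.smul_apply, smul_eq_mul]
    push_cast
    rfl
  rw [Matrix.add_mulVec, ← Matrix.mulVec_mulVec, ← Matrix.mulVec_mulVec,
    ← w.halfB_mulVec_hess ε p z f f', hBm, Matrix.smul_mulVec, ← Matrix.mulVec_smul,
    ← Matrix.mulVec_add] at hv
  have h1 := w.halfB_map_mulVec_inj p (hv.trans (Matrix.mulVec_zero _).symm)
  have h2 : (fun j => z j * v j) = 0 := by
    refine w.hess_add_injective (W := fun j => (1 - z j) / z j) (fun i => ?_) fun i => ?_
    · have : (1 - z i) / z i = (z i)⁻¹ - 1 := by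
        have := hz0 i
        field_simp
      rw [this, Complex.sub_im, Complex.inv_im, Complex.one_im, sub_zero]
      exact div_neg_of_neg_of_pos (neg_lt_zero.2 (hz i)) (Complex.normSq_pos.2 (hz0 i))
    · have := congrFun h1 i
      simp only [Pi.add_apply, Pi.smul_apply, smul_eq_mul, Pi.zero_apply,
        Matrix.mulVec_diagonal] at this
      have hd : Matrix.diagonal z *ᵥ v = fun j => z j * v j := by
        ext j; rw [Matrix.mulVec_diagonal]
      rw [hd] at this
      rw [← this, NZDatum.z', ShapeLabel.inv_val_z', show (w.nzDatum ε p z f f').z = z from rfl]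
      have := hz0 i
      field_simp
  ext i
  exact (mul_eq_zero.1 (congrFun h2 i)).resolve_left (hz0 i)

theorem tauOne_nonempty (hz : ∀ j, 0 < (z j).im) : (w.nzDatum ε p z f f').tauOne.Nonempty := by
  have hz0 : ∀ j, z j ≠ 0 := fun j h => by have := hz j; rw [h] at this; simp at this
  have hc := mul_ne_zero (w.det_ne_zero ε p z f f' hz) (mul_ne_zero
    (Finset.prod_ne_zero_iff.2 fun i (_ : i ∈ Finset.univ) =>
      zpow_ne_zero ((w.nzDatum ε p z f f').f i) (ShapeLabel.val_z'_ne_zero (hz i)))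
    (Finset.prod_ne_zero_iff.2 fun i (_ : i ∈ Finset.univ) =>
      zpow_ne_zero (-(w.nzDatum ε p z f f').f' i) (hz0 i)))
  have hsqrt : ∀ c : ℂ, c ≠ 0 → ∃ t : ℂ, t ^ 2 * c = 1 := fun c hc => by
    obtain ⟨t, ht⟩ := IsAlgClosed.exists_pow_nat_eq c⁻¹ zero_lt_two
    exact ⟨t, by rw [ht, inv_mul_cancel₀ hc]⟩
  exact hsqrt _ hc

end LRWord

/-! ### Roots of unity and Dedekind sums -/

theorem expTwoPi_pow (x : ℚ) (k : ℕ) : expTwoPi x ^ k = expTwoPi (k * x) := by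
  unfold expTwoPi
  rw [← Complex.exp_nat_mul]
  congr 1
  push_cast
  ring

theorem expTwoPi_neg (x : ℚ) : expTwoPi (-x) = (expTwoPi x)⁻¹ := by
  unfold expTwoPi
  rw [← Complex.exp_neg]
  congr 1
  push_cast
  ring

theorem expTwoPi_eq_one_iff (x : ℚ) : expTwoPi x = 1 ↔ ∃ k : ℤ, x = k := by
  unfold expTwoPi
  rw [Complex.exp_eq_one_iff]
  have h : (2 * Real.pi * Complex.I : ℂ) ≠ 0 := Complex.two_pi_I_ne_zero
  refine exists_congr fun k => ?_
  rw [mul_comm (2 * Real.pi * Complex.I : ℂ) (x : ℂ), mul_left_inj' h]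
  exact_mod_cast Iff.rfl

theorem isPrimitiveRoot_expTwoPi {n : ℕ} [NeZero n] {a : ℤ} (ha : IsCoprime a (n : ℤ)) :
    IsPrimitiveRoot (expTwoPi (a / n)) n := by
  have hn : (n : ℚ) ≠ 0 := Nat.cast_ne_zero.2 (NeZero.ne n)
  constructor
  · rw [expTwoPi_pow, expTwoPi_eq_one_iff]
    exact ⟨a, by field_simp⟩
  · intro l hl
    rw [expTwoPi_pow, expTwoPi_eq_one_iff] at hl
    obtain ⟨k, hk⟩ := hl
    have h1 : (l : ℤ) * a = k * n := by
      have : (l : ℚ) * a = k * n := by field_simp at hk; linarith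
      exact_mod_cast this
    have h2 : (n : ℤ) ∣ l * a := ⟨k, by rw [h1]; ring⟩
    exact_mod_cast ha.symm.dvd_of_dvd_mul_right h2

/-- Roots of unity of order `m` are the numbers `e(k / m)`. -/
theorem exists_expTwoPi_of_pow_eq_one {m : ℕ} (hm : m ≠ 0) {x : ℂ} (hx : x ^ m = 1) :
    ∃ k : ℤ, x = expTwoPi (k / m) := by
  have : NeZero m := ⟨hm⟩
  have h : IsPrimitiveRoot (expTwoPi ((1 : ℤ) / m)) m :=
    isPrimitiveRoot_expTwoPi (a := 1) isCoprime_one_left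
  obtain ⟨i, -, hi⟩ := h.eq_pow_of_pow_eq_one hx
  refine ⟨i, ?_⟩
  rw [← hi, expTwoPi_pow]
  congr 1
  push_cast
  ring

/-- The common denominator of the Dedekind sums `s(b, n)` for odd `n`. -/
theorem exists_dedekindSum_eq {n : ℕ} (hn : Odd n) {b : ℤ} (hb : IsCoprime b (n : ℤ)) :
    ∃ k : ℤ, 6 * n * dedekindSum b n = k := by
  have hn0 : (n : ℚ) ≠ 0 := by
    have := hn.pos
    positivity
  have hterm : ∀ j ∈ Finset.Ico 1 n, ∃ k : ℤ,
      6 * n * (sawtooth ((j : ℚ) / n) * sawtooth ((b : ℚ) * j / n)) =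
        6 * b * j ^ 2 / n + 3 * n / 2 + k := by
    intro j hj
    obtain ⟨hj1, hj2⟩ := Finset.mem_Ico.1 hj
    have hfr : ∀ c : ℤ, IsCoprime c (n : ℤ) → Int.fract ((c : ℚ) * j / n) ≠ 0 := by
      intro c hc h
      obtain ⟨k, hk⟩ := Int.fract_eq_zero_iff.1 h
      have h1 : c * j = k * n := by
        have : (c : ℚ) * j = k * n := by field_simp at hk; linarith
        exact_mod_cast this
      have h2 : (n : ℤ) ∣ j := hc.symm.dvd_of_dvd_mul_left ⟨k, by rw [h1]; ring⟩
      have h3 : n ∣ j := by exact_mod_cast h2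
      exact absurd (Nat.le_of_dvd (by omega) h3) (by omega)
    have h1 := hfr 1 isCoprime_one_left
    rw [Int.cast_one, one_mul] at h1
    have h2 := hfr b hb
    have h3 : Int.fract ((j : ℚ) / n) = j / n := by
      rw [Int.fract_eq_self]
      refine ⟨by positivity, ?_⟩
      rw [div_lt_one (by have := hn.pos; positivity)]
      exact_mod_cast hj2
    simp only [sawtooth, h2, if_false, if_neg h1]
    rw [h3]
    refine ⟨-6 * j * ⌊(b : ℚ) * j / n⌋ - 3 * j - 3 * b * j + 3 * n * ⌊(b : ℚ) * j / n⌋, ?_⟩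
    rw [← Int.self_sub_floor]
    push_cast
    field_simp
    ring
  choose! k hk using hterm
  have hsq : ∑ j ∈ Finset.Ico 1 n, (j : ℚ) ^ 2 = (n - 1) * n * (2 * n - 1) / 6 := by
    have : ∀ m : ℕ, ∑ j ∈ Finset.Ico 1 (m + 1), (j : ℚ) ^ 2 = m * (m + 1) * (2 * m + 1) / 6 := by
      intro m
      induction m with
      | zero => simp
      | succ m ih =>
        rw [Finset.sum_Ico_succ_top (by omega), ih]
        push_cast
        ring
    obtain ⟨m, rfl⟩ : ∃ m, n = m + 1 := ⟨n - 1, by have := hn.pos; omega⟩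
    rw [this]
    push_cast
    ring
  obtain ⟨m, hm⟩ := hn
  refine ⟨b * (n - 1) * (2 * n - 1) + 3 * n * m + ∑ j ∈ Finset.Ico 1 n, k j, ?_⟩
  rw [dedekindSum, Finset.mul_sum, Finset.sum_congr rfl hk, Finset.sum_add_distrib,
    Finset.sum_add_distrib, ← Finset.sum_div, ← Finset.mul_sum, hsq]
  simp only [Finset.sum_const, Nat.card_Ico, nsmul_eq_mul]
  have h1 : ((n - 1 : ℕ) : ℚ) = 2 * m := by
    rw [hm]; push_cast; simp
  rw [h1]
  push_cast
  have h2 : (m : ℚ) = (n - 1) / 2 := by rw [hm]; push_cast; ring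
  rw [h2]
  field_simp

theorem cyclicDilog_pow {n : ℕ} (hn : Odd n) {b : ℤ} (hb : IsCoprime b (n : ℤ)) {x : ℂ}
    (hx : ∀ j ∈ Finset.Ico 1 n, 1 - expTwoPi (b / n) ^ j * x ≠ 0) :
    cyclicDilog n b x ^ (12 * n) =
      (∏ j ∈ Finset.Ico 1 n, (1 - expTwoPi (b / n) ^ j * x) ^ j) ^ 12 := by
  obtain ⟨k, hk⟩ := exists_dedekindSum_eq hn hb
  have hn0 : (n : ℂ) ≠ 0 := by
    have := hn.pos
    exact_mod_cast this.ne'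
  have hk' : (6 * n * (dedekindSum b n : ℂ)) = k := by
    exact_mod_cast congrArg (Rat.cast : ℚ → ℂ) hk
  unfold cyclicDilog
  rw [Complex.exp_add, mul_pow, ← Complex.exp_nat_mul, mul_comm 12 n, pow_mul (Complex.exp _) n 12,
    ← Complex.exp_nat_mul _ n]
  have h1 : Complex.exp (((n * 12 : ℕ) : ℂ) * -(Complex.I * Real.pi * (dedekindSum b n : ℂ))) =
      1 := by
    rw [Complex.exp_eq_one_iff]
    refine ⟨-k, ?_⟩
    push_cast
    rw [← hk']
    ring
  rw [h1, one_mul, Finset.mul_sum, Complex.exp_sum]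
  congr 1
  refine Finset.prod_congr rfl fun j hj => ?_
  rw [show (n : ℂ) * ((j : ℂ) / n * Complex.log (1 - expTwoPi (b / n) ^ j * x)) =
    (j : ℕ) * Complex.log (1 - expTwoPi (b / n) ^ j * x) by field_simp, Complex.exp_nat_mul,
    Complex.exp_log (hx j hj)]

@[to_additive]
theorem prod_zmod_eq_prod_range {M : Type*} [CommMonoid M] {n : ℕ} [NeZero n] (g : ZMod n → M) :
    ∏ i, g i = ∏ i ∈ Finset.range n, g (i : ZMod n) := by
  refine Finset.prod_bij' (fun i _ => i.val) (fun i _ => (i : ZMod n)) ?_ ?_ ?_ ?_ ?_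
  · intro i _
    exact Finset.mem_range.2 (ZMod.val_lt i)
  · intro i _
    exact Finset.mem_univ _
  · intro i _
    exact ZMod.natCast_zmod_val i
  · intro i hi
    exact ZMod.val_cast_of_lt (Finset.mem_range.1 hi)
  · intro i _
    rw [ZMod.natCast_zmod_val]

/-! ### The trace of a product of matrices -/

/-- The trace of a product of matrices as a sum over closed paths, with the last matrix kept
separate. -/
theorem trace_list_prod_mul {κ R : Type*} [Fintype κ] [DecidableEq κ] [CommRing R]
    (M : ℕ → Matrix κ κ R) (m : ℕ) (Q : Matrix κ κ R) :
    (((List.range m).map M).prod * Q).trace =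
      ∑ k : Fin (m + 1) → κ,
        (∏ i : Fin m, M i (k i.castSucc) (k i.succ)) * Q (k (Fin.last m)) (k 0) := by
  induction m generalizing Q with
  | zero =>
    simp only [List.range_zero, List.map_nil, List.prod_nil, one_mul, Finset.univ_eq_empty,
      Finset.prod_empty, Matrix.trace, Matrix.diag]
    refine (Fintype.sum_equiv (Equiv.funUnique (Fin 1) κ) _ _ fun k => ?_).symm
    rfl
  | succ m ih =>
    rw [List.range_succ, List.map_append, List.prod_append, List.map_singleton, List.prod_singleton,
      mul_assoc, ih]
    rw [← Fintype.sum_equiv (Fin.snocEquiv fun _ : Fin (m + 2) => κ) _ _ fun _ => rfl,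
      Fintype.sum_prod_type_right]
    refine Finset.sum_congr rfl fun k _ => ?_
    rw [Matrix.mul_apply, Finset.mul_sum]
    refine Finset.sum_congr rfl fun b _ => ?_
    rw [Fin.prod_univ_castSucc]
    simp only [Fin.snocEquiv, Equiv.coe_fn_mk, Fin.snoc_castSucc, Fin.succ_last, Fin.snoc_last,
      Fin.succ_castSucc, Fin.val_castSucc, Fin.val_last]
    rw [show (Fin.snoc k b : Fin (m + 2) → κ) 0 = k 0 from
      Fin.snoc_castSucc (α := fun _ => κ) b k 0, mul_assoc]

theorem trace_cyclic_prod {κ R : Type*} [Fintype κ] [DecidableEq κ] [CommRing R] {N : ℕ} [NeZero N]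
    (M : ZMod N → Matrix κ κ R) :
    ((List.range N).map fun i => M ((i + 1 : ℕ) : ZMod N)).prod.trace =
      ∑ k : ZMod N → κ, ∏ j, M j (k (j - 1)) (k j) := by
  obtain ⟨m, rfl⟩ : ∃ m, N = m + 1 := ⟨N - 1, by have := NeZero.pos N; omega⟩
  rw [List.range_succ, List.map_append, List.prod_append, List.map_singleton, List.prod_singleton,
    trace_list_prod_mul (fun i => M ((i + 1 : ℕ) : ZMod (m + 1)))]
  refine Finset.sum_congr rfl fun (k : ZMod (m + 1) → κ) _ => ?_
  have h1 : ∀ j : ZMod (m + 1), ((ZMod.val j + 1 : ℕ) : ZMod (m + 1)) = j + 1 := fun j => by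
    rw [Nat.cast_add, ZMod.natCast_zmod_val, Nat.cast_one]
  have h2 : ∏ j : ZMod (m + 1), M j (k (j - 1)) (k j) =
      ∏ j : ZMod (m + 1), M ((ZMod.val j + 1 : ℕ) : ZMod (m + 1)) (k j) (k (j + 1)) := by
    rw [← Equiv.prod_comp (Equiv.addRight (1 : ZMod (m + 1)))]
    refine Finset.prod_congr rfl fun j _ => ?_
    rw [h1, Equiv.coe_addRight, add_sub_cancel_right]
  refine Eq.trans ?_ h2.symm
  refine Eq.trans ?_ (Fin.prod_univ_castSucc (n := m) fun j : Fin (m + 1) =>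
    M ((ZMod.val (n := m + 1) j + 1 : ℕ) : ZMod (m + 1)) (k j)
      (k (show ZMod (m + 1) from (j + 1 : Fin (m + 1))))).symm
  congr 1
  · refine Finset.prod_congr rfl fun i _ => ?_
    rw [Fin.coeSucc_eq_succ]
    rfl
  · rw [Fin.last_add_one]
    rfl

/-! ### The Fourier matrices -/

section Fourier

variable {n : ℕ} [NeZero n] {q : ℂ}

theorem zmodChar_intCast (hq : q ^ n = 1) (k : ℤ) :
    AddChar.zmodChar n hq (k : ZMod n) = q ^ k := by
  have hq0 : q ≠ 0 := by
    rintro rfl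
    rw [zero_pow (NeZero.ne n)] at hq
    exact zero_ne_one hq
  obtain ⟨m, rfl | rfl⟩ := k.eq_nat_or_neg
  · rw [Int.cast_natCast, AddChar.zmodChar_apply', zpow_natCast]
  · rw [Int.cast_neg, Int.cast_natCast, AddChar.map_neg_eq_inv, AddChar.zmodChar_apply', zpow_neg,
      zpow_natCast]

theorem addChar_sum {A κ : Type*} [AddCommMonoid A] (χ : AddChar A ℂ) (s : Finset κ) (g : κ → A) :
    χ (∑ i ∈ s, g i) = ∏ i ∈ s, χ (g i) := by
  classical
  induction s using Finset.induction_on with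
  | empty => simp
  | insert i s hi ih => rw [Finset.sum_insert hi, Finset.prod_insert hi, AddChar.map_add_eq_mul, ih]

theorem two_mul_halfMod (hn : Odd n) : (2 : ZMod n) * (halfMod n : ZMod n) = 1 := by
  obtain ⟨m, rfl⟩ := hn
  have h : 2 * halfMod (2 * m + 1) = ((2 * m + 1 : ℕ) : ℤ) + 1 := by
    unfold halfMod
    push_cast
    omega
  have := congrArg (Int.cast : ℤ → ZMod (2 * m + 1)) h
  push_cast at this
  rw [this]
  have h0 : ((2 * m + 1 : ℕ) : ZMod (2 * m + 1)) = 0 := ZMod.natCast_self _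
  push_cast at h0
  rw [h0, zero_add]

theorem fourierMatrix_apply (hq : q ^ n = 1) (X : Letter) (i j : ZMod n) :
    fourierMatrix n q X i j = AddChar.zmodChar n hq
      (if X = .L then i * j else halfMod n * (i - j) ^ 2) / (Real.sqrt n : ℂ) := by
  cases X
  · simp [fourierMatrix, AddChar.zmodChar_apply]
  · have h : ((halfMod n * (((i - j) ^ 2).val : ℤ) : ℤ) : ZMod n) = halfMod n * (i - j) ^ 2 := by
      push_cast
      rw [ZMod.natCast_zmod_val]
    simp only [fourierMatrix, Matrix.of_apply, reduceCtorEq, if_false, ← h, zmodChar_intCast]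

theorem fourierMatrix_L_sq (hq : IsPrimitiveRoot q n) :
    fourierMatrix n q .L * fourierMatrix n q .L = (Equiv.neg (ZMod n)).permMatrix ℂ := by
  have hn0 : (n : ℂ) ≠ 0 := Nat.cast_ne_zero.2 (NeZero.ne n)
  have hs : (Real.sqrt n : ℂ) * Real.sqrt n = n := by
    rw [← Complex.ofReal_mul, Real.mul_self_sqrt (Nat.cast_nonneg n), Complex.ofReal_natCast]
  have hp := AddChar.zmodChar_primitive_of_primitive_root n hq
  ext i j
  simp only [Matrix.mul_apply, fourierMatrix_apply hq.pow_eq_one, if_true]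
  have h1 : ∀ k, AddChar.zmodChar n hq.pow_eq_one (i * k) / (Real.sqrt n : ℂ) *
      (AddChar.zmodChar n hq.pow_eq_one (k * j) / (Real.sqrt n : ℂ)) =
      AddChar.zmodChar n hq.pow_eq_one (k * (i + j)) / n := by
    intro k
    rw [div_mul_div_comm, hs, ← AddChar.map_add_eq_mul]
    congr 2
    ring
  simp only [h1]
  rw [← Finset.sum_div, AddChar.sum_mulShift _ hp, ZMod.card, Equiv.Perm.permMatrix,
    PEquiv.toMatrix_apply]
  simp only [Equiv.toPEquiv_apply, Option.mem_some_iff, Equiv.neg_apply]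
  by_cases h : i + j = 0
  · rw [if_pos h, if_pos (neg_eq_of_add_eq_zero_right h), div_self hn0]
  · rw [if_neg h, if_neg fun h' => h (by rw [← h']; ring), Nat.cast_zero, zero_div]

theorem det_fourierMatrix_L_pow (hq : IsPrimitiveRoot q n) :
    (fourierMatrix n q .L).det ^ 4 = 1 := by
  have h := congrArg Matrix.det (fourierMatrix_L_sq hq)
  rw [Matrix.det_mul, Matrix.det_permutation] at h
  have h2 : ((Equiv.Perm.sign (Equiv.neg (ZMod n)) : ℤˣ) : ℂ) ^ 2 = 1 := by
    rcases Int.units_eq_one_or (Equiv.Perm.sign (Equiv.neg (ZMod n))) with h | h <;> rw [h] <;> simp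
  rw [show (4 : ℕ) = 2 * 2 from rfl, pow_mul, sq (Matrix.det _), h]
  exact h2

/-- `F_R` is a product of diagonal matrices and of a Fourier matrix, as
`(i - j)² / 2 = i² / 2 - i j + j² / 2`. -/
theorem det_fourierMatrix_R_pow (hn : Odd n) (hq : IsPrimitiveRoot q n) :
    (fourierMatrix n q .R).det ^ 12 = 1 := by
  set χ := AddChar.zmodChar n hq.pow_eq_one with hχ
  have hfac : fourierMatrix n q .R = Matrix.diagonal (fun i => χ (halfMod n * i ^ 2)) *
      fourierMatrix n q⁻¹ .L * Matrix.diagonal (fun i => χ (halfMod n * i ^ 2)) := by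
    ext i j
    rw [Matrix.mul_diagonal, Matrix.diagonal_mul, fourierMatrix_apply hq.pow_eq_one,
      fourierMatrix_apply hq.inv.pow_eq_one]
    have h1 : AddChar.zmodChar n hq.inv.pow_eq_one (i * j) = χ (-(i * j)) := by
      rw [AddChar.map_neg_eq_inv, hχ, AddChar.zmodChar_apply, AddChar.zmodChar_apply, inv_pow]
    rw [if_neg (by decide), if_pos rfl, h1, ← hχ]
    have h2 : (halfMod n : ZMod n) * (i - j) ^ 2 =
        halfMod n * i ^ 2 + -(i * j) + halfMod n * j ^ 2 := by
      linear_combination (-(i * j)) * two_mul_halfMod hn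
    rw [h2, AddChar.map_add_eq_mul, AddChar.map_add_eq_mul]
    ring
  have hsum : (∏ i : ZMod n, χ (halfMod n * i ^ 2)) ^ 12 = 1 := by
    rw [← addChar_sum, ← AddChar.map_nsmul_eq_pow]
    have h0 : (12 : ZMod n) * ∑ i : ZMod n, halfMod n * i ^ 2 = 0 := by
      rw [← Finset.mul_sum, ← mul_assoc,
        show (12 : ZMod n) * halfMod n = 6 * (2 * halfMod n) by ring, two_mul_halfMod hn, mul_one]
      have h1 : ∑ i : ZMod n, i ^ 2 = ∑ i ∈ Finset.range n, (i : ZMod n) ^ 2 := by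
        exact sum_zmod_eq_sum_range fun i : ZMod n => i ^ 2
      have h2 : ∀ m : ℕ, (6 : ℤ) * ∑ i ∈ Finset.range m, (i : ℤ) ^ 2 =
          m * ((m - 1) * (2 * m - 1)) := by
        intro m
        induction m with
        | zero => simp
        | succ m ih =>
          rw [Finset.sum_range_succ, mul_add, ih]
          push_cast
          ring
      have h3 := congrArg (Int.cast : ℤ → ZMod n) (h2 n)
      push_cast at h3
      rw [h1, h3, ZMod.natCast_self, zero_mul]
    rw [nsmul_eq_mul]
    push_cast
    rw [h0, AddChar.map_zero_eq_one]
  rw [hfac, Matrix.det_mul, Matrix.det_mul, Matrix.det_diagonal, mul_pow, mul_pow, hsum,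
    show (12 : ℕ) = 4 * 3 from rfl, pow_mul (Matrix.det _), det_fourierMatrix_L_pow hq.inv]
  simp

theorem det_fourierMatrix_pow (hn : Odd n) (hq : IsPrimitiveRoot q n) (X : Letter) :
    (fourierMatrix n q X).det ^ 12 = 1 := by
  cases X
  · rw [show (12 : ℕ) = 4 * 3 from rfl, pow_mul, det_fourierMatrix_L_pow hq, one_pow]
  · exact det_fourierMatrix_R_pow hn hq

end Fourier

/-! ### Cyclic Pochhammer symbols -/

theorem prod_one_sub_pow_mul {n : ℕ} [NeZero n] {Q : ℂ} (hQ : IsPrimitiveRoot Q n) (y : ℂ) :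
    ∏ j ∈ Finset.range n, (1 - Q ^ j * y) = 1 - y ^ n := by
  have h := hQ.pow_sub_pow_eq_prod_sub_mul 1 y (NeZero.pos n)
  rw [one_pow] at h
  rw [h]
  symm
  refine Finset.prod_bij' (fun μ hμ => ((hQ.eq_pow_of_pow_eq_one
    ((Polynomial.mem_nthRootsFinset (NeZero.pos n) 1).1 hμ)).choose)) (fun j _ => Q ^ j)
    ?_ ?_ ?_ ?_ ?_
  · intro μ hμ
    exact Finset.mem_range.2 (hQ.eq_pow_of_pow_eq_one
      ((Polynomial.mem_nthRootsFinset (NeZero.pos n) 1).1 hμ)).choose_spec.1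
  · intro j _
    rw [Polynomial.mem_nthRootsFinset (NeZero.pos n), ← pow_mul, mul_comm, pow_mul, hQ.pow_eq_one,
      one_pow]
  · intro μ hμ
    exact (hQ.eq_pow_of_pow_eq_one
      ((Polynomial.mem_nthRootsFinset (NeZero.pos n) 1).1 hμ)).choose_spec.2
  · intro j hj
    have hμ : Q ^ j ∈ Polynomial.nthRootsFinset n (1 : ℂ) := by
      rw [Polynomial.mem_nthRootsFinset (NeZero.pos n), ← pow_mul, mul_comm, pow_mul,
        hQ.pow_eq_one, one_pow]
    have hs := (hQ.eq_pow_of_pow_eq_one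
      ((Polynomial.mem_nthRootsFinset (NeZero.pos n) 1).1 hμ)).choose_spec
    exact hQ.pow_inj hs.1 (Finset.mem_range.1 hj) hs.2
  · intro μ hμ
    have hs := (hQ.eq_pow_of_pow_eq_one
      ((Polynomial.mem_nthRootsFinset (NeZero.pos n) 1).1 hμ)).choose_spec.2
    rw [hs]

/-- Triangular products. -/
theorem prod_range_prod_range_mul (g : ℕ → ℂ) (m : ℕ) :
    (∏ l ∈ Finset.range m, ∏ j ∈ Finset.range l, g j) * ∏ j ∈ Finset.range m, g j ^ (j + 1) =
      (∏ j ∈ Finset.range m, g j) ^ m := by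
  induction m with
  | zero => simp
  | succ m ih =>
    rw [Finset.prod_range_succ, Finset.prod_range_succ (fun j => g j ^ (j + 1)),
      Finset.prod_range_succ g, mul_pow, pow_succ (∏ j ∈ Finset.range m, g j), ← ih]
    ring

/-- The Pochhammer symbol `(x; Q⁻¹)_k z ^ (- k / n)`. If `Q` is a primitive `n`-th root of unity and
`x ^ n = 1 - z`, it is periodic in `k` with period `n`. -/
def normPoch (n : ℕ) (Q z x : ℂ) (k : ℕ) : ℂ :=
  Complex.exp (-(k / n * Complex.log z)) * qPoch x Q⁻¹ k

section NormPoch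

variable {n : ℕ} [NeZero n] {Q z x : ℂ}

omit [NeZero n] in
theorem normPoch_add (k l : ℕ) : normPoch n Q z x (k + l) =
    normPoch n Q z x k * (Complex.exp (-(l / n * Complex.log z)) *
      ∏ j ∈ Finset.range l, (1 - Q⁻¹ ^ (k + j) * x)) := by
  unfold normPoch qPoch
  rw [Finset.prod_range_add]
  have : Complex.exp (-(((k + l : ℕ) : ℂ) / n * Complex.log z)) =
      Complex.exp (-(k / n * Complex.log z)) * Complex.exp (-(l / n * Complex.log z)) := by
    rw [← Complex.exp_add]
    congr 1
    push_cast
    ring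
  rw [this]
  ring

theorem normPoch_add_period (hQ : IsPrimitiveRoot Q n) (hz : z ≠ 0) (hx : x ^ n = 1 - z) (k : ℕ) :
    normPoch n Q z x (k + n) = normPoch n Q z x k := by
  have hn : (n : ℂ) ≠ 0 := Nat.cast_ne_zero.2 (NeZero.ne n)
  have h : ∏ j ∈ Finset.range n, (1 - Q⁻¹ ^ (k + j) * x) = z := by
    rw [Finset.prod_congr rfl fun j _ =>
      show 1 - Q⁻¹ ^ (k + j) * x = 1 - Q⁻¹ ^ j * (Q⁻¹ ^ k * x) by ring,
      prod_one_sub_pow_mul hQ.inv, mul_pow, ← pow_mul, mul_comm k n, pow_mul, hQ.inv.pow_eq_one,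
      one_pow, one_mul, hx, sub_sub_cancel]
  rw [normPoch_add, h, div_self hn, one_mul, Complex.exp_neg, Complex.exp_log hz,
    inv_mul_cancel₀ hz, mul_one]

theorem normPoch_congr (hQ : IsPrimitiveRoot Q n) (hz : z ≠ 0) (hx : x ^ n = 1 - z) {k l : ℕ}
    (h : (k : ZMod n) = l) : normPoch n Q z x k = normPoch n Q z x l := by
  have hp : Function.Periodic (normPoch n Q z x) n := normPoch_add_period hQ hz hx
  rw [← hp.map_mod_nat k, ← hp.map_mod_nat l, (ZMod.natCast_eq_natCast_iff' k l n).1 h]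

omit [NeZero n] in
theorem one_sub_mul_ne_zero (hz : z ≠ 0) (hx : x ^ n = 1 - z) {r : ℂ} (hr : r ^ n = 1) :
    1 - r * x ≠ 0 := by
  intro h
  have h1 : (r * x) ^ n = 1 := by rw [← sub_eq_zero.1 h, one_pow]
  rw [mul_pow, hr, one_mul, hx] at h1
  exact hz (by linear_combination -h1)

omit [NeZero n] in
theorem normPoch_ne_zero (hQ : IsPrimitiveRoot Q n) (hz : z ≠ 0) (hx : x ^ n = 1 - z) (k : ℕ) :
    normPoch n Q z x k ≠ 0 := by
  refine mul_ne_zero (Complex.exp_ne_zero _) (Finset.prod_ne_zero_iff.2 fun j _ => ?_)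
  refine one_sub_mul_ne_zero hz hx ?_
  rw [← pow_mul, mul_comm, pow_mul, hQ.inv.pow_eq_one, one_pow]

/-- Reflection: the Pochhammer symbol `(Q y; Q)_{2k}` with `y = Q ^ (-c) x`, as a quotient of two
values of the cyclic one. -/
theorem normPoch_eq_mul_qPoch (hQ : IsPrimitiveRoot Q n) (hz : z ≠ 0) (hx : x ^ n = 1 - z)
    {c k l : ℕ} (h : (l : ZMod n) = c - 2 * k) :
    normPoch n Q z x c = normPoch n Q z x l * (Complex.exp (-((2 * k : ℂ) / n * Complex.log z)) *
      qPoch (Q * (x * (Q ^ c)⁻¹)) Q (2 * k)) := by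
  have hQ0 : Q ≠ 0 := hQ.ne_zero (NeZero.ne n)
  have h1 : ((l + 2 * k : ℕ) : ZMod n) = c := by push_cast; rw [h]; ring
  have hpow : Q ^ (l + 2 * k) = Q ^ c := by
    rw [← AddChar.zmodChar_apply' hQ.pow_eq_one, ← AddChar.zmodChar_apply' hQ.pow_eq_one, h1]
  rw [← normPoch_congr hQ hz hx h1, normPoch_add, qPoch,
    ← Finset.prod_range_reflect (fun j => 1 - Q⁻¹ ^ (l + j) * x)]
  congr 2
  · push_cast; rfl
  · refine Finset.prod_congr rfl fun j hj => ?_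
    have hj' := Finset.mem_range.1 hj
    have h2 : l + 2 * k = l + (2 * k - 1 - j) + j + 1 := by omega
    rw [← hpow]
    conv_rhs => rw [h2]
    rw [inv_pow]
    field_simp
    ring

/-- The `n`-th power of the cyclic quantum dilogarithm, in terms of the cyclic Pochhammer
symbols. -/
theorem prod_pow_mul_prod_normPoch (hn : Odd n) (hQ : IsPrimitiveRoot Q n) (hz : z ≠ 0)
    (hx : x ^ n = 1 - z) (c : ℕ) :
    (∏ j ∈ Finset.Ico 1 n, (1 - Q⁻¹ ^ j * (x * (Q ^ c)⁻¹)) ^ j) *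
      ∏ l ∈ Finset.range n, normPoch n Q z x l =
      z ^ ((n - 1) / 2) * normPoch n Q z x c ^ n := by
  have hn0 : (n : ℂ) ≠ 0 := Nat.cast_ne_zero.2 (NeZero.ne n)
  set y := x * (Q ^ c)⁻¹ with hy
  have hyn : y ^ n = 1 - z := by
    rw [hy, mul_pow, hx, inv_pow, ← pow_mul, mul_comm c, pow_mul, hQ.pow_eq_one, one_pow, inv_one,
      mul_one]
  set g : ℕ → ℂ := fun j => 1 - Q⁻¹ ^ j * y with hg
  have hG : ∏ j ∈ Finset.range n, g j = z := by
    rw [hg, prod_one_sub_pow_mul hQ.inv, hyn, sub_sub_cancel]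
  have hIco : ∏ j ∈ Finset.Ico 1 n, g j ^ j = ∏ j ∈ Finset.range n, g j ^ j := by
    rw [Finset.range_eq_Ico, Finset.prod_eq_prod_Ico_succ_bot (NeZero.pos n)]
    simp
  have htri := prod_range_prod_range_mul g n
  simp only [pow_succ, Finset.prod_mul_distrib, hG] at htri
  have hpred : z ^ n = z ^ (n - 1) * z := by
    rw [← pow_succ]
    congr 1
    have := NeZero.pos n
    omega
  rw [hpred, ← mul_assoc] at htri
  have htri' := mul_right_cancel₀ hz htri
  have hshift : ∏ l ∈ Finset.range n, normPoch n Q z x l = normPoch n Q z x c ^ n *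
      ((z ^ ((n - 1) / 2))⁻¹ * ∏ l ∈ Finset.range n, ∏ j ∈ Finset.range l, g j) := by
    have h1 : ∏ l ∈ Finset.range n, normPoch n Q z x l =
        ∏ l ∈ Finset.range n, normPoch n Q z x (c + l) := by
      have h2 := prod_zmod_eq_prod_range (n := n) fun i => normPoch n Q z x i.val
      have h3 := prod_zmod_eq_prod_range (n := n) fun i => normPoch n Q z x ((c : ZMod n) + i).val
      have h4 := Equiv.prod_comp (Equiv.addLeft (c : ZMod n)) fun i => normPoch n Q z x i.val
      simp only [Equiv.coe_addLeft] at h4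
      rw [h2, h3] at h4
      have h5 : ∀ l : ℕ, normPoch n Q z x (l : ZMod n).val = normPoch n Q z x l := fun l =>
        normPoch_congr hQ hz hx (ZMod.natCast_zmod_val _)
      simp only [h5, ← Nat.cast_add] at h4
      exact h4.symm
    rw [h1]
    simp only [normPoch_add, Finset.prod_mul_distrib, Finset.prod_const, Finset.card_range]
    congr 2
    · rw [← Complex.exp_sum, Finset.sum_neg_distrib, ← Finset.sum_mul, ← Finset.sum_div,
        Complex.exp_neg]
      congr 1
      have h6 : (∑ i ∈ Finset.range n, (i : ℂ)) / n = ((n - 1) / 2 : ℕ) := by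
        obtain ⟨m, rfl⟩ := hn
        rw [← Nat.cast_sum, Finset.sum_range_id,
          show (2 * m + 1) * (2 * m + 1 - 1) / 2 = (2 * m + 1) * m by
            rw [Nat.add_sub_cancel, mul_left_comm, Nat.mul_div_cancel_left _ two_pos],
          show (2 * m + 1 - 1) / 2 = m by omega, Nat.cast_mul, mul_div_cancel_left₀ _ hn0]
      rw [h6, Complex.exp_nat_mul, Complex.exp_log hz]
    · refine Finset.prod_congr rfl fun l _ => Finset.prod_congr rfl fun j _ => ?_
      rw [hg, hy, pow_add, inv_pow Q c]
      ring
  have hsq : z ^ (n - 1) = z ^ ((n - 1) / 2) * z ^ ((n - 1) / 2) := by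
    rw [← pow_add]
    congr 1
    obtain ⟨m, rfl⟩ := hn
    omega
  have hzp : z ^ ((n - 1) / 2) ≠ 0 := pow_ne_zero _ hz
  rw [hIco, hshift]
  rw [hsq] at htri'
  have hfin : ∀ G P Z T : ℂ, Z ≠ 0 → T * G = Z * Z → G * (P * (Z⁻¹ * T)) = Z * P := by
    intro G P Z T hZ h
    rw [show G * (P * (Z⁻¹ * T)) = P * Z⁻¹ * (T * G) by ring, h]
    field_simp
  exact hfin _ _ _ _ hzp htri'

end NormPoch

/-! ### The state sum of the 1-loop invariant as a trace -/

/-- The `n`-th root of unity `exp((1 - n²) π i / (2 n))`. -/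
def diagRoot (n : ℕ) : ℂ := Complex.exp ((1 - (n : ℂ) ^ 2) / (2 * n) * Real.pi * Complex.I)

theorem diagRoot_ne_zero (n : ℕ) : diagRoot n ≠ 0 := Complex.exp_ne_zero _

theorem diagRoot_pow {n : ℕ} (hn : Odd n) : diagRoot n ^ n = 1 := by
  have hn0 : (n : ℂ) ≠ 0 := Nat.cast_ne_zero.2 hn.pos.ne'
  rw [diagRoot, ← Complex.exp_nat_mul, Complex.exp_eq_one_iff]
  obtain ⟨m, rfl⟩ := hn
  refine ⟨-(m * (m + 1)), ?_⟩
  field_simp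
  push_cast
  ring

theorem diagRoot_zpow {n : ℕ} (hn : Odd n) (j : ℤ) :
    diagRoot n ^ (-2 * j) = Complex.exp (-(Real.pi * Complex.I / n * j)) * (-1) ^ j := by
  have hn0 : (n : ℂ) ≠ 0 := Nat.cast_ne_zero.2 hn.pos.ne'
  have h1 : ((-1 : ℂ)) ^ j = Complex.exp (j * (n * (Real.pi * Complex.I))) := by
    rw [Complex.exp_int_mul, Complex.exp_nat_mul, Complex.exp_pi_mul_I, hn.neg_one_pow]
  rw [h1, diagRoot, ← Complex.exp_int_mul, ← Complex.exp_add]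
  congr 1
  push_cast
  field_simp
  ring

theorem prod_zpow_eq_zpow_sum {κ : Type*} {x : ℂ} (hx : x ≠ 0) (s : Finset κ) (g : κ → ℤ) :
    ∏ i ∈ s, x ^ g i = x ^ ∑ i ∈ s, g i := by
  classical
  induction s using Finset.induction_on with
  | empty => simp
  | insert i s hi ih => rw [Finset.prod_insert hi, Finset.sum_insert hi, zpow_add₀ hx, ih]

namespace LRWord

variable {N : ℕ} [NeZero N] (w : LRWord N)

theorem prod_list_range {M : Type*} [CommMonoid M] (g : ZMod N → M) :
    ((List.range N).map fun i => g ((i + 1 : ℕ) : ZMod N)).prod = ∏ j, g j := by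
  have h : ∀ (m : ℕ) (h : ℕ → M), ((List.range m).map h).prod = ∏ i ∈ Finset.range m, h i := by
    intro m h
    induction m with
    | zero => simp
    | succ m ih => rw [List.range_succ, List.map_append, List.prod_append, ih,
        Finset.prod_range_succ, List.map_singleton, List.prod_singleton]
  rw [h, ← Equiv.prod_comp (Equiv.addRight (1 : ZMod N)) g,
    prod_zmod_eq_prod_range fun i => g (Equiv.addRight 1 i)]
  simp

section

variable (z : ZMod N → ℂ) (m : ℤ) (n : ℕ) [NeZero n] (q : ℂ)

/-- The part of `d_i` that is a root of unity. -/
def dRoot (i : ZMod N) : ℂ :=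
  q ^ (m * w.beta i - halfMod n * w.eta i) * diagRoot n ^ w.eta i

/-- The entries of the diagonal matrices `D_i`, without roots of unity. -/
def weight (i : ZMod N) (k : ℕ) : ℂ := normPoch n (q ^ 2) (z i) (bwyTheta z n i)⁻¹ k

variable {n q}

omit [NeZero N] [NeZero n] in
theorem dRoot_pow (hn : Odd n) (hq : q ^ n = 1) (i : ZMod N) : w.dRoot m n q i ^ n = 1 := by
  have h1 : ∀ (x : ℂ) (k : ℤ), x ^ n = 1 → (x ^ k) ^ n = 1 := fun x k hx => by
    rw [← zpow_natCast, ← zpow_mul, mul_comm, zpow_mul, zpow_natCast, hx, one_zpow]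
  rw [dRoot, mul_pow, h1 _ _ hq, h1 _ _ (diagRoot_pow hn), one_mul]

omit [NeZero N] in
theorem bwyFactor_apply (hn : Odd n) (hq : IsPrimitiveRoot q n) (i : ZMod N) (k l : ZMod n) :
    w.bwyFactor z w.eta m n q i k l = AddChar.zmodChar n hq.pow_eq_one
      (if w.letter i = .L then k * l else halfMod n * (k - l) ^ 2) / (Real.sqrt n : ℂ) *
      (AddChar.zmodChar n (w.dRoot_pow m hn hq.pow_eq_one i) l * weight z n q i l.val) := by
  have hq0 : q ≠ 0 := hq.ne_zero (NeZero.ne n)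
  have hd : w.bwyD z w.eta m n q i = w.dRoot m n q i *
      Complex.exp (-(1 / n * Complex.log (z i))) := by
    rw [bwyD, dRoot, diagRoot, sub_eq_add_neg (_ * (w.eta i : ℂ)), Complex.exp_add,
      mul_comm _ (w.eta i : ℂ), Complex.exp_int_mul, ← mul_assoc]
  have hχ : AddChar.zmodChar n (w.dRoot_pow m hn hq.pow_eq_one i) l = w.dRoot m n q i ^ l.val :=
    AddChar.zmodChar_apply _ l
  have hx : -q⁻¹ * (bwyA z n q i)⁻¹ = (bwyTheta z n i)⁻¹ := by
    rw [bwyA, mul_inv, inv_neg, inv_inv]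
    field_simp
  rw [bwyFactor, Matrix.mul_diagonal, fourierMatrix_apply hq.pow_eq_one, hd, hx, mul_pow,
    hχ, weight, normPoch, ← Complex.exp_nat_mul]
  have : ((l.val : ℕ) : ℂ) * -(1 / n * Complex.log (z i)) = -(l.val / n * Complex.log (z i)) := by
    ring
  rw [this]
  ring

theorem trace_bwyMatrix (hn : Odd n) (hq : IsPrimitiveRoot q n) :
    (w.bwyMatrix z w.eta m n q).trace = ((Real.sqrt n : ℂ) ^ N)⁻¹ * ∑ l : ZMod N → ZMod n,
      AddChar.zmodChar n hq.pow_eq_one (halfMod n * w.hessForm l l) *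
      ∏ i, (AddChar.zmodChar n (w.dRoot_pow m hn hq.pow_eq_one i) (l i) *
        weight z n q i (l i).val) := by
  rw [bwyMatrix, trace_cyclic_prod, Finset.mul_sum]
  refine Finset.sum_congr rfl fun l _ => ?_
  simp only [w.bwyFactor_apply z m hn hq]
  rw [Finset.prod_mul_distrib, Finset.prod_div_distrib, ← addChar_sum, Finset.prod_const,
    Finset.card_univ, ZMod.card, hessForm, Finset.mul_sum]
  have : ∑ i, (if w.letter i = .L then l (i - 1) * l i else
      (halfMod n : ZMod n) * (l (i - 1) - l i) ^ 2) =
      ∑ i, (halfMod n : ZMod n) * (if w.letter i = .L then l i * l (i - 1) + l (i - 1) * l i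
        else (l i - l (i - 1)) * (l i - l (i - 1))) := by
    refine Finset.sum_congr rfl fun i _ => ?_
    split_ifs
    · linear_combination (-(l (i - 1) * l i)) * two_mul_halfMod hn
    · ring
  rw [this]
  ring

theorem det_bwyMatrix_pow (hn : Odd n) (hq : IsPrimitiveRoot q n) :
    (w.bwyMatrix z w.eta m n q).det ^ 12 =
      ∏ i, (∏ l ∈ Finset.range n, weight z n q i l) ^ 12 := by
  have h1 : (w.bwyMatrix z w.eta m n q).det = ∏ i, (w.bwyFactor z w.eta m n q i).det := by
    rw [bwyMatrix, ← prod_list_range (fun i => (w.bwyFactor z w.eta m n q i).det),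
      ← Matrix.coe_detMonoidHom, map_list_prod, List.map_map]
    rfl
  rw [h1, ← Finset.prod_pow]
  refine Finset.prod_congr rfl fun i _ => ?_
  have h2 : w.bwyFactor z w.eta m n q i = fourierMatrix n q (w.letter i) *
      Matrix.diagonal (fun l => AddChar.zmodChar n (w.dRoot_pow m hn hq.pow_eq_one i) l *
        weight z n q i l.val) := by
    ext k l
    rw [w.bwyFactor_apply z m hn hq, Matrix.mul_diagonal, fourierMatrix_apply hq.pow_eq_one]
  have h3 : ∑ l : ZMod n, l = 0 := by
    rw [sum_zmod_eq_sum_range, ← Nat.cast_sum, Finset.sum_range_id,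
      ZMod.natCast_eq_zero_iff]
    obtain ⟨t, rfl⟩ := hn
    exact ⟨t, by rw [Nat.add_sub_cancel, mul_left_comm, Nat.mul_div_cancel_left _ two_pos]⟩
  rw [h2, Matrix.det_mul, mul_pow, det_fourierMatrix_pow hn hq, one_mul, Matrix.det_diagonal,
    Finset.prod_mul_distrib, ← addChar_sum, h3, AddChar.map_zero_eq_one, one_mul,
    prod_zmod_eq_prod_range]
  congr 1
  refine Finset.prod_congr rfl fun l hl => ?_
  rw [ZMod.val_cast_of_lt (Finset.mem_range.1 hl)]

end

section

variable (ε : ℤˣ) (p : ZMod N) (z : ZMod N → ℂ) (f f' : ZMod N → ℤ) (m : ℤ) {n : ℕ} [NeZero n]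
  {q : ℂ} (hz : (w.layered ε).IsGeometricSolution (w.longitude ε) z)

omit [NeZero N] in
theorem bwyTheta_pow (i : ZMod N) (hz : 0 < (z i).im) :
    bwyTheta z n i ^ n = ShapeLabel.z'.val (z i) := by
  have hn0 : (n : ℂ) ≠ 0 := Nat.cast_ne_zero.2 (NeZero.ne n)
  rw [bwyTheta, ← Complex.exp_nat_mul, ← mul_assoc, mul_one_div_cancel hn0, one_mul,
    Complex.exp_log (ShapeLabel.val_z'_ne_zero hz)]

omit [NeZero N] in
theorem bwyTheta_inv_pow (i : ZMod N) (hz : 0 < (z i).im) :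
    (bwyTheta z n i)⁻¹ ^ n = 1 - z i := by
  rw [inv_pow, bwyTheta_pow z i hz, ShapeLabel.inv_val_z']

omit [NeZero n] in
theorem summand_eq {a : ℤ} (θ : ZMod N → ℂ) (k : ZMod N → ZMod n) :
    (w.nzDatum ε p z f f').summand 2 (w.halfB p) θ m n a k =
      (-1) ^ (∑ i, ((k i).val : ℤ) * w.eta i) *
      expTwoPi (a / n) ^ (halfMod n * (2 * w.hessForm (fun i => ((k i).val : ℤ))
        (fun i => ((k i).val : ℤ)) + ∑ i, ((k i).val : ℤ) * (w.eta i - 2 * m * w.beta i))) *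
      ∏ i, θ i ^ (-(w.hess (fun i => ((k i).val : ℤ)) i)) /
        qPoch (expTwoPi (a / n) * (θ i)⁻¹) (expTwoPi (a / n)) (2 * (k i).val) := by
  have h1 := w.halfB_inv_mulVec p (w.halfB_mulVec_eta ε p z f f')
  have h2 : ∀ x : ZMod N → ℤ, ((w.halfB p)⁻¹ * (w.nzDatum ε p z f f').A) *ᵥ x = w.hess x := by
    intro x
    rw [← Matrix.mulVec_mulVec, ← w.halfB_mulVec_hess_int ε p z f f']
    exact w.halfB_inv_mulVec p rfl
  have h3 := w.halfB_inv_mulVec p (w.halfB_mulVec_beta p)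
  unfold NZDatum.summand
  simp only [h1, h2, Matrix.mulVec_sub, Matrix.mulVec_smul,
    show (w.nzDatum ε p z f f').cusp = p from rfl, h3]
  rw [← w.sum_mul_hess]
  rfl

omit [NeZero n] in
include hz in
/-- The product of the powers of the roots `θ_i` and of the powers of the shapes `z_i` is a root
of unity by the gluing equations. -/
theorem prod_bwyTheta_zpow (K : ZMod N → ℤ) :
    (∏ i, bwyTheta z n i ^ (-(w.hess K i))) *
      ∏ i, Complex.exp (-((2 * K i : ℂ) / n * Complex.log (z i))) =
      Complex.exp (-(Real.pi * Complex.I / n * (∑ i, K i * w.eta i : ℤ))) := by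
  have h1 : ∀ i, bwyTheta z n i ^ (-(w.hess K i)) = Complex.exp (-(1 / n *
      ((w.hess (fun j => (K j : ℂ)) i) * Complex.log (ShapeLabel.z'.val (z i))))) := by
    intro i
    rw [bwyTheta, ← Complex.exp_int_mul, ← hess_intCast]
    congr 1
    push_cast
    ring
  simp only [h1]
  rw [← Complex.exp_sum, ← Complex.exp_sum, ← Complex.exp_add]
  congr 1
  have h2 := w.sum_mul_hess (fun j => Complex.log (ShapeLabel.z'.val (z j))) (fun j => (K j : ℂ))
  rw [hessForm_comm, ← w.sum_mul_hess] at h2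
  have h3 : ∀ i, w.hess (fun j => Complex.log (ShapeLabel.z'.val (z j))) i =
      Real.pi * Complex.I * (w.eta i : ℂ) - 2 * Complex.log (z i) := fun i => by
    rw [← w.hess_log_add ε z hz i]; ring
  simp only [h3] at h2
  rw [Finset.sum_neg_distrib, ← Finset.mul_sum]
  simp only [mul_comm (w.hess (fun j => (K j : ℂ)) _), h2]
  push_cast
  rw [Finset.mul_sum, Finset.mul_sum, ← Finset.sum_neg_distrib, ← Finset.sum_neg_distrib,
    ← Finset.sum_add_distrib]
  refine Finset.sum_congr rfl fun i _ => ?_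
  ring

include hz in
/-- The summand of the 1-loop state sum at `k` is, up to a constant, the summand of the trace at
`c - 2 k`, where `θ_i = θ_i⁰ q ^ (2 c_i)` for the standard choice `θ_i⁰` of the roots. -/
theorem summand_mul_prod_weight (hn : Odd n) (hq : IsPrimitiveRoot q n) {a : ℤ}
    (ha : expTwoPi (a / n) = q ^ 2) {θ : ZMod N → ℂ} {c : ZMod N → ℕ}
    (hθ : ∀ i, θ i = bwyTheta z n i * (q ^ 2) ^ c i) (k : ZMod N → ZMod n) :
    (w.nzDatum ε p z f f').summand 2 (w.halfB p) θ m n a k * ∏ i, weight z n q i (c i) =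
      (AddChar.zmodChar n hq.pow_eq_one (-(halfMod n * w.hessForm (fun i => (c i : ZMod n))
          (fun i => (c i : ZMod n)))) *
        ∏ i, AddChar.zmodChar n (w.dRoot_pow m hn hq.pow_eq_one i) (-(c i : ZMod n))) *
      (AddChar.zmodChar n hq.pow_eq_one (halfMod n * w.hessForm (fun i => (c i : ZMod n) - 2 * k i)
          (fun i => (c i : ZMod n) - 2 * k i)) *
        ∏ i, (AddChar.zmodChar n (w.dRoot_pow m hn hq.pow_eq_one i) ((c i : ZMod n) - 2 * k i) *
          weight z n q i ((c i : ZMod n) - 2 * k i).val)) := by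
  have hq0 : q ≠ 0 := hq.ne_zero (NeZero.ne n)
  have hQ : IsPrimitiveRoot (q ^ 2) n := hq.pow_of_coprime 2 (Nat.coprime_two_left.2 hn)
  have hz0 : ∀ j, z j ≠ 0 := fun j h => by have := hz.im_pos j; rw [h] at this; simp at this
  set K : ZMod N → ℤ := fun i => ((k i).val : ℤ) with hK
  have hKk : ∀ i, ((K i : ℤ) : ZMod n) = k i := fun i => by simp [hK]
  set χ := AddChar.zmodChar n hq.pow_eq_one with hχ
  set J : ℤ := ∑ i, K i * w.eta i with hJ
  -- the Pochhammer symbols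
  have hpoch : (∏ i, θ i ^ (-(w.hess K i)) / qPoch (q ^ 2 * (θ i)⁻¹) (q ^ 2) (2 * (k i).val)) *
      ∏ i, weight z n q i (c i) =
      Complex.exp (-(Real.pi * Complex.I / n * J)) *
        (∏ i, ((q ^ 2) ^ c i) ^ (-(w.hess K i))) *
        ∏ i, weight z n q i ((c i : ZMod n) - 2 * k i).val := by
    rw [hJ, ← w.prod_bwyTheta_zpow ε z hz K, ← Finset.prod_mul_distrib, ← Finset.prod_mul_distrib,
      ← Finset.prod_mul_distrib, ← Finset.prod_mul_distrib]
    refine Finset.prod_congr rfl fun i _ => ?_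
    have h1 := normPoch_eq_mul_qPoch hQ (hz0 i) (bwyTheta_inv_pow z (n := n) i (hz.im_pos i))
      (c := c i) (k := (k i).val) (l := ((c i : ZMod n) - 2 * k i).val) (by simp)
    have h2 : (θ i)⁻¹ = (bwyTheta z n i)⁻¹ * ((q ^ 2) ^ c i)⁻¹ := by rw [hθ i, mul_inv]
    have h3 := normPoch_ne_zero hQ (hz0 i) (bwyTheta_inv_pow z (n := n) i (hz.im_pos i)) (c i)
    rw [← h2] at h1
    have h4 : qPoch (q ^ 2 * (θ i)⁻¹) (q ^ 2) (2 * (k i).val) ≠ 0 := fun h => by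
      rw [h1, h] at h3; simp at h3
    rw [show weight z n q i (c i) = normPoch n (q ^ 2) (z i) (bwyTheta z n i)⁻¹ (c i) from rfl, h1,
      hθ i, mul_zpow, ← hθ i, weight]
    have h5 : ∀ T S P M E : ℂ, P ≠ 0 → T * S / P * (M * (E * P)) = T * E * S * M := by
      intro T S P M E hP
      field_simp
    simp only [hK, Int.cast_natCast]
    exact h5 _ _ _ _ _ h4
  -- the roots of unity
  have hphase : (-1 : ℂ) ^ J * (q ^ 2) ^ (halfMod n * (2 * w.hessForm K K +
        ∑ i, K i * (w.eta i - 2 * m * w.beta i))) *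
      (Complex.exp (-(Real.pi * Complex.I / n * J)) *
        (∏ i, ((q ^ 2) ^ c i) ^ (-(w.hess K i)))) =
      (χ (-(halfMod n * w.hessForm (fun i => (c i : ZMod n)) (fun i => (c i : ZMod n)))) *
        ∏ i, AddChar.zmodChar n (w.dRoot_pow m hn hq.pow_eq_one i) (-(c i : ZMod n))) *
      (χ (halfMod n * w.hessForm (fun i => (c i : ZMod n) - 2 * k i)
          (fun i => (c i : ZMod n) - 2 * k i)) *
        ∏ i, AddChar.zmodChar n (w.dRoot_pow m hn hq.pow_eq_one i) ((c i : ZMod n) - 2 * k i)) := by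
    have h1 : (∏ i, AddChar.zmodChar n (w.dRoot_pow m hn hq.pow_eq_one i) (-(c i : ZMod n))) *
        ∏ i, AddChar.zmodChar n (w.dRoot_pow m hn hq.pow_eq_one i) ((c i : ZMod n) - 2 * k i) =
        χ (∑ i, ((m * w.beta i - halfMod n * w.eta i) * (-2 * K i) : ℤ)) *
          diagRoot n ^ (-2 * J) := by
      have h2 : ∀ i, AddChar.zmodChar n (w.dRoot_pow m hn hq.pow_eq_one i) (-(c i : ZMod n)) *
          AddChar.zmodChar n (w.dRoot_pow m hn hq.pow_eq_one i) ((c i : ZMod n) - 2 * k i) =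
          χ (((m * w.beta i - halfMod n * w.eta i) * (-2 * K i) : ℤ)) *
            diagRoot n ^ (-2 * (K i * w.eta i)) := by
        intro i
        have h3 : -(c i : ZMod n) + ((c i : ZMod n) - 2 * k i) = ((-2 * K i : ℤ) : ZMod n) := by
          push_cast; rw [hKk]; ring
        rw [← AddChar.map_add_eq_mul, h3, zmodChar_intCast, dRoot, mul_zpow, ← zpow_mul,
          ← zpow_mul, hχ, zmodChar_intCast]
        congr 2
        ring
      rw [← Finset.prod_mul_distrib, Finset.prod_congr rfl fun i _ => h2 i,
        Finset.prod_mul_distrib, ← addChar_sum]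
      congr 1
      rw [hJ, Finset.mul_sum]
      exact prod_zpow_eq_zpow_sum (diagRoot_ne_zero n) _ _
    have h4 : (∏ i, ((q ^ 2) ^ c i) ^ (-(w.hess K i))) =
        χ (∑ i, ((2 * (c i : ℤ) * -(w.hess K i) : ℤ) : ZMod n)) := by
      rw [addChar_sum]
      refine Finset.prod_congr rfl fun i _ => ?_
      rw [hχ, zmodChar_intCast, zpow_mul, zpow_mul]
      norm_cast
    have h5 : ∀ X : ℤ, (q ^ 2) ^ X = χ ((2 * X : ℤ) : ZMod n) := fun X => by
      rw [hχ, zmodChar_intCast, zpow_mul]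
      norm_cast
    rw [mul_mul_mul_comm (χ _) _ (χ _) _, h1, h4, h5, diagRoot_zpow hn]
    have h6 : ((2 * (halfMod n * (2 * w.hessForm K K +
        ∑ i, K i * (w.eta i - 2 * m * w.beta i))) : ℤ) : ZMod n) +
        ∑ i, ((2 * (c i : ℤ) * -(w.hess K i) : ℤ) : ZMod n) =
        -(halfMod n * w.hessForm (fun i => (c i : ZMod n)) (fun i => (c i : ZMod n))) +
        halfMod n * w.hessForm (fun i => (c i : ZMod n) - 2 * k i)
          (fun i => (c i : ZMod n) - 2 * k i) +
        ∑ i, (((m * w.beta i - halfMod n * w.eta i) * (-2 * K i) : ℤ) : ZMod n) := by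
      have e1 : ∀ y : ZMod N → ZMod n, ∑ i, y i * ((w.hess K i : ℤ) : ZMod n) =
          w.hessForm y k := by
        intro y
        rw [← w.sum_mul_hess]
        refine Finset.sum_congr rfl fun i _ => ?_
        rw [hess_intCast]
        simp only [hKk]
      have e2 : ((w.hessForm K K : ℤ) : ZMod n) = w.hessForm k k := by
        rw [← w.sum_mul_hess, ← e1]
        push_cast
        simp only [hKk]
      have e3 : (halfMod n : ZMod n) * w.hessForm (fun i => (c i : ZMod n) - 2 * k i)
          (fun i => (c i : ZMod n) - 2 * k i) =
          halfMod n * w.hessForm (fun i => (c i : ZMod n)) (fun i => (c i : ZMod n)) +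
            2 * w.hessForm k k - 2 * w.hessForm (fun i => (c i : ZMod n)) k := by
        simp only [hessForm, Finset.mul_sum]
        rw [← Finset.sum_add_distrib, ← Finset.sum_sub_distrib]
        refine Finset.sum_congr rfl fun i _ => ?_
        split_ifs
        · linear_combination (4 * k i * k (i - 1) - 2 * (c i * k (i - 1) + c (i - 1) * k i)) *
            two_mul_halfMod hn
        · linear_combination (2 * (k i - k (i - 1)) ^ 2 -
            2 * (c i - c (i - 1)) * (k i - k (i - 1))) * two_mul_halfMod hn
      have e4 : ∑ i, ((2 * (c i : ℤ) * -(w.hess K i) : ℤ) : ZMod n) =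
          -2 * w.hessForm (fun i => (c i : ZMod n)) k := by
        rw [← e1, Finset.mul_sum]
        refine Finset.sum_congr rfl fun i _ => ?_
        push_cast
        ring
      have e5 : ((∑ i, K i * (w.eta i - 2 * m * w.beta i) : ℤ) : ZMod n) =
          ∑ i, k i * w.eta i - 2 * m * ∑ i, k i * w.beta i := by
        push_cast
        simp only [hKk]
        rw [Finset.mul_sum, ← Finset.sum_sub_distrib]
        refine Finset.sum_congr rfl fun i _ => ?_
        ring
      have e6 : ∑ i, (((m * w.beta i - halfMod n * w.eta i) * (-2 * K i) : ℤ) : ZMod n) =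
          2 * halfMod n * ∑ i, k i * w.eta i - 2 * m * ∑ i, k i * w.beta i := by
        push_cast
        simp only [hKk]
        rw [Finset.mul_sum, Finset.mul_sum, ← Finset.sum_sub_distrib]
        refine Finset.sum_congr rfl fun i _ => ?_
        ring
      rw [Int.cast_mul, Int.cast_mul, Int.cast_add, e5, Int.cast_mul, e2, e3, e4, e6]
      push_cast
      linear_combination (2 * w.hessForm k k - 2 * m * ∑ i, k i * (w.beta i : ZMod n)) *
        two_mul_halfMod hn
    have h7 := congrArg χ h6
    simp only [AddChar.map_add_eq_mul] at h7
    linear_combination ((-1 : ℂ) ^ J * Complex.exp (-(Real.pi * Complex.I / n * J))) * h7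
  rw [w.summand_eq ε p z f f' m θ k, ha, Finset.prod_mul_distrib (f := fun i =>
    AddChar.zmodChar n (w.dRoot_pow m hn hq.pow_eq_one i) ((c i : ZMod n) - 2 * k i))]
  rw [mul_assoc, hpoch, ← mul_assoc, hphase]
  ring

end

end LRWord

namespace LRWord

variable {N : ℕ} [NeZero N] (w : LRWord N) (ε : ℤˣ) (p : ZMod N) (z : ZMod N → ℂ)
  (f f' : ZMod N → ℤ) (m : ℤ) {n : ℕ} [NeZero n]
  {q : ℂ} (hz : (w.layered ε).IsGeometricSolution (w.longitude ε) z)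

include hz in
theorem sum_summand_mul_prod_weight (hn : Odd n) (hq : IsPrimitiveRoot q n) {a : ℤ}
    (ha : expTwoPi (a / n) = q ^ 2) {θ : ZMod N → ℂ} {c : ZMod N → ℕ}
    (hθ : ∀ i, θ i = bwyTheta z n i * (q ^ 2) ^ c i) :
    ∃ ω : ℂ, ω ^ n = 1 ∧ (∑ k, (w.nzDatum ε p z f f').summand 2 (w.halfB p) θ m n a k) *
        ∏ i, weight z n q i (c i) =
      ω * ((Real.sqrt n : ℂ) ^ N * (w.bwyMatrix z w.eta m n q).trace) := by
  have hs : (Real.sqrt n : ℂ) ^ N ≠ 0 := by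
    refine pow_ne_zero _ (Complex.ofReal_ne_zero.2 (Real.sqrt_ne_zero'.2 ?_))
    exact_mod_cast NeZero.pos n
  have hbij : Function.Bijective fun (k : ZMod N → ZMod n) i => (c i : ZMod n) - 2 * k i := by
    refine Finite.injective_iff_bijective.1 fun k k' h => ?_
    ext i
    have h1 : (c i : ZMod n) - 2 * k i = c i - 2 * k' i := congrFun h i
    linear_combination (-(halfMod n : ZMod n)) * h1 - (k i - k' i) * two_mul_halfMod hn
  refine ⟨AddChar.zmodChar n hq.pow_eq_one (-(halfMod n * w.hessForm (fun i => (c i : ZMod n))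
    (fun i => (c i : ZMod n)))) *
    ∏ i, AddChar.zmodChar n (w.dRoot_pow m hn hq.pow_eq_one i) (-(c i : ZMod n)), ?_, ?_⟩
  · have h1 : ∀ (u : ℂ) (hu : u ^ n = 1) (x : ZMod n), AddChar.zmodChar n hu x ^ n = 1 := by
      intro u hu x
      rw [AddChar.zmodChar_apply, ← pow_mul, mul_comm, pow_mul, hu, one_pow]
    rw [mul_pow, h1, one_mul, ← Finset.prod_pow]
    exact Finset.prod_eq_one fun i _ => h1 _ _ _
  · rw [w.trace_bwyMatrix z m hn hq, mul_inv_cancel_left₀ hs, Finset.sum_mul]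
    simp only [w.summand_mul_prod_weight ε p z f f' m hz hn hq ha hθ]
    rw [← Finset.mul_sum]
    congr 1
    exact Fintype.sum_bijective _ hbij _ _ fun k => rfl

include hz in
/-- The prefactors with the flattening, up to roots of unity. -/
theorem exp_flattening_pow (hf : (w.nzDatum ε p z f f').IsFlattening) (hn : Odd n) :
    (Complex.exp ((1 - n) / (2 * n) * ∑ i, (f i : ℂ) * Complex.log (ShapeLabel.z'.val (z i))) *
      Complex.exp ((n - 1) / (2 * n) * ∑ i, (f' i : ℂ) * Complex.log (z i))) ^ (12 * n) =
      ∏ i, (z i ^ ((n - 1) / 2)) ^ 12 := by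
  have hn0 : (n : ℂ) ≠ 0 := Nat.cast_ne_zero.2 (NeZero.ne n)
  have hz0 : ∀ j, z j ≠ 0 := fun j h => by have := hz.im_pos j; rw [h] at this; simp at this
  rw [isFlattening_iff] at hf
  set y : ZMod N → ℂ := fun i => Complex.log (ShapeLabel.z'.val (z i)) with hy
  set x : ZMod N → ℂ := fun i => Complex.log (z i) with hx
  have hlog : ∀ i, w.hess y i = Real.pi * Complex.I * (w.eta i : ℂ) - 2 * x i := fun i => by
    rw [← w.hess_log_add ε z hz i]; ring
  have hf1 : ∀ i, 2 * (f i : ℂ) = w.eta i - w.hess (fun j => (f' j : ℂ)) i := fun i => by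
    rw [← hf i, ← hess_intCast]; push_cast; ring
  -- contract the equations of the flattening with `log z'`, and use the symmetry of the form
  have h1 : ∑ i, w.hess (fun j => (f' j : ℂ)) i * y i =
      Real.pi * Complex.I * ∑ i, (f' i : ℂ) * w.eta i - 2 * ∑ i, (f' i : ℂ) * x i := by
    have h := w.sum_mul_hess y (fun j => (f' j : ℂ))
    rw [hessForm_comm, ← w.sum_mul_hess] at h
    simp only [hlog] at h
    simp only [mul_comm (w.hess (fun j => (f' j : ℂ)) _), h]
    rw [Finset.mul_sum, Finset.mul_sum, ← Finset.sum_sub_distrib]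
    exact Finset.sum_congr rfl fun i _ => by ring
  have h2 : ∑ i, (w.eta i : ℂ) * y i =
      Real.pi * Complex.I * ∑ i, (w.eta i : ℂ) - 2 * ∑ i, x i := by
    have h := w.sum_mul_hess y (fun j => (1 : ℂ))
    rw [hessForm_comm, ← w.sum_mul_hess] at h
    simp only [hlog, one_mul] at h
    have h3 : ∀ i, (w.eta i : ℂ) = w.hess (fun j => (1 : ℂ)) i := fun i => by
      rw [eta, hess_intCast]; simp
    rw [Finset.mul_sum, Finset.mul_sum, ← Finset.sum_sub_distrib, ← h]
    exact Finset.sum_congr rfl fun i _ => by rw [h3, mul_comm]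
  have h3 : 2 * ∑ i, (f i : ℂ) * y i =
      (∑ i, (w.eta i : ℂ) * y i) - ∑ i, w.hess (fun j => (f' j : ℂ)) i * y i := by
    rw [Finset.mul_sum, ← Finset.sum_sub_distrib]
    exact Finset.sum_congr rfl fun i _ => by rw [← mul_assoc, hf1, sub_mul]
  rw [h1, h2] at h3
  obtain ⟨t, ht⟩ := hn
  have ht1 : (n - 1) / 2 = t := by omega
  have ht2 : (n : ℂ) = 2 * t + 1 := by rw [ht]; push_cast; ring
  have hR : ∏ i, (z i ^ ((n - 1) / 2)) ^ 12 = Complex.exp (12 * t * ∑ i, x i) := by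
    rw [Finset.mul_sum, Complex.exp_sum]
    refine Finset.prod_congr rfl fun i _ => ?_
    rw [ht1, ← pow_mul, ← Complex.exp_log (hz0 i), ← Complex.exp_nat_mul]
    congr 1
    push_cast
    ring
  rw [hR, ← Complex.exp_add, ← Complex.exp_nat_mul, Complex.exp_eq_exp_iff_exists_int]
  refine ⟨-3 * t * (∑ i, w.eta i - ∑ i, f' i * w.eta i), ?_⟩
  push_cast
  have hlin : 12 * (n : ℂ) * ((1 - n) / (2 * n) * ∑ i, (f i : ℂ) * y i +
      (n - 1) / (2 * n) * ∑ i, (f' i : ℂ) * x i) =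
      12 * t * (∑ i, (f' i : ℂ) * x i - ∑ i, (f i : ℂ) * y i) := by
    field_simp
    rw [ht2]
    ring
  rw [hlin]
  linear_combination (-6 * (t : ℂ)) * h3

include hz in
/-- Comparison of the 1-loop and the BWY invariants up to roots of unity. -/
theorem tauRatio_pow (hf : (w.nzDatum ε p z f f').IsFlattening) (hn : Odd n) {a : ℤ}
    (ha : IsCoprime a (n : ℤ)) {θ : ZMod N → ℂ} (hθ : ∀ i, θ i ^ n = ShapeLabel.z'.val (z i)) :
    (w.nzDatum ε p z f f').tauRatio 2 (w.halfB p) θ m n (2 * a) ^ (12 * n) *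
      (w.bwyMatrix z w.eta m n (expTwoPi (a / n))).det ^ 12 =
      (w.bwyMatrix z w.eta m n (expTwoPi (a / n))).trace ^ (12 * n) := by
  set q := expTwoPi (a / n) with hqdef
  have hq : IsPrimitiveRoot q n := isPrimitiveRoot_expTwoPi ha
  have hQ : IsPrimitiveRoot (q ^ 2) n := hq.pow_of_coprime 2 (Nat.coprime_two_left.2 hn)
  have hz0 : ∀ j, z j ≠ 0 := fun j h => by have := hz.im_pos j; rw [h] at this; simp at this
  have hq2 : expTwoPi ((2 * a : ℤ) / n) = q ^ 2 := by
    rw [hqdef, expTwoPi_pow]; congr 1; push_cast; ring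
  have hq2' : expTwoPi ((-(2 * a) : ℤ) / n) = (q ^ 2)⁻¹ := by
    rw [← hq2, ← expTwoPi_neg]; congr 1; push_cast; ring
  have hcop : IsCoprime (-(2 * a)) (n : ℤ) := by
    refine (IsCoprime.mul_left ?_ ha).neg_left
    exact_mod_cast Nat.isCoprime_iff_coprime.2 (Nat.coprime_two_left.2 hn)
  -- the roots `θ` differ from the standard ones by powers of `q ^ 2`
  have hc : ∀ i, ∃ c : ℕ, θ i = bwyTheta z n i * (q ^ 2) ^ c := by
    intro i
    have hb : bwyTheta z n i ≠ 0 := Complex.exp_ne_zero _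
    have h1 : (θ i / bwyTheta z n i) ^ n = 1 := by
      rw [div_pow, hθ, bwyTheta_pow z i (hz.im_pos i),
        div_self (ShapeLabel.val_z'_ne_zero (hz.im_pos i))]
    obtain ⟨c, -, hc⟩ := hQ.eq_pow_of_pow_eq_one h1
    exact ⟨c, by rw [hc, mul_div_cancel₀ _ hb]⟩
  choose c hc using hc
  obtain ⟨ω, hω, hsum⟩ := w.sum_summand_mul_prod_weight ε p z f f' m hz hn hq hq2 hc
  have hdil : ∀ i, cyclicDilog n (-(2 * a)) (θ i)⁻¹ ^ (12 * n) *
      (∏ l ∈ Finset.range n, weight z n q i l) ^ 12 =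
      (z i ^ ((n - 1) / 2)) ^ 12 * weight z n q i (c i) ^ (12 * n) := by
    intro i
    have hx : (θ i)⁻¹ ^ n = 1 - z i := by rw [inv_pow, hθ, ShapeLabel.inv_val_z']
    rw [cyclicDilog_pow hn hcop]
    · have h1 := prod_pow_mul_prod_normPoch hn hQ (hz0 i)
        (bwyTheta_inv_pow z (n := n) i (hz.im_pos i)) (c i)
      rw [← mul_inv, ← hc i] at h1
      rw [hq2', ← mul_pow]
      simp only [weight]
      rw [h1, mul_pow, ← pow_mul, ← pow_mul, mul_comm n 12]
    · intro j _
      refine one_sub_mul_ne_zero (hz0 i) hx ?_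
      rw [hq2', ← pow_mul, mul_comm, pow_mul, hQ.inv.pow_eq_one, one_pow]
  have hE := w.exp_flattening_pow ε p z f f' hz hf hn
  have hs : (Real.sqrt n : ℂ) ≠ 0 := by
    refine Complex.ofReal_ne_zero.2 (Real.sqrt_ne_zero'.2 ?_)
    exact_mod_cast NeZero.pos n
  rw [w.det_bwyMatrix_pow z m hn hq]
  unfold NZDatum.tauRatio
  rw [ZMod.card]
  set E1 := Complex.exp ((1 - n) / (2 * n) *
    ∑ i, (f i : ℂ) * Complex.log (ShapeLabel.z'.val (z i))) with hE1
  set E2 := Complex.exp ((n - 1) / (2 * n) * ∑ i, (f' i : ℂ) * Complex.log (z i)) with hE2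
  change (1 / ((Real.sqrt n : ℂ) ^ N * E1 * E2) * (∏ i, cyclicDilog n (-(2 * a)) (θ i)⁻¹) *
    ∑ k, (w.nzDatum ε p z f f').summand 2 (w.halfB p) θ m n (2 * a) k) ^ (12 * n) * _ = _
  set S := ∑ k, (w.nzDatum ε p z f f').summand 2 (w.halfB p) θ m n (2 * a) k
  have hE0 : E1 * E2 ≠ 0 := mul_ne_zero (Complex.exp_ne_zero _) (Complex.exp_ne_zero _)
  have h1 : (∏ i, cyclicDilog n (-(2 * a)) (θ i)⁻¹) ^ (12 * n) *
      ∏ i, (∏ l ∈ Finset.range n, weight z n q i l) ^ 12 =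
      (E1 * E2) ^ (12 * n) * (∏ i, weight z n q i (c i)) ^ (12 * n) := by
    rw [← Finset.prod_pow, ← Finset.prod_mul_distrib, hE, ← Finset.prod_pow,
      ← Finset.prod_mul_distrib]
    exact Finset.prod_congr rfl fun i _ => hdil i
  have h2 := congrArg (· ^ (12 * n)) hsum
  simp only [mul_pow] at h2
  rw [mul_comm 12 n, pow_mul ω, hω, one_pow, one_mul, mul_comm n 12] at h2
  rw [mul_assoc ((Real.sqrt n : ℂ) ^ N) E1 E2, mul_pow, mul_pow, div_pow, one_pow,
    mul_pow ((Real.sqrt n : ℂ) ^ N)]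
  have hX : ((Real.sqrt n : ℂ) ^ N) ^ (12 * n) ≠ 0 := pow_ne_zero _ (pow_ne_zero _ hs)
  have hY : (E1 * E2) ^ (12 * n) ≠ 0 := pow_ne_zero _ hE0
  have hfin : ∀ X Y D S P W T : ℂ, X ≠ 0 → Y ≠ 0 → D * P = Y * W → S * W = X * T →
      1 / (X * Y) * D * S * P = T := by
    intro X Y D S P W T hX hY h1 h2
    rw [show 1 / (X * Y) * D * S * P = 1 / (X * Y) * S * (D * P) by ring, h1,
      show 1 / (X * Y) * S * (Y * W) = Y / (X * Y) * (S * W) by ring, h2]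
    field_simp
  exact hfin _ _ _ _ _ _ _ hX hY h1 h2

end LRWord

/-! ### Hyperbolic elements of `SL(2, ℤ)` as words in `L` and `R` -/

/-- The product of the matrices of a word. -/
def letterProd (l : List Letter) : Matrix (Fin 2) (Fin 2) ℤ := (l.map Letter.mat).prod

theorem letterProd_append (l₁ l₂ : List Letter) :
    letterProd (l₁ ++ l₂) = letterProd l₁ * letterProd l₂ := by
  simp [letterProd]

theorem det_letterProd (l : List Letter) : (letterProd l).det = 1 := by
  induction l with
  | nil => simp [letterProd]
  | cons X l ih =>
    rw [letterProd, List.map_cons, List.prod_cons, Matrix.det_mul]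
    rw [letterProd] at ih
    rw [ih, mul_one]
    cases X <;> simp [Letter.mat, Matrix.det_fin_two]

/-- Matrices of determinant one with nonnegative entries are products of `L` and `R`, by the
Euclidean algorithm on the rows. -/
theorem exists_letterProd_eq (s : ℕ) : ∀ a b c d : ℤ, 0 ≤ a → 0 ≤ b → 0 ≤ c → 0 ≤ d →
    a * d - b * c = 1 → a + b + c + d = s → ∃ l, letterProd l = !![a, b; c, d] := by
  induction s using Nat.strong_induction_on with
  | _ s ih =>
  intro a b c d ha hb hc hd hdet hs
  by_cases h1 : c ≤ a ∧ d ≤ b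
  · have hpos : 0 < c + d := by
      by_contra h
      have hc0 : c = 0 := by omega
      have hd0 : d = 0 := by omega
      subst hc0 hd0
      simp at hdet
    obtain ⟨l, hl⟩ := ih (a - c + (b - d) + c + d).toNat (by omega) (a - c) (b - d) c d
      (by omega) (by omega) hc hd (by linear_combination hdet) (by omega)
    refine ⟨.R :: l, ?_⟩
    rw [letterProd, List.map_cons, List.prod_cons, ← letterProd, hl]
    simp [Letter.mat]
  by_cases h2 : a ≤ c ∧ b ≤ d
  · have hpos : 0 < a + b := by
      by_contra h
      have ha0 : a = 0 := by omega
      have hb0 : b = 0 := by omega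
      subst ha0 hb0
      simp at hdet
    obtain ⟨l, hl⟩ := ih (a + b + (c - a) + (d - b)).toNat (by omega) a b (c - a) (d - b)
      ha hb (by omega) (by omega) (by linear_combination hdet) (by omega)
    refine ⟨.L :: l, ?_⟩
    rw [letterProd, List.map_cons, List.prod_cons, ← letterProd, hl]
    simp [Letter.mat]
  · refine ⟨[], ?_⟩
    -- otherwise `a > c`, `b < d`, and the determinant leaves only the identity
    have hac : c < a := by
      by_contra h
      have : d < b := by omega
      nlinarith [mul_nonneg ha hd]
    have hbd : b < d := by omega
    have hb0 : b = 0 := by nlinarith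
    have hc0 : c = 0 := by nlinarith
    subst hb0 hc0
    have ha1 : a = 1 := by nlinarith
    subst ha1
    have hd1 : d = 1 := by linarith
    subst hd1
    simp [letterProd, Matrix.one_fin_two]

/-- The matrix `g'` is conjugate to `g` by an element of `SL(2, ℤ)`. -/
def SLConj (g g' : Matrix (Fin 2) (Fin 2) ℤ) : Prop :=
  ∃ h : SL(2, ℤ), (h : Matrix (Fin 2) (Fin 2) ℤ) * g = g' * h

theorem SLConj.trans {g₁ g₂ g₃ : Matrix (Fin 2) (Fin 2) ℤ} (h : SLConj g₁ g₂) (h' : SLConj g₂ g₃) :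
    SLConj g₁ g₃ := by
  obtain ⟨x, hx⟩ := h
  obtain ⟨y, hy⟩ := h'
  refine ⟨y * x, ?_⟩
  rw [Matrix.SpecialLinearGroup.coe_mul, mul_assoc, hx, ← mul_assoc, hy, mul_assoc]

theorem slConj_R (k a b c d : ℤ) :
    SLConj !![a, b; c, d] !![a + k * c, b + k * d - k * a - k ^ 2 * c; c, d - k * c] := by
  refine ⟨⟨!![1, k; 0, 1], by simp [Matrix.det_fin_two]⟩, ?_⟩
  ext i j
  fin_cases i <;> fin_cases j <;> simp [Matrix.mul_apply, Fin.sum_univ_two] <;> ring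

theorem slConj_L (k a b c d : ℤ) :
    SLConj !![a, b; c, d] !![a - k * b, b; c + k * a - k * d - k ^ 2 * b, d + k * b] := by
  refine ⟨⟨!![1, 0; k, 1], by simp [Matrix.det_fin_two]⟩, ?_⟩
  ext i j
  fin_cases i <;> fin_cases j <;> simp [Matrix.mul_apply, Fin.sum_univ_two] <;> ring

theorem slConj_rot (a b c d : ℤ) : SLConj !![a, b; c, d] !![d, -c; -b, a] := by
  refine ⟨⟨!![0, -1; 1, 0], by simp [Matrix.det_fin_two]⟩, ?_⟩
  ext i j
  fin_cases i <;> fin_cases j <;> simp [Matrix.mul_apply, Fin.sum_univ_two]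

theorem exists_abs_add_two_mul_lt {c e : ℤ} (hc0 : c ≠ 0) (hc : |c| < |e|) :
    ∃ k : ℤ, |e + 2 * (k * c)| < |e| := by
  simp only [Int.abs_eq_natAbs] at *
  by_cases h : (0 ≤ e ∧ 0 ≤ c) ∨ (e < 0 ∧ c < 0)
  · exact ⟨-1, by rw [neg_one_mul]; omega⟩
  · exact ⟨1, by rw [one_mul]; omega⟩

/-- A matrix of determinant one and trace at least three is conjugate to one with nonnegative
entries, by reduction of the difference of the diagonal entries. -/
theorem exists_slConj_nonneg (s : ℕ) : ∀ a b c d : ℤ, a * d - b * c = 1 → 2 < a + d →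
    (a - d).natAbs = s → ∃ a' b' c' d' : ℤ, 0 ≤ a' ∧ 0 ≤ b' ∧ 0 ≤ c' ∧ 0 ≤ d' ∧
      a' * d' - b' * c' = 1 ∧ 2 < a' + d' ∧ SLConj !![a, b; c, d] !![a', b'; c', d'] := by
  induction s using Nat.strong_induction_on with
  | _ s ih =>
  intro a b c d hdet htr hs
  have hdiag : ∀ b c : ℤ, 0 < b → 0 < c → a * d - b * c = 1 → 0 ≤ a ∧ 0 ≤ d := by
    intro b c hb hc hdet
    have : 0 < a * d := by nlinarith [mul_pos hb hc]
    rcases pos_and_pos_or_neg_and_neg_of_mul_pos this with h | h <;> omega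
  rcases lt_trichotomy (b * c) 0 with hbc | hbc | hbc
  · have hstep : ∀ a' b' c' d' : ℤ, SLConj !![a, b; c, d] !![a', b'; c', d'] →
        a' * d' - b' * c' = 1 → a' + d' = a + d → |a' - d'| < |a - d| →
        ∃ a' b' c' d' : ℤ, 0 ≤ a' ∧ 0 ≤ b' ∧ 0 ≤ c' ∧ 0 ≤ d' ∧
          a' * d' - b' * c' = 1 ∧ 2 < a' + d' ∧ SLConj !![a, b; c, d] !![a', b'; c', d'] := by
      intro a' b' c' d' hconj hdet' htr' hlt
      obtain ⟨a2, b2, c2, d2, h1, h2, h3, h4, h5, h6, h7⟩ :=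
        ih (a' - d').natAbs (by simp only [Int.abs_eq_natAbs] at hlt; omega) a' b' c' d' hdet'
          (by omega) rfl
      exact ⟨a2, b2, c2, d2, h1, h2, h3, h4, h5, h6, hconj.trans h7⟩
    have hb0 : b ≠ 0 := by rintro rfl; simp at hbc
    have hc0 : c ≠ 0 := by rintro rfl; simp at hbc
    have had : a * d ≤ 0 := by linarith
    by_cases hc : |c| < |a - d|
    · obtain ⟨k, hk⟩ := exists_abs_add_two_mul_lt hc0 hc
      refine hstep _ _ _ _ (slConj_R k a b c d) (by linear_combination hdet) (by ring) ?_
      convert hk using 2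
      ring
    by_cases hb : |b| < |a - d|
    · obtain ⟨k, hk⟩ := exists_abs_add_two_mul_lt hb0 hb
      refine hstep _ _ _ _ (slConj_L (-k) a b c d) (by linear_combination hdet) (by ring) ?_
      convert hk using 2
      ring
    · exfalso
      push Not at hb hc
      have h1 : |a - d| * |a - d| ≤ |b| * |c| :=
        mul_le_mul hb hc (abs_nonneg _) (abs_nonneg _)
      rw [abs_mul_abs_self, ← abs_mul, abs_of_neg hbc] at h1
      nlinarith
  · exfalso
    have h1 : a * d = 1 := by linarith
    rcases Int.eq_one_or_neg_one_of_mul_eq_one' h1 with ⟨rfl, rfl⟩ | ⟨rfl, rfl⟩ <;> omega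
  · rcases pos_and_pos_or_neg_and_neg_of_mul_pos hbc with ⟨h1, h2⟩ | ⟨h1, h2⟩
    · obtain ⟨h3, h4⟩ := hdiag b c h1 h2 hdet
      exact ⟨a, b, c, d, h3, h1.le, h2.le, h4, hdet, htr, ⟨1, by simp⟩⟩
    · obtain ⟨h3, h4⟩ := hdiag (-c) (-b) (by omega) (by omega) (by linarith)
      exact ⟨d, -c, -b, a, h4, by omega, by omega, h3, by linarith, by omega, slConj_rot a b c d⟩

theorem letterProd_replicate_L (k : ℕ) :
    letterProd (List.replicate k .L) = !![1, 0; (k : ℤ), 1] := by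
  induction k with
  | zero => simp [letterProd, Matrix.one_fin_two]
  | succ k ih =>
    rw [List.replicate_succ, letterProd, List.map_cons, List.prod_cons, ← letterProd, ih]
    simp [Letter.mat, add_comm]

theorem letterProd_replicate_R (k : ℕ) :
    letterProd (List.replicate k .R) = !![1, (k : ℤ); 0, 1] := by
  induction k with
  | zero => simp [letterProd, Matrix.one_fin_two]
  | succ k ih =>
    rw [List.replicate_succ, letterProd, List.map_cons, List.prod_cons, ← letterProd, ih]
    simp [Letter.mat, add_comm]

theorem mem_of_trace_ne {l : List Letter} (h : (letterProd l).trace ≠ 2) (X : Letter) : X ∈ l := by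
  by_contra hX
  apply h
  cases X
  · have : l = List.replicate l.length .R := List.eq_replicate_iff.2 ⟨rfl, fun Y hY => by
      cases Y
      · exact absurd hY hX
      · rfl⟩
    rw [this, letterProd_replicate_R]
    simp [Matrix.trace_fin_two]
  · have : l = List.replicate l.length .L := List.eq_replicate_iff.2 ⟨rfl, fun Y hY => by
      cases Y
      · rfl
      · exact absurd hY hX⟩
    rw [this, letterProd_replicate_L]
    simp [Matrix.trace_fin_two]

/-- A word with both letters has a rotation of the form `L ⋯ R`. -/
theorem exists_rotation {l : List Letter} (hL : .L ∈ l) (hR : .R ∈ l) :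
    ∃ l₁ l₂ l₃, l = l₁ ++ l₂ ∧ l₂ ++ l₁ = .L :: (l₃ ++ [.R]) := by
  cases l with
  | nil => simp at hL
  | cons X l =>
    cases X
    · -- move the final letters `L` to the front
      obtain ⟨s, t, hst, ht⟩ := List.eq_append_cons_of_mem (List.mem_reverse.2 hR)
      have h1 : Letter.L :: l = t.reverse ++ (.R :: s.reverse) := by
        rw [← List.reverse_reverse (Letter.L :: l), hst]; simp
      have hs : s.reverse = List.replicate s.length .L := List.eq_replicate_iff.2
        ⟨by simp, fun Y hY => by
          cases Y
          · rfl
          · exact absurd (List.mem_reverse.1 hY) ht⟩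
      cases hr : t.reverse with
      | nil => rw [hr] at h1; simp at h1
      | cons Y u =>
        rw [hr, List.cons_append] at h1
        obtain ⟨rfl, h2⟩ := List.cons.inj h1
        cases hk : s.length with
        | zero =>
          rw [hk] at hs
          refine ⟨[], .L :: l, u, rfl, ?_⟩
          rw [h2, hs]; simp
        | succ k =>
          rw [hk] at hs
          refine ⟨.L :: (u ++ [.R]), s.reverse, List.replicate k .L ++ (.L :: u), ?_, ?_⟩
          · rw [h2]; simp
          · rw [hs, List.replicate_succ]; simp
    · -- move the initial letters `R` to the end
      obtain ⟨s, t, hst, hs⟩ := List.eq_append_cons_of_mem hL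
      have hs' : s = List.replicate s.length .R := List.eq_replicate_iff.2
        ⟨rfl, fun Y hY => by
          cases Y
          · exact absurd hY hs
          · rfl⟩
      cases hk : s.length with
      | zero =>
        rw [hk] at hs'
        rw [hs'] at hst
        simp at hst
      | succ k =>
        rw [hk] at hs'
        refine ⟨s, .L :: t, t ++ List.replicate k .R, hst, ?_⟩
        rw [hs', List.replicate_succ']
        simp

/-- The cyclic word of a list of the form `L ⋯ R`. -/
theorem exists_lrWord (l : List Letter) :
    ∃ w : LRWord (l.length + 2), w.mat = letterProd (.L :: (l ++ [.R])) := by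
  set u := Letter.L :: (l ++ [.R]) with hu
  have hlen : u.length = l.length + 2 := by simp [hu]
  refine ⟨⟨fun j => u.getD (j - 1).val .L, ?_, ?_⟩, ?_⟩
  · simp [hu]
  · have h : ((0 : ZMod (l.length + 2)) - 1).val = l.length + 1 := by
      rw [zero_sub, ZMod.val_neg_one]
    rw [h, hu, List.getD_cons_succ]
    simp
  · rw [LRWord.mat, letterProd]
    congr 1
    refine List.ext_getElem (by simp [hlen]) fun i h1 h2 => ?_
    have hi : i < l.length + 2 := by simpa using h1
    rw [List.getElem_map, List.getElem_map, List.getElem_range]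
    congr 1
    have h3 : (((i + 1 : ℕ) : ZMod (l.length + 2)) - 1).val = i := by
      rw [Nat.cast_add, Nat.cast_one, add_sub_cancel_right, ZMod.val_cast_of_lt hi]
    change u.getD _ _ = _
    rw [h3, List.getD_eq_getElem]

/-- Every hyperbolic element of `SL(2, ℤ)` is conjugate to `± L ⋯ R`. -/
theorem exists_lrWord_conj (g : SL(2, ℤ))
    (hg : 2 < |Matrix.trace (g : Matrix (Fin 2) (Fin 2) ℤ)|) :
    ∃ (N : ℕ) (_ : NeZero N) (w : LRWord N) (ε : ℤˣ) (h : SL(2, ℤ)),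
      ((h * g * h⁻¹ : SL(2, ℤ)) : Matrix (Fin 2) (Fin 2) ℤ) = (ε : ℤ) • w.mat := by
  obtain ⟨ε, hε⟩ : ∃ ε : ℤˣ, 2 < (ε : ℤ) * Matrix.trace (g : Matrix (Fin 2) (Fin 2) ℤ) := by
    rcases abs_cases (Matrix.trace (g : Matrix (Fin 2) (Fin 2) ℤ)) with ⟨h, -⟩ | ⟨h, -⟩
    · exact ⟨1, by rw [h] at hg; simpa using hg⟩
    · exact ⟨-1, by rw [h] at hg; simpa using hg⟩
  set G : Matrix (Fin 2) (Fin 2) ℤ := (g : Matrix (Fin 2) (Fin 2) ℤ) with hG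
  have hεε : (ε : ℤ) * ε = 1 := by rcases Int.units_eq_one_or ε with rfl | rfl <;> simp
  have hdet : G 0 0 * G 1 1 - G 0 1 * G 1 0 = 1 := by
    rw [← Matrix.det_fin_two]; exact g.2
  obtain ⟨a, b, c, d, ha, hb, hc, hd, hdet', htr, h, hh⟩ := exists_slConj_nonneg _
    (ε * G 0 0) (ε * G 0 1) (ε * G 1 0) (ε * G 1 1)
    (by linear_combination hdet + (G 0 0 * G 1 1 - G 0 1 * G 1 0) * hεε)
    (by rw [Matrix.trace_fin_two] at hε; linarith) rfl
  obtain ⟨l, hl⟩ := exists_letterProd_eq (a + b + c + d).toNat a b c d ha hb hc hd hdet' (by omega)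
  have htr' : (letterProd l).trace ≠ 2 := by
    rw [hl, Matrix.trace_fin_two]
    simp only [Matrix.of_apply, Matrix.cons_val', Matrix.cons_val_zero, Matrix.cons_val_one,
      Matrix.cons_val_fin_one]
    omega
  obtain ⟨l₁, l₂, l₃, h1, h2⟩ := exists_rotation (mem_of_trace_ne htr' .L) (mem_of_trace_ne htr' .R)
  obtain ⟨w, hw⟩ := exists_lrWord l₃
  obtain ⟨P, hP⟩ : ∃ P : SL(2, ℤ), (P : Matrix (Fin 2) (Fin 2) ℤ) = letterProd l₂ :=
    ⟨⟨letterProd l₂, det_letterProd l₂⟩, rfl⟩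
  refine ⟨l₃.length + 2, inferInstance, w, ε, P * h, ?_⟩
  have hGε : (!![ε * G 0 0, ε * G 0 1; ε * G 1 0, ε * G 1 1] : Matrix (Fin 2) (Fin 2) ℤ) =
      (ε : ℤ) • G := by
    ext i j; fin_cases i <;> fin_cases j <;> simp
  rw [hGε, ← hl, h1, letterProd_append] at hh
  set H : SL(2, ℤ) := P * h with hH
  have hHc : (H : Matrix (Fin 2) (Fin 2) ℤ) = letterProd l₂ * h := by
    rw [hH, Matrix.SpecialLinearGroup.coe_mul, hP]
  have hHG : (ε : ℤ) • ((H : Matrix (Fin 2) (Fin 2) ℤ) * G) = w.mat * H := by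
    rw [hw, ← h2, letterProd_append, hHc, ← Matrix.mul_smul, mul_assoc, hh]
    simp only [mul_assoc]
  have hHG' : (H : Matrix (Fin 2) (Fin 2) ℤ) * G = (ε : ℤ) • (w.mat * H) := by
    rw [← hHG, smul_smul, hεε, one_smul]
  have hinv : (H : Matrix (Fin 2) (Fin 2) ℤ) * ((H⁻¹ : SL(2, ℤ)) : Matrix (Fin 2) (Fin 2) ℤ) = 1 := by
    rw [← Matrix.SpecialLinearGroup.coe_mul, mul_inv_cancel, Matrix.SpecialLinearGroup.coe_one]
  rw [Matrix.SpecialLinearGroup.coe_mul, Matrix.SpecialLinearGroup.coe_mul, ← hG, hHG',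
    Matrix.smul_mul, mul_assoc, hinv, mul_one]

/-! ### The comparison -/

namespace LRWord

variable {N : ℕ} [NeZero N] (w : LRWord N) (ε : ℤˣ) (p : ZMod N) (z : ZMod N → ℂ)
  (f f' : ZMod N → ℤ) (m : ℤ) {n : ℕ} [NeZero n] {a : ℤ}

/-- `B` is twice a unimodular matrix, so that only `d = 2` occurs in the 1-loop invariant. -/
theorem eq_halfB {d : ℕ} (hd : d = 1 ∨ d = 2) {U : Matrix (ZMod N) (ZMod N) ℤ}
    (hB : (w.nzDatum ε p z f f').B = (d : ℤ) • U) (hU : IsUnit U.det) :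
    d = 2 ∧ U = w.halfB p := by
  rw [nzDatum_B] at hB
  rcases hd with rfl | rfl
  · exfalso
    rw [Nat.cast_one, one_smul] at hB
    rw [← hB, Matrix.det_smul, ZMod.card] at hU
    have h2 : IsUnit ((2 : ℤ) ^ N) := isUnit_of_mul_isUnit_left hU
    have h3 : IsUnit (2 : ℤ) := (isUnit_pow_iff (NeZero.ne N)).1 h2
    exact absurd (Int.isUnit_iff.1 h3) (by decide)
  · refine ⟨rfl, ?_⟩
    ext i j
    have := congrFun (congrFun hB i) j
    simp only [Matrix.smul_apply, smul_eq_mul, Nat.cast_ofNat] at this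
    omega

theorem eq_eta {η : ZMod N → ℤ}
    (h : (w.nzDatum ε p z f f').B *ᵥ η = (2 : ℤ) • (w.nzDatum ε p z f f').ν) : η = w.eta := by
  apply w.halfB_mulVec_inj p
  rw [nzDatum_B, Matrix.smul_mulVec, ← w.halfB_mulVec_eta ε p z f f'] at h
  exact smul_right_injective _ (two_ne_zero (α := ℤ)) h

theorem nzDatum_B_mulVec_eta : (w.nzDatum ε p z f f').B *ᵥ w.eta =
    (2 : ℤ) • (w.nzDatum ε p z f f').ν := by
  rw [nzDatum_B, Matrix.smul_mulVec, w.halfB_mulVec_eta ε p z f f']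

theorem tau_nonempty (hz : ∀ j, 0 < (z j).im) (b : ℤ) :
    ((w.nzDatum ε p z f f').tau m n b).Nonempty := by
  obtain ⟨t, ht⟩ := w.tauOne_nonempty ε p z f f' hz
  exact ⟨_, 2, Or.inr rfl, w.halfB p, w.nzDatum_B ε p z f f', w.isUnit_det_halfB p,
    bwyTheta z n, fun i => bwyTheta_pow z i (hz i), t, ht, rfl⟩

theorem det_bwyMatrix_ne_zero (hz : ∀ j, 0 < (z j).im) (hn : Odd n) (ha : IsCoprime a (n : ℤ)) :
    (w.bwyMatrix z w.eta m n (expTwoPi (a / n))).det ≠ 0 := by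
  have hz0 : ∀ j, z j ≠ 0 := fun j h => by have := hz j; rw [h] at this; simp at this
  have hq := isPrimitiveRoot_expTwoPi (n := n) ha
  have hQ := hq.pow_of_coprime 2 (Nat.coprime_two_left.2 hn)
  have h : (w.bwyMatrix z w.eta m n (expTwoPi (a / n))).det ^ 12 ≠ 0 := by
    rw [w.det_bwyMatrix_pow z m hn hq]
    exact Finset.prod_ne_zero_iff.2 fun i _ => pow_ne_zero _ (Finset.prod_ne_zero_iff.2 fun l _ =>
      normPoch_ne_zero hQ (hz0 i) (bwyTheta_inv_pow z i (hz i)) l)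
  exact fun h0 => h (by rw [h0, zero_pow (by norm_num)])

theorem bwy_nonempty (hz : ∀ j, 0 < (z j).im) (hn : Odd n) (ha : IsCoprime a (n : ℤ)) :
    (w.bwy (w.nzDatum ε p z f f') m n a).Nonempty := by
  have h := w.det_bwyMatrix_ne_zero z m hz hn ha
  obtain ⟨r, hr⟩ := IsAlgClosed.exists_pow_nat_eq
    (w.bwyMatrix z w.eta m n (expTwoPi (a / n))).det (NeZero.pos n)
  refine ⟨_, w.eta, w.nzDatum_B_mulVec_eta ε p z f f', r, ?_, hr, rfl⟩
  rintro rfl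
  rw [zero_pow (NeZero.ne n)] at hr
  exact h hr.symm

theorem tau_eq_mul_bwy (hz : (w.layered ε).IsGeometricSolution (w.longitude ε) z)
    (hf : (w.nzDatum ε p z f f').IsFlattening) (hn : Odd n) (ha : IsCoprime a (n : ℤ)) {τ τ₁ t : ℂ}
    (hτ : τ ∈ (w.nzDatum ε p z f f').tau m n (2 * a))
    (hτ₁ : τ₁ ∈ (w.nzDatum ε p z f f').tauOne)
    (ht : t ∈ w.bwy (w.nzDatum ε p z f f') m n a) :
    ∃ k : ℤ, τ = expTwoPi (k / (12 * n)) * τ₁ * t := by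
  obtain ⟨d, hd, U, hB, hU, θ, hθ, t₁, ht₁, rfl⟩ := hτ
  obtain ⟨rfl, rfl⟩ := w.eq_halfB ε p z f f' hd hB hU
  obtain ⟨η, hη, r, hr0, hr, rfl⟩ := ht
  obtain rfl := w.eq_eta ε p z f f' hη
  have hn12 : 12 * n ≠ 0 := mul_ne_zero (by norm_num) (NeZero.ne n)
  have hsq : t₁ ^ 2 = τ₁ ^ 2 := by
    simp only [NZDatum.tauOne, Set.mem_ofPred_eq] at ht₁ hτ₁
    exact mul_right_cancel₀ (right_ne_zero_of_mul_eq_one hτ₁) (ht₁.trans hτ₁.symm)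
  have hpow := w.tauRatio_pow ε p z f f' m hz hf hn ha hθ
  have hdet : (w.bwyMatrix z w.eta m n (expTwoPi (a / n))).det ^ 12 = r ^ (12 * n) := by
    rw [mul_comm, pow_mul]
    exact congrArg (· ^ 12) hr.symm
  rw [hdet] at hpow
  set ρ := (w.nzDatum ε p z f f').tauRatio 2 (w.halfB p) θ m n (2 * a)
  have hρ : (t₁ * ρ) ^ (12 * n) =
      (τ₁ * ((w.bwyMatrix z w.eta m n (expTwoPi (a / n))).trace / r)) ^ (12 * n) := by
    have h1 : t₁ ^ (12 * n) = τ₁ ^ (12 * n) := by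
      rw [show 12 * n = 2 * (6 * n) by ring, pow_mul, hsq, ← pow_mul]
    rw [mul_pow, mul_pow, div_pow, h1, ← hpow, mul_div_cancel_right₀ _ (pow_ne_zero _ hr0)]
  change ∃ k : ℤ, t₁ * ρ = expTwoPi (k / (12 * n)) * τ₁ *
    ((w.bwyMatrix z w.eta m n (expTwoPi (a / n))).trace / r)
  set y := τ₁ * ((w.bwyMatrix z w.eta m n (expTwoPi (a / n))).trace / r) with hy
  by_cases hy0 : y = 0
  · rw [hy0, zero_pow hn12] at hρ
    refine ⟨0, ?_⟩
    rw [mul_assoc, ← hy, hy0, eq_zero_of_pow_eq_zero hρ, mul_zero]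
  · obtain ⟨k, hk⟩ := exists_expTwoPi_of_pow_eq_one hn12 (x := t₁ * ρ / y)
      (by rw [div_pow, hρ, div_self (pow_ne_zero _ hy0)])
    refine ⟨k, ?_⟩
    rw [mul_assoc, ← hy, ← div_eq_iff hy0, hk]
    push_cast
    rfl

end LRWord

end

theorem theorem1 (φ : PuncturedTorus ≃ₜ PuncturedTorus) (hφ : IsPseudoAnosov φ) :
    (∃ (N : ℕ) (_ : NeZero N) (w : LRWord N) (ε : ℤˣ), IsMonodromy φ w ε) ∧
    ∀ (N : ℕ) [NeZero N] (w : LRWord N) (ε : ℤˣ), IsMonodromy φ w ε →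
    ∀ z : ZMod N → ℂ, (w.layered ε).IsGeometricSolution (w.longitude ε) z →
    ∀ p : ZMod N,
      (∃ f f' : ZMod N → ℤ, (w.nzDatum ε p z f f').IsFlattening) ∧
      ∀ f f' : ZMod N → ℤ, (w.nzDatum ε p z f f').IsFlattening →
      ∀ (n : ℕ) [NeZero n], Odd n → ∀ a : ℤ, IsCoprime a (n : ℤ) → ∀ m : ℤ,
        (w.nzDatum ε p z f f').tauOne.Nonempty ∧
        ((w.nzDatum ε p z f f').tau m n (2 * a)).Nonempty ∧
        (w.bwy (w.nzDatum ε p z f f') m n a).Nonempty ∧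
        ∀ τ ∈ (w.nzDatum ε p z f f').tau m n (2 * a),
        ∀ τ₁ ∈ (w.nzDatum ε p z f f').tauOne,
        ∀ t ∈ w.bwy (w.nzDatum ε p z f f') m n a,
          ∃ k : ℤ, τ = expTwoPi (k / (12 * n)) * τ₁ * t := by
  refine ⟨?_, ?_⟩
  · obtain ⟨g, hφg, hg⟩ := hφ
    obtain ⟨N, hN, w, ε, h, hw⟩ := exists_lrWord_conj g hg
    exact ⟨N, hN, w, ε, g, h, hφg, hw⟩
  · intro N _ w ε _ z hz p
    refine ⟨w.exists_isFlattening ε p z, fun f f' hf n _ hn a ha m => ?_⟩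
    exact ⟨w.tauOne_nonempty ε p z f f' hz.im_pos, w.tau_nonempty ε p z f f' m hz.im_pos _,
      w.bwy_nonempty ε p z f f' m hz.im_pos hn ha, fun τ hτ τ₁ hτ₁ t ht =>
        w.tau_eq_mul_bwy ε p z f f' m hz hf hn ha hτ hτ₁ ht⟩
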